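/- **Setup.** Let $\mathbf F$ be fermionic Fock space over $\mathbb C$, with basis the Maya diagrams (placements of black and white beads at the positions $m\in\mathbb Z+\frac12$ such that all but finitely many $m<0$ are black and all but finitely many $m>0$ are white), i.e. the semi-infinite wedges $e_{m_1}\wedge e_{m_2}\wedge\cdots$, where $m_1>m_2>\cdots$ are the positions of the black beads. For a partition $\lambda$ and $h\in\mathbb Z$, $|\lambda,h\rangle$ is the basis element with black beads at $\lambda_i-i+\frac12+h$, $i\ge1$, and $\mathbf F^{(h)}=\mathrm{span}\{|\lambda,h\rangle\}$. Let $\psi_m v=e_m\wedge v$, and let $\psi_m^*$ send $e_m\wedge v$ to $v$, and $v$ to $0$ if $e_m$ is not a factor of $v$. Let $\mathbf{Cl}$ be the Clifford algebra generated by all $\psi_m,\psi^*_m$, and $\widetilde{\mathbf{Cl}}$ its completion, consisting of the sums $z+\sum_{m<N}X_m\psi_m+\sum_{m>M}Y_m\psi_m^*$ with $z\in\mathbb C$, $X_m,Y_m\in\mathbf{Cl}$; both are regarded as algebras of operators on $\mathbf F$. Let $a_\infty$ be the vector space of formal sums $\sum a_{m,n}\overline E_{m,n}+zc$ ($m,n\in\mathbb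 Z+\frac12$, with $a_{m,n}=0$ for $|m-n|$ large), with $c$ central and $[\overline E_{m,n},\overline E_{p,q}]=\delta_{n,p}\overline E_{m,q}-\delta_{m,q}\overline E_{p,n}+\epsilon_{m,n}\delta_{m,q}\delta_{n,p}\,c$, where $\epsilon_{m,n}=1$ if $m<0<n$, $-1$ if $n<0<m$, and $0$ otherwise. It acts on $\mathbf F$ by $\overline E_{m,n}\mapsto\psi_m\psi_n^*$ if $m\ne n$ or $m>0$, $\overline E_{n,n}\mapsto-\psi_n^*\psi_n$ if $n<0$, $c\mapsto 1$. For $\ell\ge1$ let $\widehat{\mathfrak{gl}}_\ell=(\mathfrak{gl}_\ell\otimes\mathbb C[t,t^{-1}])\oplus\mathbb Cc\oplus\mathbb Cd$ with $[X\otimes t^n,Y\otimes t^m]=(XY-YX)\otimes t^{n+m}+n\,\delta_{n,-m}\mathrm{tr}(XY)\,c$, $[d,X\otimes t^n]=n\,X\otimes t^n$, $c$ central; let $\widehat{\mathfrak{gl}}_\ell'=(\mathfrak{gl}_\ell\otimes\mathbb C[t,t^{-1}])\oplus\mathbb Cc$ and $\widehat{\mathfrak{sl}}_\ell'=(\mathfrak{sl}_\ell\otimes\mathbb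 C[t,t^{-1}])\oplus\mathbb Cc$. Let $X_{i,j}$ be the matrix units. The box of $(\lambda,h)$ in row $r$ and column $s$ (counted from $1$) has colour $h+s-r$ modulo $\ell$. **Proposition.** Let $\ell\ge 1$. 1. There is an injective Lie algebra homomorphism $\widehat{\mathfrak{gl}}_\ell'\to a_\infty$ with $c\mapsto c$ and, for $1\le i,j\le\ell$ and $m\in\mathbb Z$, $$X_{i,j}\otimes t^m\mapsto\sum_{k\in\mathbb Z}\overline E_{i-\frac12+k\ell,\;j-\frac12+k\ell+m\ell}.$$ The action of $a_\infty$ on $\mathbf F$ is a well-defined injective Lie algebra homomorphism from $a_\infty$ to the operators on $\mathbf F$, with image in $\widetilde{\mathbf{Cl}}$. Thus $\widehat{\mathfrak{gl}}_\ell'$ acts on $\mathbf F$, with $c$ acting as $1$ (so it is $\widehat{\mathfrak{gl}}_\ell'/(c-1)$ that is embedded). On $\widehat{\mathfrak{sl}}_\ell'$ this agrees with the action given there by the same formula, extended linearly to $X\in\mathfrak{sl}_\ell$. 2. This action extends to all of $\widehat{\mathfrak{gl}}_\ell$ by letting $d$ act on $|\lambda,h\rangle$ as multiplication by minus the number of boxes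 of $\lambda$ of colour $0$. 3. Each $\mathbf F^{(h)}$ is preserved by $\widehat{\mathfrak{gl}}_\ell$ and is an irreducible representation of it. 4. For $k\neq0$ write $k=q\ell+j$ with $0\le j<\ell$. Then $\sum_{a+j\le\ell}X_{a,a+j}\otimes t^q+\sum_{a+j>\ell}X_{a,a+j-\ell}\otimes t^{q+1}$ (sums over $1\le a\le\ell$) acts on $\mathbf F$ as the Heisenberg generator $\alpha_k=\sum_{m\in\mathbb Z+\frac12}\psi_m\psi^*_{m+k}$ (locally finite sum). These operators satisfy $\alpha_j\alpha_k-\alpha_k\alpha_j=j\,\delta_{j,-k}$ for $j,k\ne0$. -/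

import Mathlib

open scoped TensorProduct

attribute [local instance 100] LieRing.ofAssociativeRing

noncomputable section

/-! ### Indexing

Half-integers are indexed by integers: the integer `p` stands for the half-integer `p - 1/2`.
So the positive half-integers are the `p` with `0 < p`, and the negative ones are the `p ≤ 0`. -/

/-! ### Fermionic Fock space -/

/-- A Maya diagram, given by its set of black beads: all but finitely many negative positions are
black, and all but finitely many positive positions are white. -/
@[ext] structure Maya where
  black : Set ℤ
  finite_black_pos : {p : ℤ | 0 < p ∧ p ∈ black}.Finite
  finite_white_neg : {p : ℤ | p ≤ 0 ∧ p ∉ black}.Finite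

namespace Maya

/-- Put a black bead at position `p`. -/
def insert (M : Maya) (p : ℤ) : Maya where
  black := M.black ∪ {p}
  finite_black_pos := (M.finite_black_pos.union (Set.finite_singleton p)).subset (by
    rintro q ⟨hq, h | h⟩
    · exact Or.inl ⟨hq, h⟩
    · exact Or.inr h)
  finite_white_neg := M.finite_white_neg.subset (by
    rintro q ⟨hq, h⟩
    exact ⟨hq, fun h' => h (Or.inl h')⟩)

/-- Remove the bead at position `p`. -/
def erase (M : Maya) (p : ℤ) : Maya where
  black := M.black \ {p}
  finite_black_pos := M.finite_black_pos.subset (by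
    rintro q ⟨hq, h⟩
    exact ⟨hq, h.1⟩)
  finite_white_neg := (M.finite_white_neg.union (Set.finite_singleton p)).subset (by
    rintro q ⟨hq, h⟩
    by_cases hp : q = p
    · exact Or.inr hp
    · exact Or.inl ⟨hq, fun h' => h ⟨h', hp⟩⟩)

/-- The sign `(-1) ^ #{black beads at positions larger than p}`. -/
def sign (M : Maya) (p : ℤ) : ℂ := (-1) ^ {q : ℤ | p < q ∧ q ∈ M.black}.ncard

/-- The Maya diagram of the charged partition `(lam, h)`, with black beads at the half-integers
`lam_i - i + 1/2 + h` for `i = 1, 2, 3, …`. (Here `r = i - 1`.) -/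
def ofPartition (lam : YoungDiagram) (h : ℤ) : Maya where
  black := {p : ℤ | ∃ r : ℕ, p = (lam.rowLen r : ℤ) - r + h}
  finite_black_pos := (Set.finite_Icc (1 : ℤ) (lam.rowLen 0 + h)).subset (by
    rintro q ⟨hq, r, hr⟩
    have := lam.rowLen_anti 0 r (Nat.zero_le r)
    exact ⟨by omega, by omega⟩)
  finite_white_neg := (Set.finite_Icc (h - lam.colLen 0) (0 : ℤ)).subset (by
    rintro q ⟨hq, hr⟩
    refine ⟨?_, hq⟩
    by_contra hlt
    refine hr ⟨(h - q).toNat, ?_⟩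
    have h0 : lam.rowLen (h - q).toNat = 0 := by
      by_contra hne
      have hmem : ((h - q).toNat, 0) ∈ lam :=
        YoungDiagram.mem_iff_lt_rowLen.mpr (Nat.pos_of_ne_zero hne)
      have := YoungDiagram.mem_iff_lt_colLen.mp hmem
      omega
    omega)

end Maya

/-- Fermionic Fock space: the complex vector space with basis the Maya diagrams (equivalently the
regular normally ordered semi-infinite wedges `e_{m₁} ∧ e_{m₂} ∧ ⋯`, where `m₁ > m₂ > ⋯` are the
positions of the black beads). -/
abbrev Fock : Type := Maya →₀ ℂ

/-- The standard basis vector `|lam, h⟩`. -/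
def ket (lam : YoungDiagram) (h : ℤ) : Fock := Finsupp.single (Maya.ofPartition lam h) 1

/-- The charge `h` part of Fock space. -/
def chargeSector (h : ℤ) : Submodule ℂ Fock :=
  Submodule.span ℂ (Set.range fun lam : YoungDiagram => ket lam h)

/-- The number of boxes of `lam` of colour `0`. The box in row `r` and column `s` (both counted from
`0`) of the charged partition `(lam, h)` lies at horizontal position `h + s - r`, and its colour is
this position modulo `ℓ`. -/
def numZeroBoxes (ℓ : ℕ) (lam : YoungDiagram) (h : ℤ) : ℕ :=
  (lam.cells.filter fun b => (ℓ : ℤ) ∣ h + (b.2 : ℤ) - (b.1 : ℤ)).card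

open Classical in
/-- The operator `ψ_p`, that is `v ↦ e_p ∧ v`. -/
def psi (p : ℤ) : Module.End ℂ Fock :=
  Finsupp.linearCombination ℂ fun M : Maya =>
    if p ∈ M.black then 0 else Finsupp.single (M.insert p) (M.sign p)

open Classical in
/-- The operator `ψ*_p`, which sends `e_p ∧ v` to `v`, and `v` to `0` if `e_p` is not a factor of
`v`. -/
def psiStar (p : ℤ) : Module.End ℂ Fock :=
  Finsupp.linearCombination ℂ fun M : Maya =>
    if p ∈ M.black then Finsupp.single (M.erase p) (M.sign p) else 0

/-- The Clifford algebra generated by all `ψ_p` and `ψ*_p`, as an algebra of operators on Fock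
space (on which it acts faithfully). -/
def cliffordAlg : Subalgebra ℂ (Module.End ℂ Fock) :=
  Algebra.adjoin ℂ (Set.range psi ∪ Set.range psiStar)

/-- The completion of the Clifford algebra, acting on Fock space: its elements are the operators
given by infinite sums `z + ∑_{m < N} X_m ψ_m + ∑_{m > K} Y_m ψ*_m`, where `X_m` and `Y_m` are in the
Clifford algebra. Applied to a vector, only finitely many terms of such a sum are nonzero. -/
def cliffordCompletion : Set (Module.End ℂ Fock) :=
  {T | ∃ (z : ℂ) (N K : ℤ) (X Y : ℤ → Module.End ℂ Fock),
    (∀ m, X m ∈ cliffordAlg) ∧ (∀ m, Y m ∈ cliffordAlg) ∧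
    ∀ v : Fock, T v = z • v + (∑ᶠ m ∈ Set.Iio N, X m (psi m v))
      + ∑ᶠ m ∈ Set.Ioi K, Y m (psiStar m v)}

/-- The operator by which `Ē_{m,n}` acts: `ψ_m ψ*_n` if `m ≠ n` or `m > 0`, and `-ψ*_n ψ_n` if
`m = n < 0`. -/
def normalOrdered (m n : ℤ) : Module.End ℂ Fock :=
  if m = n ∧ n ≤ 0 then -(psiStar n * psi n) else psi m * psiStar n

/-- The bosonic operator `α_k = ∑_m ψ_m ψ*_{m+k}` applied to a vector (for `k ≠ 0` only finitely
many terms of the sum are nonzero). -/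
def alphaApply (k : ℤ) (v : Fock) : Fock := ∑ᶠ m : ℤ, psi m (psiStar (m + k) v)

/-! ### Infinite matrices with finitely many diagonals -/

/-- The infinite matrices `a` for which there is a `k` with `a i j = 0` whenever `|i - j| > k`. -/
def bandMatrix : Submodule ℂ (Matrix ℤ ℤ ℂ) where
  carrier := {a | ∃ k : ℕ, ∀ i j : ℤ, (k : ℤ) < |i - j| → a i j = 0}
  zero_mem' := ⟨0, fun _ _ _ => rfl⟩
  add_mem' := by
    rintro a b ⟨k, hk⟩ ⟨l, hl⟩
    refine ⟨k + l, fun i j h => ?_⟩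
    push_cast at h
    rw [Matrix.add_apply, hk i j (by omega), hl i j (by omega), add_zero]
  smul_mem' := by
    rintro c a ⟨k, hk⟩
    exact ⟨k, fun i j h => by rw [Matrix.smul_apply, hk i j h, smul_zero]⟩

/-- The vector space underlying the Lie algebra `gl~` of infinite matrices with finitely many nonzero
diagonals. -/
abbrev BandMatrix : Type := bandMatrix

namespace BandMatrix

theorem exists_width (a : BandMatrix) :
    ∃ k : ℕ, ∀ i j : ℤ, (k : ℤ) < |i - j| → a.1 i j = 0 := a.2

/-- Entries of the product of two infinite matrices. -/
def mulEntry (a b : BandMatrix) (i j : ℤ) : ℂ := ∑ᶠ p : ℤ, a.1 i p * b.1 p j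

theorem mulEntry_eq_sum (a b : BandMatrix) {k : ℕ} (ha : ∀ i j : ℤ, (k : ℤ) < |i - j| → a.1 i j = 0)
    (i j : ℤ) {S : Finset ℤ} (hS : Finset.Icc (i - k) (i + k) ⊆ S) :
    mulEntry a b i j = ∑ p ∈ S, a.1 i p * b.1 p j := by
  refine finsum_eq_finsetSum_of_support_subset _ fun p hp => ?_
  by_contra h
  refine hp ?_
  have : p ∉ Finset.Icc (i - (k : ℤ)) (i + k) := fun h' => h (hS h')
  rw [Finset.mem_Icc] at this
  simp only
  rw [ha i p (by rw [lt_abs]; omega), zero_mul]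

instance : Mul BandMatrix where
  mul a b := ⟨fun i j => mulEntry a b i j, by
    obtain ⟨k, hk⟩ := a.exists_width
    obtain ⟨l, hl⟩ := b.exists_width
    refine ⟨k + l, fun i j h => ?_⟩
    push_cast at h
    rw [lt_abs] at h
    change mulEntry a b i j = 0
    rw [mulEntry_eq_sum a b hk i j subset_rfl]
    refine Finset.sum_eq_zero fun p hp => ?_
    rw [Finset.mem_Icc] at hp
    rw [hl p j (by rw [lt_abs]; omega), mul_zero]⟩

theorem mul_apply (a b : BandMatrix) (i j : ℤ) : (a * b).1 i j = ∑ᶠ p : ℤ, a.1 i p * b.1 p j := rfl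

theorem mul_apply_sum (a b : BandMatrix) {k : ℕ}
    (ha : ∀ i j : ℤ, (k : ℤ) < |i - j| → a.1 i j = 0) (i j : ℤ) {S : Finset ℤ}
    (hS : Finset.Icc (i - k) (i + k) ⊆ S) :
    (a * b).1 i j = ∑ p ∈ S, a.1 i p * b.1 p j := mulEntry_eq_sum a b ha i j hS

instance : One BandMatrix where
  one := ⟨1, 0, fun i j h => Matrix.one_apply_ne (by rintro rfl; simp at h)⟩

theorem one_val : (1 : BandMatrix).1 = 1 := rfl

instance : Ring BandMatrix where
  __ := (inferInstance : AddCommGroup BandMatrix)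
  mul_assoc a b c := by
    obtain ⟨k, hk⟩ := a.exists_width
    obtain ⟨l, hl⟩ := b.exists_width
    obtain ⟨n, hn⟩ := (a * b).exists_width
    ext i j
    have hk' : ∀ i j : ℤ, ((k + l + n : ℕ) : ℤ) < |i - j| → a.1 i j = 0 :=
      fun i j h => hk i j (by push_cast at h; omega)
    have hn' : ∀ i j : ℤ, ((k + l + n : ℕ) : ℤ) < |i - j| → (a * b).1 i j = 0 :=
      fun i j h => hn i j (by push_cast at h; omega)
    rw [mul_apply_sum _ c hn' i j subset_rfl, mul_apply_sum a _ hk' i j subset_rfl]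
    have h1 : ∀ q ∈ Finset.Icc (i - ((k + l + n : ℕ) : ℤ)) (i + (k + l + n : ℕ)),
        (a * b).1 i q * c.1 q j =
          ∑ p ∈ Finset.Icc (i - ((k + l + n : ℕ) : ℤ)) (i + (k + l + n : ℕ)),
            a.1 i p * b.1 p q * c.1 q j := by
      intro q _
      rw [mul_apply_sum a b hk' i q subset_rfl, Finset.sum_mul]
    have h2 : ∀ p ∈ Finset.Icc (i - ((k + l + n : ℕ) : ℤ)) (i + (k + l + n : ℕ)),
        a.1 i p * (b * c).1 p j =
          ∑ q ∈ Finset.Icc (i - ((k + l + n : ℕ) : ℤ)) (i + (k + l + n : ℕ)),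
            a.1 i p * b.1 p q * c.1 q j := by
      intro p _
      by_cases hp : (k : ℤ) < |i - p|
      · simp [hk i p hp]
      · rw [mul_apply_sum b c hl p j
          (S := Finset.Icc (i - ((k + l + n : ℕ) : ℤ)) (i + (k + l + n : ℕ))) ?_, Finset.mul_sum]
        · simp only [mul_assoc]
        · intro q hq
          rw [Finset.mem_Icc] at hq ⊢
          rw [lt_abs] at hp
          push_cast
          omega
    rw [Finset.sum_congr rfl h1, Finset.sum_congr rfl h2, Finset.sum_comm]
  one_mul a := by
    ext i j
    rw [mul_apply_sum 1 a (k := 0) (fun i j h => Matrix.one_apply_ne (by rintro rfl; simp at h)) i j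
      subset_rfl]
    simp [one_val]
  mul_one a := by
    obtain ⟨k, hk⟩ := a.exists_width
    ext i j
    rw [mul_apply_sum a 1 hk i j (S := insert j (Finset.Icc (i - k) (i + k)))
      (Finset.subset_insert _ _)]
    simp [one_val, Matrix.one_apply]
  left_distrib a b c := by
    obtain ⟨k, hk⟩ := a.exists_width
    ext i j
    rw [mul_apply_sum a _ hk i j subset_rfl]
    change _ = (a * b).1 i j + (a * c).1 i j
    rw [mul_apply_sum a b hk i j subset_rfl, mul_apply_sum a c hk i j subset_rfl,
      ← Finset.sum_add_distrib]
    exact Finset.sum_congr rfl fun p _ => mul_add _ _ _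
  right_distrib a b c := by
    obtain ⟨k, hk⟩ := a.exists_width
    obtain ⟨l, hl⟩ := b.exists_width
    have hk' : ∀ i j : ℤ, ((k + l : ℕ) : ℤ) < |i - j| → a.1 i j = 0 :=
      fun i j h => hk i j (by push_cast at h; omega)
    have hl' : ∀ i j : ℤ, ((k + l : ℕ) : ℤ) < |i - j| → b.1 i j = 0 :=
      fun i j h => hl i j (by push_cast at h; omega)
    have hab : ∀ i j : ℤ, ((k + l : ℕ) : ℤ) < |i - j| → (a + b).1 i j = 0 :=
      fun i j h => by
        change a.1 i j + b.1 i j = 0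
        rw [hk' i j h, hl' i j h, add_zero]
    ext i j
    rw [mul_apply_sum _ c hab i j subset_rfl]
    change _ = (a * c).1 i j + (b * c).1 i j
    rw [mul_apply_sum a c hk' i j subset_rfl, mul_apply_sum b c hl' i j subset_rfl,
      ← Finset.sum_add_distrib]
    exact Finset.sum_congr rfl fun p _ => add_mul _ _ _
  zero_mul a := by
    ext i j
    rw [mul_apply]
    simp
  mul_zero a := by
    ext i j
    rw [mul_apply]
    simp

instance : Algebra ℂ BandMatrix :=
  Algebra.ofModule
    (fun r a b => by
      obtain ⟨k, hk⟩ := a.exists_width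
      have hk' : ∀ i j : ℤ, (k : ℤ) < |i - j| → (r • a).1 i j = 0 := fun i j h => by
        change r * a.1 i j = 0
        rw [hk i j h, mul_zero]
      ext i j
      change _ = r * (a * b).1 i j
      rw [mul_apply_sum _ b hk' i j subset_rfl, mul_apply_sum a b hk i j subset_rfl,
        Finset.mul_sum]
      exact Finset.sum_congr rfl fun p _ => mul_assoc _ _ _)
    (fun r a b => by
      obtain ⟨k, hk⟩ := a.exists_width
      ext i j
      change _ = r * (a * b).1 i j
      rw [mul_apply_sum a _ hk i j subset_rfl, mul_apply_sum a b hk i j subset_rfl,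
        Finset.mul_sum]
      exact Finset.sum_congr rfl fun p _ => mul_left_comm _ _ _)

/-- The coefficient of `c` in the bracket of `Ē_{m,n}` and `Ē_{n,m}`: it is `1` if `m < 0 < n`,
it is `-1` if `n < 0 < m`, and `0` otherwise. -/
def cocycleSign (m n : ℤ) : ℂ :=
  if m ≤ 0 ∧ 0 < n then 1 else if 0 < m ∧ n ≤ 0 then -1 else 0

/-- The coefficient of `c` in the bracket of two elements of `a_∞`, the bilinear extension of
`(E_{m,n}, E_{p,q}) ↦ δ_{m,q} δ_{n,p} cocycleSign m n`. Only finitely many terms are nonzero. -/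
def cocycle (a b : BandMatrix) : ℂ :=
  ∑ᶠ x : ℤ × ℤ, cocycleSign x.1 x.2 * (a.1 x.1 x.2 * b.1 x.2 x.1)

theorem cocycle_eq_sum (a b : BandMatrix) {k : ℕ}
    (ha : ∀ i j : ℤ, (k : ℤ) < |i - j| → a.1 i j = 0) {S : Finset ℤ}
    (hS : Finset.Icc (-k : ℤ) k ⊆ S) :
    cocycle a b = ∑ m ∈ S, ∑ n ∈ S, cocycleSign m n * (a.1 m n * b.1 n m) := by
  rw [← Finset.sum_product', cocycle]
  refine finsum_eq_finsetSum_of_support_subset _ fun x hx => ?_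
  by_contra h
  refine hx ?_
  have h' : ¬ (x.1 ∈ Finset.Icc (-k : ℤ) k ∧ x.2 ∈ Finset.Icc (-k : ℤ) k) := fun h' =>
    h (Finset.mem_coe.mpr (Finset.mem_product.mpr ⟨hS h'.1, hS h'.2⟩))
  simp only [Finset.mem_Icc] at h'
  simp only [cocycleSign]
  split_ifs with h1 h2
  · rw [ha _ _ (by rw [lt_abs]; omega)]; simp
  · rw [ha _ _ (by rw [lt_abs]; omega)]; simp
  · simp

theorem exists_common_width (a b c : BandMatrix) : ∃ k : ℕ,
    (∀ i j : ℤ, (k : ℤ) < |i - j| → a.1 i j = 0) ∧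
    (∀ i j : ℤ, (k : ℤ) < |i - j| → b.1 i j = 0) ∧
    (∀ i j : ℤ, (k : ℤ) < |i - j| → c.1 i j = 0) := by
  obtain ⟨k, hk⟩ := a.exists_width
  obtain ⟨l, hl⟩ := b.exists_width
  obtain ⟨n, hn⟩ := c.exists_width
  exact ⟨k + l + n, fun i j h => hk i j (by push_cast at h; omega),
    fun i j h => hl i j (by push_cast at h; omega), fun i j h => hn i j (by push_cast at h; omega)⟩

theorem cocycle_add_left (a b c : BandMatrix) :
    cocycle (a + b) c = cocycle a c + cocycle b c := by
  obtain ⟨k, ha, hb, -⟩ := exists_common_width a b c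
  have hab : ∀ i j : ℤ, (k : ℤ) < |i - j| → (a + b).1 i j = 0 := fun i j h => by
    change a.1 i j + b.1 i j = 0
    rw [ha i j h, hb i j h, add_zero]
  rw [cocycle_eq_sum _ c hab subset_rfl, cocycle_eq_sum a c ha subset_rfl,
    cocycle_eq_sum b c hb subset_rfl]
  simp only [← Finset.sum_add_distrib]
  refine Finset.sum_congr rfl fun m _ => Finset.sum_congr rfl fun n _ => ?_
  change _ * ((a.1 m n + b.1 m n) * _) = _
  ring

theorem cocycleSign_eq (m n : ℤ) :
    cocycleSign m n = (if 0 < n then 1 else 0) - (if 0 < m then 1 else 0) := by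
  unfold cocycleSign
  split_ifs <;> first | omega | simp

theorem cocycle_skew (a b : BandMatrix) : cocycle a b = -cocycle b a := by
  obtain ⟨k, ha, hb, -⟩ := exists_common_width a b a
  rw [cocycle_eq_sum a b ha subset_rfl, cocycle_eq_sum b a hb subset_rfl, Finset.sum_comm]
  simp only [← Finset.sum_neg_distrib]
  refine Finset.sum_congr rfl fun m _ => Finset.sum_congr rfl fun n _ => ?_
  rw [cocycleSign_eq, cocycleSign_eq]
  ring

theorem cocycle_smul_right (r : ℂ) (a b : BandMatrix) :
    cocycle a (r • b) = r * cocycle a b := by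
  obtain ⟨k, ha⟩ := a.exists_width
  rw [cocycle_eq_sum a _ ha subset_rfl, cocycle_eq_sum a b ha subset_rfl]
  simp only [Finset.mul_sum]
  refine Finset.sum_congr rfl fun m _ => Finset.sum_congr rfl fun n _ => ?_
  change _ * (_ * (r * _)) = _
  ring

theorem cocycle_lie_eq_sum (a b c : BandMatrix) {k : ℕ}
    (ha : ∀ i j : ℤ, (k : ℤ) < |i - j| → a.1 i j = 0)
    (hb : ∀ i j : ℤ, (k : ℤ) < |i - j| → b.1 i j = 0)
    (hc : ∀ i j : ℤ, (k : ℤ) < |i - j| → c.1 i j = 0) {S : Finset ℤ}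
    (hS : Finset.Icc (-(2 * k : ℤ)) (2 * k) ⊆ S) :
    cocycle ⁅a, b⁆ c = ∑ m ∈ S, ∑ n ∈ S, ∑ p ∈ S,
      cocycleSign m n * ((a.1 m p * b.1 p n - b.1 m p * a.1 p n) * c.1 n m) := by
  have hS' : Finset.Icc (-k : ℤ) k ⊆ S := fun x hx => hS (by
    rw [Finset.mem_Icc] at hx ⊢
    omega)
  rw [← neg_neg (cocycle _ _), ← cocycle_skew, cocycle_eq_sum c _ hc hS', Finset.sum_comm]
  simp only [← Finset.sum_neg_distrib]
  refine Finset.sum_congr rfl fun m _ => Finset.sum_congr rfl fun n _ => ?_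
  have key : cocycleSign n m = 0 ∨ c.1 n m = 0 ∨
      (m ∈ Finset.Icc (-k : ℤ) k) := by
    by_cases h : (k : ℤ) < |n - m|
    · exact Or.inr (Or.inl (hc _ _ h))
    · rw [lt_abs] at h
      simp only [cocycleSign, Finset.mem_Icc]
      split_ifs with h1 h2
      · right; right; omega
      · right; right; omega
      · simp
  have hs : cocycleSign m n = -cocycleSign n m := by
    rw [cocycleSign_eq, cocycleSign_eq]; ring
  rcases key with h | h | h
  · simp [h, hs]
  · simp [h]
  · rw [Finset.mem_Icc] at h
    have hsub : Finset.Icc (m - k) (m + k) ⊆ S := fun x hx => hS (by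
      rw [Finset.mem_Icc] at hx ⊢
      omega)
    have hlie : (⁅a, b⁆ : BandMatrix).1 m n =
        ∑ p ∈ S, (a.1 m p * b.1 p n - b.1 m p * a.1 p n) := by
      change (a * b).1 m n - (b * a).1 m n = _
      rw [mul_apply_sum a b ha m n hsub, mul_apply_sum b a hb m n hsub, Finset.sum_sub_distrib]
    rw [hlie, hs, Finset.mul_sum, Finset.mul_sum, ← Finset.sum_neg_distrib]
    refine Finset.sum_congr rfl fun p _ => ?_
    ring

theorem cocycle_jacobi (a b c : BandMatrix) :
    cocycle ⁅a, b⁆ c + cocycle ⁅b, c⁆ a + cocycle ⁅c, a⁆ b = 0 := by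
  obtain ⟨k, ha, hb, hc⟩ := exists_common_width a b c
  set S := Finset.Icc (-(2 * k : ℤ)) (2 * k)
  have hrot : ∀ f : ℤ → ℤ → ℤ → ℂ,
      ∑ m ∈ S, ∑ n ∈ S, ∑ p ∈ S, f m n p = ∑ m ∈ S, ∑ n ∈ S, ∑ p ∈ S, f p m n := by
    intro f
    calc ∑ m ∈ S, ∑ n ∈ S, ∑ p ∈ S, f m n p = ∑ n ∈ S, ∑ m ∈ S, ∑ p ∈ S, f m n p :=
          Finset.sum_comm
      _ = ∑ n ∈ S, ∑ p ∈ S, ∑ m ∈ S, f m n p :=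
          Finset.sum_congr rfl fun _ _ => Finset.sum_comm
  let F : BandMatrix → BandMatrix → BandMatrix → ℂ := fun x y z =>
    ∑ m ∈ S, ∑ n ∈ S, ∑ p ∈ S, cocycleSign m n * (x.1 m p * y.1 p n * z.1 n m)
  have hF : ∀ x y z, F x y z + F y z x + F z x y = 0 := by
    intro x y z
    have h1 : F y z x = ∑ m ∈ S, ∑ n ∈ S, ∑ p ∈ S,
        cocycleSign p m * (y.1 p n * z.1 n m * x.1 m p) := hrot _
    have h2 : F z x y = ∑ m ∈ S, ∑ n ∈ S, ∑ p ∈ S,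
        cocycleSign n p * (z.1 n m * x.1 m p * y.1 p n) := (hrot _).trans (hrot _)
    rw [h1, h2]
    simp only [F, ← Finset.sum_add_distrib]
    refine Finset.sum_eq_zero fun m _ => Finset.sum_eq_zero fun n _ =>
      Finset.sum_eq_zero fun p _ => ?_
    rw [cocycleSign_eq m n, cocycleSign_eq p m, cocycleSign_eq n p]
    ring
  have e : ∀ x y z : BandMatrix, (∑ m ∈ S, ∑ n ∈ S, ∑ p ∈ S,
      cocycleSign m n * ((x.1 m p * y.1 p n - y.1 m p * x.1 p n) * z.1 n m)) =
      F x y z - F y x z := by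
    intro x y z
    simp only [F, ← Finset.sum_sub_distrib]
    refine Finset.sum_congr rfl fun m _ => Finset.sum_congr rfl fun n _ =>
      Finset.sum_congr rfl fun p _ => ?_
    ring
  rw [cocycle_lie_eq_sum a b c ha hb hc subset_rfl, cocycle_lie_eq_sum b c a hb hc ha subset_rfl,
    cocycle_lie_eq_sum c a b hc ha hb subset_rfl, e, e, e]
  linear_combination hF a b c - hF b a c

end BandMatrix

/-! ### The Lie algebra `a_∞` -/

/-- The Lie algebra `a_∞`, a central extension of the Lie algebra of infinite matrices with finitely
many nonzero diagonals: the element `⟨a, z⟩` is `∑ a_{m,n} Ē_{m,n} + z c`. -/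
@[ext] structure AInf : Type where
  mat : BandMatrix
  central : ℂ

namespace AInf

/-- `a_∞` as a vector space. -/
def equivProd : AInf ≃ BandMatrix × ℂ where
  toFun x := (x.mat, x.central)
  invFun x := ⟨x.1, x.2⟩

instance : AddCommGroup AInf := equivProd.addCommGroup
instance : Module ℂ AInf := equivProd.module ℂ

@[simp] theorem mat_zero : (0 : AInf).mat = 0 := rfl
@[simp] theorem central_zero : (0 : AInf).central = 0 := rfl
@[simp] theorem mat_add (x y : AInf) : (x + y).mat = x.mat + y.mat := rfl
@[simp] theorem central_add (x y : AInf) : (x + y).central = x.central + y.central := rfl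
@[simp] theorem mat_smul (r : ℂ) (x : AInf) : (r • x).mat = r • x.mat := rfl
@[simp] theorem central_smul (r : ℂ) (x : AInf) : (r • x).central = r * x.central := rfl

instance : Bracket AInf AInf where
  bracket x y := ⟨⁅x.mat, y.mat⁆, BandMatrix.cocycle x.mat y.mat⟩

@[simp] theorem mat_lie (x y : AInf) : ⁅x, y⁆.mat = ⁅x.mat, y.mat⁆ := rfl
@[simp] theorem central_lie (x y : AInf) :
    ⁅x, y⁆.central = BandMatrix.cocycle x.mat y.mat := rfl

instance : LieRing AInf where
  add_lie x y z := by
    ext1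
    · simp
    · simp [BandMatrix.cocycle_add_left]
  lie_add x y z := by
    ext1
    · simp
    · simp only [central_lie, central_add, mat_add]
      rw [BandMatrix.cocycle_skew, BandMatrix.cocycle_add_left, BandMatrix.cocycle_skew x.mat,
        BandMatrix.cocycle_skew x.mat]
      ring
  lie_self x := by
    ext1
    · simp
    · have := BandMatrix.cocycle_skew x.mat x.mat
      simp only [central_lie, central_zero]
      linear_combination this / 2
  leibniz_lie x y z := by
    ext1
    · simp
    · have h := BandMatrix.cocycle_jacobi x.mat y.mat z.mat
      have h1 := BandMatrix.cocycle_skew x.mat ⁅y.mat, z.mat⁆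
      have h2 := BandMatrix.cocycle_skew y.mat ⁅x.mat, z.mat⁆
      have h3 : BandMatrix.cocycle ⁅z.mat, x.mat⁆ y.mat =
          -BandMatrix.cocycle ⁅x.mat, z.mat⁆ y.mat := by
        rw [← lie_skew, ← neg_one_smul ℂ, BandMatrix.cocycle_skew, BandMatrix.cocycle_smul_right,
          BandMatrix.cocycle_skew y.mat]
        ring
      simp only [central_lie, central_add, mat_lie]
      linear_combination h1 - h2 - h + h3

instance : LieAlgebra ℂ AInf where
  lie_smul r x y := by
    ext1
    · simp
    · simp [BandMatrix.cocycle_smul_right]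

/-- The central element `c` of `a_∞`. -/
def c : AInf := ⟨0, 1⟩

/-- The element `∑_{k ∈ ℤ} Ē_{i - 1/2 + kℓ, j - 1/2 + kℓ + mℓ}` of `a_∞`, where `i` and `j` range
over `1, …, ℓ`. (The elements of `Fin ℓ` are `0, …, ℓ - 1`, so they are shifted by `1` here.) -/
def blockSum {ℓ : ℕ} (i j : Fin ℓ) (m : ℤ) : AInf where
  mat := ⟨fun p q => open Classical in
      if ∃ k : ℤ, p = (i : ℤ) + 1 + k * ℓ ∧ q = (j : ℤ) + 1 + k * ℓ + m * ℓ then 1 else 0, by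
    refine ⟨((i : ℤ) - j - m * ℓ).natAbs, fun p q h => if_neg ?_⟩
    rintro ⟨k, rfl, rfl⟩
    rw [Int.natCast_natAbs] at h
    refine absurd h (not_lt.mpr (le_of_eq (congrArg abs ?_)))
    ring⟩
  central := 0

end AInf

/-! ### The affine Lie algebra of `gl_ℓ` -/

/-- The matrix Lie algebra `gl_ℓ` (with the commutator as its bracket). -/
abbrev GLie (ℓ : ℕ) : Type := Matrix (Fin ℓ) (Fin ℓ) ℂ

/-- The trace form `(X, Y) ↦ tr (X Y)`. -/
def trForm (ℓ : ℕ) : LinearMap.BilinForm ℂ (GLie ℓ) :=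
  (LinearMap.mul ℂ (GLie ℓ)).compr₂ (Matrix.traceLinearMap (Fin ℓ) ℂ ℂ)

theorem trForm_apply {ℓ : ℕ} (X Y : GLie ℓ) : trForm ℓ X Y = (X * Y).trace := rfl

/-- The Lie algebra `gl_ℓ ⊗ ℂ[t, t⁻¹]`. -/
def Loop (ℓ : ℕ) : Type := LieAlgebra.loopAlgebra ℂ ℤ (GLie ℓ)

namespace Loop

variable {ℓ : ℕ}

instance : LieRing (Loop ℓ) := inferInstanceAs (LieRing (LieAlgebra.loopAlgebra ℂ ℤ (GLie ℓ)))
instance : LieAlgebra ℂ (Loop ℓ) :=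
  inferInstanceAs (LieAlgebra ℂ (LieAlgebra.loopAlgebra ℂ ℤ (GLie ℓ)))

/-- The element `X ⊗ t ^ n`. -/
def mono (X : GLie ℓ) (n : ℤ) : Loop ℓ := (AddMonoidAlgebra.single n (1 : ℂ)) ⊗ₜ[ℂ] X

theorem lie_mono (X Y : GLie ℓ) (n m : ℤ) :
    ⁅mono X n, mono Y m⁆ = mono (X * Y - Y * X) (n + m) := by
  refine (LieAlgebra.ExtendScalars.bracket_tmul ℂ (AddMonoidAlgebra ℂ ℤ) (GLie ℓ) (GLie ℓ)
    (AddMonoidAlgebra.single n 1) (AddMonoidAlgebra.single m 1) X Y).trans ?_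
  rw [AddMonoidAlgebra.single_mul_single, one_mul]
  rfl

/-- The derivation `t d/dt` of `ℂ[t, t⁻¹]`, extended to `gl_ℓ ⊗ ℂ[t, t⁻¹]`. -/
def degree : Loop ℓ →ₗ[ℂ] Loop ℓ :=
  LinearMap.rTensor (GLie ℓ) ((AddMonoidAlgebra.basis ℤ ℂ).constr ℂ
    fun n => AddMonoidAlgebra.single n (n : ℂ))

/-- The cocycle of the affine Lie algebra: `(X ⊗ t ^ n, Y ⊗ t ^ m) ↦ n δ_{n,-m} tr (X Y)`. -/
def cocycle : LinearMap.BilinForm ℂ (Loop ℓ) :=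
  (LieAlgebra.LoopAlgebra.residuePairing ℂ ℤ (GLie ℓ) (trForm ℓ)).flip

theorem cocycle_mono (X Y : GLie ℓ) (n m : ℤ) :
    cocycle (mono X n) (mono Y m) = if n = -m then (n : ℂ) * (X * Y).trace else 0 := by
  refine (LieAlgebra.LoopAlgebra.residuePairing_apply_apply ℂ ℤ (GLie ℓ) (trForm ℓ)
    (mono Y m) (mono X n)).trans ?_
  simp only [mono, LieAlgebra.LoopAlgebra.toFinsupp_single_tmul]
  rw [Finsupp.sum_single_index (by simp), Finsupp.single_apply]
  split_ifs with h1 h2 h2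
  · rw [trForm_apply, Matrix.trace_mul_comm, zsmul_eq_mul]
  · omega
  · omega
  · simp

theorem degree_mono (X : GLie ℓ) (n : ℤ) : degree (mono X n) = (n : ℂ) • mono X n := by
  refine (LinearMap.rTensor_tmul _ _ _ _).trans ?_
  have h := (AddMonoidAlgebra.basis ℤ ℂ).constr_basis ℂ
    (fun n => AddMonoidAlgebra.single n (n : ℂ)) n
  rw [AddMonoidAlgebra.basis_apply] at h
  rw [h]
  change _ = (n : ℂ) • (AddMonoidAlgebra.single n (1 : ℂ) ⊗ₜ[ℂ] X : AddMonoidAlgebra ℂ ℤ ⊗[ℂ] GLie ℓ)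
  rw [TensorProduct.smul_tmul', AddMonoidAlgebra.smul_single, smul_eq_mul, mul_one]

@[elab_as_elim]
theorem induction {P : Loop ℓ → Prop} (x : Loop ℓ) (h0 : P 0) (hm : ∀ X n, P (mono X n))
    (ha : ∀ x y, P x → P y → P (x + y)) : P x := by
  obtain ⟨f, rfl⟩ := (LieAlgebra.LoopAlgebra.toFinsupp ℂ ℤ (GLie ℓ)).symm.surjective x
  induction f using Finsupp.induction_linear with
  | zero => rw [map_zero]; exact h0
  | add f g hf hg => rw [map_add]; exact ha _ _ hf hg
  | single n X =>
    rw [LieAlgebra.LoopAlgebra.toFinsupp_symm_single]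
    exact hm X n

theorem cocycle_skew (x y : Loop ℓ) : cocycle x y = -cocycle y x := by
  induction x using induction with
  | h0 => simp
  | ha x x' h h' => simp only [map_add, LinearMap.add_apply, h, h']; ring
  | hm X n =>
    induction y using induction with
    | h0 => simp
    | ha y y' h h' => simp only [map_add, LinearMap.add_apply, h, h']; ring
    | hm Y m =>
      rw [cocycle_mono, cocycle_mono, Matrix.trace_mul_comm Y X]
      by_cases h : n = -m
      · subst h; simp
      · rw [if_neg h, if_neg (by omega), neg_zero]

theorem cocycle_degree (x y : Loop ℓ) : cocycle (degree x) y + cocycle x (degree y) = 0 := by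
  induction x using induction with
  | h0 => simp
  | ha x x' h h' =>
    simp only [map_add, LinearMap.add_apply]
    linear_combination h + h'
  | hm X n =>
    induction y using induction with
    | h0 => simp
    | ha y y' h h' =>
      simp only [map_add]
      linear_combination h + h'
    | hm Y m =>
      rw [degree_mono, degree_mono, map_smul, map_smul, LinearMap.smul_apply, cocycle_mono]
      by_cases h : n = -m
      · subst h; simp
      · simp [h]

theorem degree_lie (x y : Loop ℓ) : degree ⁅x, y⁆ = ⁅degree x, y⁆ + ⁅x, degree y⁆ := by
  induction x using induction with
  | h0 => simp
  | ha x x' h h' =>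
    simp only [map_add, add_lie, h, h']
    abel
  | hm X n =>
    induction y using induction with
    | h0 => simp
    | ha y y' h h' =>
      simp only [map_add, lie_add, h, h']
      abel
    | hm Y m =>
      rw [degree_mono, degree_mono, smul_lie, lie_smul, lie_mono, degree_mono, ← add_smul]
      push_cast
      rfl

theorem cocycle_jacobi (x y z : Loop ℓ) :
    cocycle ⁅x, y⁆ z + cocycle ⁅y, z⁆ x + cocycle ⁅z, x⁆ y = 0 := by
  induction x using induction with
  | h0 => simp
  | ha x x' h h' =>
    simp only [map_add, add_lie, lie_add, LinearMap.add_apply]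
    linear_combination h + h'
  | hm X n =>
    induction y using induction with
    | h0 => simp
    | ha y y' h h' =>
      simp only [map_add, add_lie, lie_add, LinearMap.add_apply]
      linear_combination h + h'
    | hm Y m =>
      induction z using induction with
      | h0 => simp
      | ha z z' h h' =>
        simp only [map_add, add_lie, lie_add, LinearMap.add_apply]
        linear_combination h + h'
      | hm Z p =>
        simp only [lie_mono, cocycle_mono, sub_mul, Matrix.trace_sub]
        have e1 : (Y * Z * X).trace = (X * Y * Z).trace := by
          rw [Matrix.trace_mul_comm, mul_assoc]
        have e2 : (Z * X * Y).trace = (X * Y * Z).trace := by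
          rw [mul_assoc, Matrix.trace_mul_comm]
        have e3 : (Z * Y * X).trace = (Y * X * Z).trace := by
          rw [mul_assoc, Matrix.trace_mul_comm]
        have e4 : (X * Z * Y).trace = (Y * X * Z).trace := by
          rw [Matrix.trace_mul_comm, mul_assoc]
        rw [e1, e2, e3, e4]
        by_cases h : n + m + p = 0
        · rw [if_pos (by omega), if_pos (by omega), if_pos (by omega)]
          have h' : (n : ℂ) + m + p = 0 := by exact_mod_cast h
          push_cast
          linear_combination 2 * ((X * Y * Z).trace - (Y * X * Z).trace) * h'
        · rw [if_neg (by omega), if_neg (by omega), if_neg (by omega)]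
          simp

end Loop

/-- The affine Lie algebra of `gl_ℓ`, with underlying vector space
`(gl_ℓ ⊗ ℂ[t, t⁻¹]) ⊕ ℂ c ⊕ ℂ d`. -/
@[ext] structure AffineGL (ℓ : ℕ) : Type where
  loop : Loop ℓ
  central : ℂ
  deriv : ℂ

namespace AffineGL

variable {ℓ : ℕ}

/-- The affine Lie algebra as a vector space. -/
def equivProd : AffineGL ℓ ≃ Loop ℓ × ℂ × ℂ where
  toFun x := (x.loop, x.central, x.deriv)
  invFun x := ⟨x.1, x.2.1, x.2.2⟩

instance : AddCommGroup (AffineGL ℓ) := equivProd.addCommGroup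
instance : Module ℂ (AffineGL ℓ) := equivProd.module ℂ

@[simp] theorem loop_zero : (0 : AffineGL ℓ).loop = 0 := rfl
@[simp] theorem central_zero : (0 : AffineGL ℓ).central = 0 := rfl
@[simp] theorem deriv_zero : (0 : AffineGL ℓ).deriv = 0 := rfl
@[simp] theorem loop_add (x y : AffineGL ℓ) : (x + y).loop = x.loop + y.loop := rfl
@[simp] theorem central_add (x y : AffineGL ℓ) : (x + y).central = x.central + y.central := rfl
@[simp] theorem deriv_add (x y : AffineGL ℓ) : (x + y).deriv = x.deriv + y.deriv := rfl
@[simp] theorem loop_smul (r : ℂ) (x : AffineGL ℓ) : (r • x).loop = r • x.loop := rfl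
@[simp] theorem central_smul (r : ℂ) (x : AffineGL ℓ) : (r • x).central = r * x.central := rfl
@[simp] theorem deriv_smul (r : ℂ) (x : AffineGL ℓ) : (r • x).deriv = r * x.deriv := rfl

/-- The bracket given by `[X ⊗ t^n, Y ⊗ t^m] = (XY - YX) ⊗ t^{n+m} + n δ_{n,-m} tr(XY) c`,
`[d, X ⊗ t^n] = n X ⊗ t^n`, and `c` central. -/
instance : Bracket (AffineGL ℓ) (AffineGL ℓ) where
  bracket x y :=
    { loop := ⁅x.loop, y.loop⁆ + x.deriv • Loop.degree y.loop - y.deriv • Loop.degree x.loop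
      central := Loop.cocycle x.loop y.loop
      deriv := 0 }

@[simp] theorem loop_lie (x y : AffineGL ℓ) : ⁅x, y⁆.loop =
    ⁅x.loop, y.loop⁆ + x.deriv • Loop.degree y.loop - y.deriv • Loop.degree x.loop := rfl
@[simp] theorem central_lie (x y : AffineGL ℓ) :
    ⁅x, y⁆.central = Loop.cocycle x.loop y.loop := rfl
@[simp] theorem deriv_lie (x y : AffineGL ℓ) : ⁅x, y⁆.deriv = 0 := rfl

instance : LieRing (AffineGL ℓ) where
  add_lie x y z := by
    ext1
    · simp only [loop_lie, loop_add, deriv_add, add_lie, map_add, add_smul, smul_add]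
      abel
    · simp
    · simp
  lie_add x y z := by
    ext1
    · simp only [loop_lie, loop_add, deriv_add, lie_add, map_add, add_smul, smul_add]
      abel
    · simp
    · simp
  lie_self x := by
    ext1
    · simp
    · have := Loop.cocycle_skew x.loop x.loop
      simp only [central_lie, central_zero]
      linear_combination this / 2
    · simp
  leibniz_lie x y z := by
    ext1
    · simp only [loop_lie, loop_add, deriv_lie, map_add, map_sub, map_smul, lie_add, lie_sub,
        add_lie, sub_lie, lie_smul, smul_lie, Loop.degree_lie, zero_smul, smul_add, smul_sub]
      rw [leibniz_lie x.loop y.loop z.loop, ← lie_skew (Loop.degree x.loop) y.loop,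
        smul_comm z.deriv x.deriv, smul_comm z.deriv y.deriv, smul_comm x.deriv y.deriv]
      simp only [smul_neg]
      abel
    · have h := Loop.cocycle_jacobi x.loop y.loop z.loop
      have h1 := Loop.cocycle_skew x.loop ⁅y.loop, z.loop⁆
      have h2 := Loop.cocycle_skew y.loop ⁅x.loop, z.loop⁆
      have h3 : Loop.cocycle ⁅z.loop, x.loop⁆ y.loop = -Loop.cocycle ⁅x.loop, z.loop⁆ y.loop := by
        rw [← lie_skew, map_neg, LinearMap.neg_apply]
      have k1 := Loop.cocycle_degree x.loop y.loop
      have k2 := Loop.cocycle_degree x.loop z.loop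
      have k3 := Loop.cocycle_degree y.loop z.loop
      have s1 := Loop.cocycle_skew y.loop (Loop.degree x.loop)
      simp only [central_lie, central_add, loop_lie, map_add, map_sub, map_smul,
        LinearMap.add_apply, LinearMap.sub_apply, LinearMap.smul_apply, smul_eq_mul]
      linear_combination h1 - h2 - h + h3 - x.deriv * k3 + y.deriv * k2 - z.deriv * k1
        + z.deriv * s1
    · simp

instance : LieAlgebra ℂ (AffineGL ℓ) where
  lie_smul r x y := by
    ext1
    · simp only [loop_lie, loop_smul, deriv_smul, map_smul, lie_smul, smul_add, smul_sub,
        smul_smul]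
      rw [mul_comm x.deriv r]
    · simp
    · simp

/-- The element `X ⊗ t ^ n` of the affine Lie algebra. -/
def mono (X : GLie ℓ) (n : ℤ) : AffineGL ℓ := ⟨Loop.mono X n, 0, 0⟩

/-- The central element `c`. -/
def c : AffineGL ℓ := ⟨0, 1, 0⟩

/-- The element `d`. -/
def d : AffineGL ℓ := ⟨0, 0, 1⟩

variable (ℓ) in
/-- The Lie subalgebra `(gl_ℓ ⊗ ℂ[t, t⁻¹]) ⊕ ℂ c`. -/
def glPrime : LieSubalgebra ℂ (AffineGL ℓ) where
  carrier := {x | x.deriv = 0}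
  zero_mem' := rfl
  add_mem' {x y} hx hy := by
    change x.deriv + y.deriv = 0
    rw [show x.deriv = 0 from hx, show y.deriv = 0 from hy, add_zero]
  smul_mem' r x hx := by
    change r * x.deriv = 0
    rw [show x.deriv = 0 from hx, mul_zero]
  lie_mem' _ _ := rfl

variable (ℓ) in
/-- The map `X ⊗ f ↦ tr(X) f` from `gl_ℓ ⊗ ℂ[t, t⁻¹]` to `ℂ[t, t⁻¹] ⊗ ℂ`. -/
def loopTrace : Loop ℓ →ₗ[ℂ] AddMonoidAlgebra ℂ ℤ ⊗[ℂ] ℂ :=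
  LinearMap.lTensor _ (Matrix.traceLinearMap (Fin ℓ) ℂ ℂ)

theorem loopTrace_mono (X : GLie ℓ) (n : ℤ) :
    loopTrace ℓ (Loop.mono X n) = AddMonoidAlgebra.single n (1 : ℂ) ⊗ₜ[ℂ] X.trace :=
  LinearMap.lTensor_tmul _ _ _ _

theorem loopTrace_lie (x y : Loop ℓ) : loopTrace ℓ ⁅x, y⁆ = 0 := by
  induction x using Loop.induction with
  | h0 => simp
  | ha x x' h h' => rw [add_lie, map_add, h, h', add_zero]
  | hm X n =>
    induction y using Loop.induction with
    | h0 => simp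
    | ha y y' h h' => rw [lie_add, map_add, h, h', add_zero]
    | hm Y m =>
      rw [Loop.lie_mono, loopTrace_mono, Matrix.trace_sub, Matrix.trace_mul_comm, sub_self,
        TensorProduct.tmul_zero]

variable (ℓ) in
/-- The Lie subalgebra `(sl_ℓ ⊗ ℂ[t, t⁻¹]) ⊕ ℂ c`: here `sl_ℓ ⊗ ℂ[t, t⁻¹]` is the kernel of
`X ⊗ f ↦ tr(X) f`. -/
def slPrime : LieSubalgebra ℂ (AffineGL ℓ) where
  carrier := {x | x.deriv = 0 ∧ loopTrace ℓ x.loop = 0}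
  zero_mem' := ⟨rfl, map_zero _⟩
  add_mem' {x y} hx hy := by
    refine ⟨?_, ?_⟩
    · change x.deriv + y.deriv = 0
      rw [hx.1, hy.1, add_zero]
    · change loopTrace ℓ (x.loop + y.loop) = 0
      rw [map_add, hx.2, hy.2, add_zero]
  smul_mem' r x hx := by
    refine ⟨?_, ?_⟩
    · change r * x.deriv = 0
      rw [hx.1, mul_zero]
    · change loopTrace ℓ (r • x.loop) = 0
      rw [map_smul, hx.2, smul_zero]
  lie_mem' {x y} hx hy := by
    refine ⟨rfl, ?_⟩
    change loopTrace ℓ (_ + x.deriv • _ - y.deriv • _) = 0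
    rw [show x.deriv = 0 from hx.1, show y.deriv = 0 from hy.1, zero_smul, zero_smul, add_zero,
      sub_zero, loopTrace_lie]

theorem slPrime_le_glPrime : slPrime ℓ ≤ glPrime ℓ := fun _ hx => hx.1

theorem mono_mem_glPrime (X : GLie ℓ) (n : ℤ) : mono X n ∈ glPrime ℓ := rfl

theorem c_mem_glPrime : (c : AffineGL ℓ) ∈ glPrime ℓ := rfl

theorem c_mem_slPrime : (c : AffineGL ℓ) ∈ slPrime ℓ := ⟨rfl, map_zero _⟩

theorem mono_mem_slPrime {X : GLie ℓ} (hX : X.trace = 0) (n : ℤ) : mono X n ∈ slPrime ℓ := by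
  refine ⟨rfl, ?_⟩
  change loopTrace ℓ (Loop.mono X n) = 0
  rw [loopTrace_mono, hX, TensorProduct.tmul_zero]

/-- The matrix with a `1` in position `(i, j)` and zeros elsewhere. -/
abbrev unit (i j : Fin ℓ) : GLie ℓ := Matrix.single i j 1

variable (ℓ) in
/-- For `k = q ℓ + j` with `0 ≤ j < ℓ`, the element
`∑_{a + j ≤ ℓ} X_{a, a+j} ⊗ t^q + ∑_{a + j > ℓ} X_{a, a+j-ℓ} ⊗ t^{q+1}`. -/
def heisenberg (k : ℤ) : AffineGL ℓ :=
  ∑ a : Fin ℓ, ∑ b : Fin ℓ,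
    if (b : ℤ) = a + k % ℓ then mono (unit a b) (k / ℓ)
    else if (b : ℤ) = a + k % ℓ - ℓ then mono (unit a b) (k / ℓ + 1)
    else 0

end AffineGL

/-- A subspace `W` is preserved by a representation `ρ`. -/
def IsPreserved {L V : Type} [LieRing L] [LieAlgebra ℂ L] [AddCommGroup V] [Module ℂ V]
    (ρ : L →ₗ⁅ℂ⁆ Module.End ℂ V) (W : Submodule ℂ V) : Prop :=
  ∀ x : L, ∀ v ∈ W, ρ x v ∈ W

/-- A subspace `W` (preserved by `ρ`) is irreducible under `ρ`: it is nonzero, and `0` and `W` are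
the only subspaces of `W` preserved by `ρ`. -/
def IsIrreducibleOn {L V : Type} [LieRing L] [LieAlgebra ℂ L] [AddCommGroup V] [Module ℂ V]
    (ρ : L →ₗ⁅ℂ⁆ Module.End ℂ V) (W : Submodule ℂ V) : Prop :=
  W ≠ ⊥ ∧ ∀ U : Submodule ℂ V, U ≤ W → IsPreserved ρ U → U = ⊥ ∨ U = W

end

/-!
Everything reduces to the canonical anticommutation relations of wedging and contraction on Fock
space. By them the normally ordered products `Ē_{m,n}` satisfy the relations of `a_∞`, the scalars
removed by normal ordering giving the cocycle (`normalOrdered_lie`). On a fixed vector an infinite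
sum `∑ a_{m,n} Ē_{m,n}` with `a` a band matrix agrees with its large finite truncations
(`eventually_bandAct_eq`), so that the representation `aInfAct` of `a_∞` is a matter of finite sums.
It is faithful because the commutators with the `ψ_p` recover the matrix (`aInfAct_psi`).

The algebra of loops embeds into band matrices by its action on `ℂ^ℓ ⊗ ℂ[t, t⁻¹]`, whose basis is
numbered by the integers in blocks of length `ℓ` (`site`, `loopBand`). The cocycles agree because
the signed number of blocks crossing the origin under translation by `n` blocks is `n`
(`finsum_crossing`, `cocycle_loopBandHom`). The same count gives the Heisenberg relations
(`alphaOp_lie`).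

The derivation `d` acts diagonally. Since `Ē_{m,n}` moves a bead from `n` to `m`, it changes the sum
of the block numbers of the beads by the difference of two block numbers, and this is the degree in
`t` (`levelOp_lie_loop`). Relative to the vacuum of the same charge, that sum counts the boxes of
colour `0`, as each row of a partition records how far a bead has been raised, and the block number
grows by one at each box of colour `0` (`level_ofPartition`).

The charge sectors are irreducible already for the Heisenberg algebra. The point is that a vector of
charge `h` annihilated by all `α_k` with `k > 0` is a multiple of the vacuum
(`eq_vacuum_of_singular`), and this is proved without the boson-fermion correspondence or a count of
partitions. Newton's identities turn the `α_k` into operators `e_k` that commute with wedging like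
the coefficients of `Λ(1 + t S)`, with `S` the shift of positions. If all diagrams in the support of
a singular vector are filled below `w`, then the top `e_k` moves all the remaining beads down by
one, which up to sign amounts to applying `ψ_w` and translating (`elementaryOp_single`). As this
`e_k` kills the vector, so does `ψ_w`, and all the diagrams are black at `w` as well; this
continues up to `h`. Hence a nonzero invariant subspace contains the vacuum. That it contains all of
the sector follows by duality: `α_k` and `α_{-k}` are transposes of each other, so a functional
vanishing on the subspace gives, in the lowest level where it is nonzero, another singular vector
(`single_mem_of_isInvariant`).
-/

noncomputable section

/-! ### Wedging, contraction and the canonical anticommutation relations -/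

namespace Maya

@[simp] theorem mem_insert {M : Maya} {p q : ℤ} : q ∈ (M.insert p).black ↔ q ∈ M.black ∨ q = p :=
  Iff.rfl

@[simp] theorem mem_erase {M : Maya} {p q : ℤ} : q ∈ (M.erase p).black ↔ q ∈ M.black ∧ q ≠ p :=
  Iff.rfl

/-- Outside a bounded window, a Maya diagram is white above and black below. -/
theorem exists_window (M : Maya) :
    ∃ L : ℕ, (∀ p ∈ M.black, p ≤ L) ∧ ∀ p ∉ M.black, -(L : ℤ) ≤ p := by
  obtain ⟨a, ha⟩ := M.finite_black_pos.bddAbove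
  obtain ⟨b, hb⟩ := M.finite_white_neg.bddBelow
  refine ⟨a.natAbs + b.natAbs, fun p hp => ?_, fun p hp => ?_⟩
  · by_cases h : 0 < p
    · have := ha ⟨h, hp⟩
      omega
    · omega
  · by_cases h : p ≤ 0
    · have := hb ⟨h, hp⟩
      omega
    · omega

theorem finite_above (M : Maya) (p : ℤ) : {q : ℤ | p < q ∧ q ∈ M.black}.Finite := by
  obtain ⟨L, hL, -⟩ := M.exists_window
  exact (Set.finite_Icc p L).subset fun q hq => ⟨hq.1.le, hL q hq.2⟩

theorem sign_mul_self (M : Maya) (p : ℤ) : M.sign p * M.sign p = 1 := by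
  rw [sign, ← mul_pow]; simp

theorem sign_ne_zero (M : Maya) (p : ℤ) : M.sign p ≠ 0 := pow_ne_zero _ (by norm_num)

/-- A bead added at `p` changes the sign at the positions `q` below it. -/
theorem sign_insert {M : Maya} {p : ℤ} (hp : p ∉ M.black) (q : ℤ) :
    (M.insert p).sign q = (if q < p then -1 else 1) * M.sign q := by
  unfold sign
  split_ifs with h
  · have : {r : ℤ | q < r ∧ r ∈ (M.insert p).black} =
        Insert.insert p {r | q < r ∧ r ∈ M.black} := by
      ext r
      simp only [mem_insert, Set.mem_ofPred_eq, Set.mem_insert_iff]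
      constructor
      · rintro ⟨h1, h2 | h2⟩
        · exact Or.inr ⟨h1, h2⟩
        · exact Or.inl h2
      · rintro (rfl | h2)
        · exact ⟨h, Or.inr rfl⟩
        · exact ⟨h2.1, Or.inl h2.2⟩
    rw [this, Set.ncard_insert_of_notMem (fun h' => hp h'.2) (M.finite_above q), pow_succ, mul_comm]
  · have : {r : ℤ | q < r ∧ r ∈ (M.insert p).black} = {r | q < r ∧ r ∈ M.black} := by
      ext r
      simp only [mem_insert, Set.mem_ofPred_eq]
      constructor
      · rintro ⟨h1, h2 | h2⟩
        · exact ⟨h1, h2⟩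
        · omega
      · exact fun h2 => ⟨h2.1, Or.inl h2.2⟩
    rw [this, one_mul]

theorem insert_erase {M : Maya} {p : ℤ} (hp : p ∈ M.black) : (M.erase p).insert p = M := by
  ext q
  by_cases h : q = p
  · subst h; simpa using hp
  · simp [h]

theorem erase_insert {M : Maya} {p : ℤ} (hp : p ∉ M.black) : (M.insert p).erase p = M := by
  ext q
  by_cases h : q = p
  · subst h; simpa using hp
  · simp [h]

theorem insert_comm (M : Maya) (p q : ℤ) : (M.insert p).insert q = (M.insert q).insert p := by
  ext r; simp only [mem_insert]; tauto

theorem erase_insert_comm (M : Maya) {p q : ℤ} (h : p ≠ q) :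
    (M.insert q).erase p = (M.erase p).insert q := by
  ext r
  simp only [mem_insert, mem_erase]
  constructor
  · tauto
  · rintro (h1 | rfl)
    · tauto
    · exact ⟨Or.inr rfl, h.symm⟩

theorem erase_comm (M : Maya) (p q : ℤ) : (M.erase p).erase q = (M.erase q).erase p := by
  ext r; simp only [mem_erase]; tauto

theorem sign_erase {M : Maya} {p : ℤ} (hp : p ∈ M.black) (q : ℤ) :
    (M.erase p).sign q = (if q < p then -1 else 1) * M.sign q := by
  have h := sign_insert (M := M.erase p) (p := p) (by simp) q
  rw [insert_erase hp] at h
  rw [h]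
  split_ifs <;> simp

end Maya

theorem psi_single_of_mem {M : Maya} {p : ℤ} (hp : p ∈ M.black) (a : ℂ) :
    psi p (Finsupp.single M a) = 0 := by
  simp [psi, Finsupp.linearCombination_single, hp]

theorem psi_single_of_notMem {M : Maya} {p : ℤ} (hp : p ∉ M.black) (a : ℂ) :
    psi p (Finsupp.single M a) = Finsupp.single (M.insert p) (a * M.sign p) := by
  simp [psi, Finsupp.linearCombination_single, hp]

theorem psiStar_single_of_mem {M : Maya} {p : ℤ} (hp : p ∈ M.black) (a : ℂ) :
    psiStar p (Finsupp.single M a) = Finsupp.single (M.erase p) (a * M.sign p) := by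
  simp [psiStar, Finsupp.linearCombination_single, hp]

theorem psiStar_single_of_notMem {M : Maya} {p : ℤ} (hp : p ∉ M.black) (a : ℂ) :
    psiStar p (Finsupp.single M a) = 0 := by
  simp [psiStar, Finsupp.linearCombination_single, hp]

/-- To compare two operators on Fock space it suffices to apply them to Maya diagrams. -/
theorem Fock.end_ext {S T : Module.End ℂ Fock}
    (h : ∀ M : Maya, S (Finsupp.single M 1) = T (Finsupp.single M 1)) : S = T :=
  Finsupp.lhom_ext' fun M => LinearMap.ext_ring (h M)

theorem psi_mul_psi (p q : ℤ) : psi p * psi q = -(psi q * psi p) := by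
  refine Fock.end_ext fun M => ?_
  simp only [Module.End.mul_apply, LinearMap.neg_apply]
  by_cases hp : p ∈ M.black
  · rw [psi_single_of_mem hp, map_zero, neg_zero]
    by_cases hq : q ∈ M.black
    · rw [psi_single_of_mem hq, map_zero]
    · rw [psi_single_of_notMem hq, psi_single_of_mem (by simp [hp])]
  by_cases hq : q ∈ M.black
  · rw [psi_single_of_mem hq, psi_single_of_notMem hp, psi_single_of_mem (by simp [hq])]
    simp
  by_cases hpq : p = q
  · subst hpq
    rw [psi_single_of_notMem hq, psi_single_of_mem (by simp)]
    simp
  rw [psi_single_of_notMem hq, psi_single_of_notMem hp, psi_single_of_notMem (by simp [hp, hpq]),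
    psi_single_of_notMem (by simp [hq, Ne.symm hpq]), M.insert_comm, ← Finsupp.single_neg,
    Maya.sign_insert hq, Maya.sign_insert hp]
  congr 1
  rcases lt_or_gt_of_ne hpq with h | h
  · rw [if_pos h, if_neg h.not_gt]; ring
  · rw [if_neg h.not_gt, if_pos h]; ring

theorem psiStar_mul_psiStar (p q : ℤ) : psiStar p * psiStar q = -(psiStar q * psiStar p) := by
  refine Fock.end_ext fun M => ?_
  simp only [Module.End.mul_apply, LinearMap.neg_apply]
  by_cases hp : p ∈ M.black
  swap
  · rw [psiStar_single_of_notMem hp, map_zero, neg_zero]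
    by_cases hq : q ∈ M.black
    · rw [psiStar_single_of_mem hq, psiStar_single_of_notMem (by simp [hp])]
    · rw [psiStar_single_of_notMem hq, map_zero]
  by_cases hq : q ∈ M.black
  swap
  · rw [psiStar_single_of_notMem hq, psiStar_single_of_mem hp,
      psiStar_single_of_notMem (by simp [hq])]
    simp
  by_cases hpq : p = q
  · subst hpq
    rw [psiStar_single_of_mem hq, psiStar_single_of_notMem (by simp)]
    simp
  rw [psiStar_single_of_mem hq, psiStar_single_of_mem hp,
    psiStar_single_of_mem (by simp [hp, hpq]),
    psiStar_single_of_mem (by simp [hq, Ne.symm hpq]), M.erase_comm, ← Finsupp.single_neg,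
    Maya.sign_erase hq, Maya.sign_erase hp]
  congr 1
  rcases lt_or_gt_of_ne hpq with h | h
  · rw [if_pos h, if_neg h.not_gt]; ring
  · rw [if_neg h.not_gt, if_pos h]; ring

theorem psiStar_mul_psi (p q : ℤ) :
    psiStar p * psi q = (if p = q then 1 else 0) - psi q * psiStar p := by
  refine Fock.end_ext fun M => ?_
  simp only [Module.End.mul_apply, LinearMap.sub_apply]
  by_cases hpq : p = q
  · subst hpq
    simp only [if_pos, Module.End.one_apply]
    by_cases hp : p ∈ M.black
    · rw [psi_single_of_mem hp, psiStar_single_of_mem hp, psi_single_of_notMem (by simp),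
        Maya.insert_erase hp, Maya.sign_erase hp]
      simp [Maya.sign_mul_self]
    · rw [psi_single_of_notMem hp, psiStar_single_of_notMem hp, psiStar_single_of_mem (by simp),
        Maya.erase_insert hp, Maya.sign_insert hp]
      simp [Maya.sign_mul_self]
  rw [if_neg hpq, LinearMap.zero_apply, zero_sub]
  by_cases hp : p ∈ M.black
  swap
  · rw [psiStar_single_of_notMem hp, map_zero, neg_zero]
    by_cases hq : q ∈ M.black
    · rw [psi_single_of_mem hq, map_zero]
    · rw [psi_single_of_notMem hq, psiStar_single_of_notMem (by simp [hp, hpq])]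
  by_cases hq : q ∈ M.black
  · rw [psi_single_of_mem hq, psiStar_single_of_mem hp,
      psi_single_of_mem (by simp [hq, Ne.symm hpq])]
    simp
  rw [psi_single_of_notMem hq, psiStar_single_of_mem hp, psiStar_single_of_mem (by simp [hp]),
    psi_single_of_notMem (by simp [hq]), M.erase_insert_comm hpq, ← Finsupp.single_neg,
    Maya.sign_insert hq, Maya.sign_erase hp]
  congr 1
  rcases lt_or_gt_of_ne hpq with h | h
  · rw [if_pos h, if_neg h.not_gt]; ring
  · rw [if_neg h.not_gt, if_pos h]; ring

theorem psi_mul_psiStar (p q : ℤ) :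
    psi p * psiStar q = (if p = q then 1 else 0) - psiStar q * psi p := by
  rw [psiStar_mul_psi]
  simp only [eq_comm (a := q)]
  exact (sub_sub_cancel (G := Module.End ℂ Fock) _ _).symm

theorem psi_mul_psiStar_of_ne {p q : ℤ} (h : p ≠ q) :
    psi p * psiStar q = -(psiStar q * psi p) := by
  rw [psi_mul_psiStar, if_neg h, zero_sub (G := Module.End ℂ Fock)]

theorem normalOrdered_of_pos (m : ℤ) {n : ℤ} (hn : 0 < n) :
    normalOrdered m n = psi m * psiStar n := if_neg (by omega)

theorem normalOrdered_of_nonpos (m : ℤ) {n : ℤ} (hn : n ≤ 0) :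
    normalOrdered m n = -(psiStar n * psi m) := by
  unfold normalOrdered
  split_ifs with h
  · rw [h.1]
  · exact psi_mul_psiStar_of_ne (by omega)

theorem normalOrdered_of_ne {m n : ℤ} (h : m ≠ n) : normalOrdered m n = psi m * psiStar n :=
  if_neg fun h' => h h'.1

/-- Normal ordering subtracts from `ψ_m ψ_n^*` its vacuum expectation value. -/
theorem normalOrdered_eq (m n : ℤ) :
    normalOrdered m n = psi m * psiStar n - if m = n ∧ n ≤ 0 then 1 else 0 := by
  unfold normalOrdered
  split_ifs with h
  · rw [psi_mul_psiStar, if_pos h.1, h.1]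
    exact (sub_sub_cancel_left (G := Module.End ℂ Fock) 1 (psiStar n * psi n)).symm
  · exact (sub_zero (G := Module.End ℂ Fock) _).symm

section Anticommutation

variable {R : Type*} [Ring R] {a b : ℤ → R}

/-- Two families with the anticommutation relations of creation and annihilation operators: the
products `a_m b_n` act on the `a_p` by commutators like matrix units on basis vectors. -/
theorem bilinear_mul_of_anticomm (haa : ∀ p q, a p * a q = -(a q * a p))
    (hba : ∀ p q, b p * a q = (if p = q then 1 else 0) - a q * b p) (m n p : ℤ) :
    (a m * b n) * a p = a p * (a m * b n) + if n = p then a m else 0 := by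
  rw [mul_assoc, hba, mul_sub, ← mul_assoc, haa m p, ← mul_assoc]
  split_ifs <;> simp [add_comm]

theorem bilinear_lie_of_anticomm (haa : ∀ p q, a p * a q = -(a q * a p))
    (hbb : ∀ p q, b p * b q = -(b q * b p))
    (hba : ∀ p q, b p * a q = (if p = q then 1 else 0) - a q * b p) (m n p q : ℤ) :
    (a m * b n) * (a p * b q) - (a p * b q) * (a m * b n) =
      (if n = p then a m * b q else 0) - if m = q then a p * b n else 0 := by
  have h1 : (a m * b n) * (a p * b q) =
      (if n = p then a m * b q else 0) - a m * a p * (b n * b q) := by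
    rw [mul_assoc, ← mul_assoc (b n), hba, sub_mul, mul_sub]
    split_ifs <;> simp [mul_assoc]
  have h2 : (a p * b q) * (a m * b n) =
      (if m = q then a p * b n else 0) - a p * a m * (b q * b n) := by
    rw [mul_assoc, ← mul_assoc (b q), hba, sub_mul, mul_sub]
    simp only [eq_comm (a := q)]
    split_ifs <;> simp [mul_assoc]
  rw [h1, h2, haa p m, hbb q n, neg_mul_neg]
  abel

end Anticommutation

theorem normalOrdered_mul_psi (m n p : ℤ) :
    normalOrdered m n * psi p = psi p * normalOrdered m n + if n = p then psi m else 0 := by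
  have h := bilinear_mul_of_anticomm (R := Module.End ℂ Fock) psi_mul_psi psiStar_mul_psi m n p
  refine LinearMap.ext fun v => ?_
  have h' := congrArg (fun T : Module.End ℂ Fock => T v) h
  simp only [normalOrdered_eq, Module.End.mul_apply, LinearMap.sub_apply, LinearMap.add_apply,
    map_sub] at h' ⊢
  rw [h']
  split_ifs <;> simp; abel

/-- The normally ordered products satisfy the relations of `a_∞` with `c` acting as `1`: the
products `ψ_m ψ_n^*` satisfy those of the matrix units, and the constants subtracted by normal
ordering produce the cocycle. -/
theorem normalOrdered_lie (m n p q : ℤ) :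
    normalOrdered m n * normalOrdered p q - normalOrdered p q * normalOrdered m n =
      (if n = p then normalOrdered m q else 0) - (if m = q then normalOrdered p n else 0) +
        if n = p ∧ m = q then algebraMap ℂ _ (BandMatrix.cocycleSign m n) else 0 := by
  have h := bilinear_lie_of_anticomm (R := Module.End ℂ Fock) psi_mul_psi psiStar_mul_psiStar
    psiStar_mul_psi m n p q
  have h0 : normalOrdered m n * normalOrdered p q - normalOrdered p q * normalOrdered m n =
      (psi m * psiStar n) * (psi p * psiStar q) - (psi p * psiStar q) * (psi m * psiStar n) := by
    refine LinearMap.ext fun v => ?_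
    simp only [normalOrdered_eq, Module.End.mul_apply, LinearMap.sub_apply, map_sub]
    split_ifs <;> simp
    abel
  rw [h0, h, BandMatrix.cocycleSign_eq]
  refine LinearMap.ext fun v => ?_
  by_cases h1 : n = p <;> by_cases h2 : m = q
  · subst h1 h2
    simp only [normalOrdered_eq, if_true, and_self, true_and, LinearMap.sub_apply,
      LinearMap.add_apply]
    split_ifs <;> first | omega | (simp; try abel)
  · subst h1
    simp [h2, normalOrdered_eq]
  · subst h2
    have h3 : ¬ (p = n ∧ n ≤ 0) := by tauto
    simp [normalOrdered_eq, h1, h3]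
  · simp [h1, h2]

theorem exists_annihilation_bound (v : Fock) :
    ∃ L : ℕ, (∀ m : ℤ, m < -L → psi m v = 0) ∧ ∀ n : ℤ, (L : ℤ) < n → psiStar n v = 0 := by
  induction v using Finsupp.induction_linear with
  | zero => exact ⟨0, by simp, by simp⟩
  | add u v hu hv =>
    obtain ⟨L, h1, h2⟩ := hu
    obtain ⟨L', h3, h4⟩ := hv
    refine ⟨L + L', fun m hm => ?_, fun n hn => ?_⟩
    · rw [map_add, h1 m (by push_cast at hm; omega), h3 m (by push_cast at hm; omega), add_zero]
    · rw [map_add, h2 n (by push_cast at hn; omega), h4 n (by push_cast at hn; omega), add_zero]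
  | single M a =>
    obtain ⟨L, h1, h2⟩ := M.exists_window
    refine ⟨L, fun m hm => psi_single_of_mem ?_ a, fun n hn => psiStar_single_of_notMem ?_ a⟩
    · by_contra h
      have := h2 m h
      omega
    · intro h
      have := h1 n h
      omega

/-- On a fixed vector, only the normally ordered products whose creation index is bounded below and
whose annihilation index is bounded above survive. -/
theorem exists_normalOrdered_bound (v : Fock) :
    ∃ L : ℕ, ∀ m n : ℤ, normalOrdered m n v ≠ 0 → -(L : ℤ) ≤ m ∧ n ≤ L := by
  obtain ⟨L, h1, h2⟩ := exists_annihilation_bound v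
  refine ⟨L, fun m n h => ?_⟩
  by_contra hmn
  refine h ?_
  rcases le_or_gt n 0 with hn | hn
  · rw [normalOrdered_of_nonpos m hn, LinearMap.neg_apply, Module.End.mul_apply,
      h1 m (by omega), map_zero, neg_zero]
  · by_cases hm : m < -L
    · rw [normalOrdered_of_ne (by omega), psi_mul_psiStar_of_ne (by omega),
        LinearMap.neg_apply, Module.End.mul_apply, h1 m hm, map_zero, neg_zero]
    · rw [normalOrdered_of_pos m hn, Module.End.mul_apply, h2 n (by omega), map_zero]

/-! ### The action of `a_∞` on Fock space -/

open Filter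

/-- The integers of absolute value at most `N`. -/
def centredBox (N : ℕ) : Finset ℤ := Finset.Icc (-(N : ℤ)) N

theorem mem_centredBox {N : ℕ} {p : ℤ} : p ∈ centredBox N ↔ -(N : ℤ) ≤ p ∧ p ≤ N :=
  Finset.mem_Icc

/-- The truncation `∑ a_{m,n} Ē_{m,n}`, over `|m|, |n| ≤ N`, of the operator by which a band
matrix acts. -/
def truncatedAct (a : BandMatrix) (N : ℕ) : Module.End ℂ Fock :=
  ∑ m ∈ centredBox N, ∑ n ∈ centredBox N, a.1 m n • normalOrdered m n

theorem truncatedAct_apply (a : BandMatrix) (N : ℕ) (v : Fock) :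
    truncatedAct a N v =
      ∑ m ∈ centredBox N, ∑ n ∈ centredBox N, a.1 m n • normalOrdered m n v := by
  simp only [truncatedAct, LinearMap.sum_apply, LinearMap.smul_apply]

theorem eventually_support_subset (a : BandMatrix) (v : Fock) :
    ∀ᶠ N : ℕ in atTop, ∀ m n : ℤ, a.1 m n • normalOrdered m n v ≠ 0 →
      m ∈ centredBox N ∧ n ∈ centredBox N := by
  obtain ⟨k, hk⟩ := a.exists_width
  obtain ⟨L, hL⟩ := exists_normalOrdered_bound v
  filter_upwards [eventually_ge_atTop (L + k)] with N hN m n h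
  have h1 := hL m n (right_ne_zero_of_smul h)
  have h2 : ¬ (k : ℤ) < |m - n| := fun h' => left_ne_zero_of_smul h (hk m n h')
  rw [lt_abs] at h2
  simp only [mem_centredBox]
  omega

theorem finite_support_act (a : BandMatrix) (v : Fock) :
    {mn : ℤ × ℤ | a.1 mn.1 mn.2 • normalOrdered mn.1 mn.2 v ≠ 0}.Finite := by
  obtain ⟨N, hN⟩ := (eventually_support_subset a v).exists
  exact (centredBox N ×ˢ centredBox N).finite_toSet.subset fun mn h =>
    Finset.mem_coe.mpr (Finset.mem_product.mpr (hN mn.1 mn.2 h))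

theorem eventually_finsum_eq (a : BandMatrix) (v : Fock) :
    ∀ᶠ N : ℕ in atTop,
      ∑ᶠ mn : ℤ × ℤ, a.1 mn.1 mn.2 • normalOrdered mn.1 mn.2 v = truncatedAct a N v := by
  filter_upwards [eventually_support_subset a v] with N hN
  rw [truncatedAct_apply, ← Finset.sum_product'
    (f := fun m n => a.1 m n • normalOrdered m n v)]
  exact finsum_eq_finsetSum_of_support_subset _ fun mn h =>
    Finset.mem_coe.mpr (Finset.mem_product.mpr (hN mn.1 mn.2 h))

/-- The operator `∑ a_{m,n} Ē_{m,n}` on Fock space, for a band matrix `a`. -/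
def bandAct (a : BandMatrix) : Module.End ℂ Fock where
  toFun v := ∑ᶠ mn : ℤ × ℤ, a.1 mn.1 mn.2 • normalOrdered mn.1 mn.2 v
  map_add' u v := by
    obtain ⟨N, h1, h2, h3⟩ := ((eventually_finsum_eq a (u + v)).and
      ((eventually_finsum_eq a u).and (eventually_finsum_eq a v))).exists
    rw [h1, h2, h3, map_add]
  map_smul' r v := by
    obtain ⟨N, h1, h2⟩ := ((eventually_finsum_eq a (r • v)).and (eventually_finsum_eq a v)).exists
    rw [h1, h2, map_smul, RingHom.id_apply]

/-- On a given vector, the action of a band matrix agrees with its large truncations. This reduces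
identities between such operators to identities between finite sums. -/
theorem eventually_bandAct_eq (a : BandMatrix) (v : Fock) :
    ∀ᶠ N : ℕ in atTop, bandAct a v = truncatedAct a N v :=
  eventually_finsum_eq a v

theorem bandAct_add (a b : BandMatrix) : bandAct (a + b) = bandAct a + bandAct b := by
  refine LinearMap.ext fun v => ?_
  obtain ⟨N, h1, h2, h3⟩ := ((eventually_bandAct_eq (a + b) v).and
      ((eventually_bandAct_eq a v).and (eventually_bandAct_eq b v))).exists
  rw [LinearMap.add_apply, h1, h2, h3]
  simp only [truncatedAct_apply, ← Finset.sum_add_distrib, ← add_smul]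
  rfl

theorem bandAct_smul (r : ℂ) (a : BandMatrix) : bandAct (r • a) = r • bandAct a := by
  refine LinearMap.ext fun v => ?_
  obtain ⟨N, h1, h2⟩ := ((eventually_bandAct_eq (r • a) v).and (eventually_bandAct_eq a v)).exists
  rw [LinearMap.smul_apply, h1, h2]
  simp only [truncatedAct_apply, Finset.smul_sum, smul_smul]
  rfl

theorem bandAct_zero : bandAct 0 = 0 := by
  have h := bandAct_smul 0 0
  rwa [zero_smul, zero_smul] at h

theorem normalOrdered_lie_apply (m n p q : ℤ) (v : Fock) :
    normalOrdered m n (normalOrdered p q v) - normalOrdered p q (normalOrdered m n v) =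
      (if n = p then normalOrdered m q v else 0) - (if m = q then normalOrdered p n v else 0) +
        if n = p then if m = q then BandMatrix.cocycleSign m n • v else 0 else 0 := by
  have h := congrArg (fun T : Module.End ℂ Fock => T v) (normalOrdered_lie m n p q)
  simp only [LinearMap.sub_apply, LinearMap.add_apply, Module.End.mul_apply] at h
  rw [h]
  by_cases h1 : n = p <;> by_cases h2 : m = q <;>
    simp [h1, h2]

theorem truncatedAct_truncatedAct (a b : BandMatrix) (N : ℕ) (v : Fock) :
    truncatedAct a N (truncatedAct b N v) =
      ∑ x ∈ centredBox N ×ˢ centredBox N, ∑ y ∈ centredBox N ×ˢ centredBox N,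
        (a.1 x.1 x.2 * b.1 y.1 y.2) • normalOrdered x.1 x.2 (normalOrdered y.1 y.2 v) := by
  rw [Finset.sum_comm]
  simp only [truncatedAct_apply, map_sum, map_smul, Finset.smul_sum, smul_smul,
    Finset.sum_product, mul_comm (a.1 _ _)]

section SumDelta

variable {ι A : Type*} [DecidableEq ι] [AddCommMonoid A] (S : Finset ι)

theorem Finset.sum_sum_ite_inner_eq (F : ι → ι → ι → ι → A) :
    ∑ m ∈ S, ∑ n ∈ S, ∑ p ∈ S, ∑ q ∈ S, (if n = p then F m n p q else 0) =
      ∑ m ∈ S, ∑ q ∈ S, ∑ n ∈ S, F m n n q := by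
  refine Finset.sum_congr rfl fun m _ => ?_
  rw [Finset.sum_comm (s := S) (t := S) (f := fun q n => F m n n q)]
  refine Finset.sum_congr rfl fun n hn => ?_
  rw [Finset.sum_comm]
  refine Finset.sum_congr rfl fun q _ => ?_
  rw [Finset.sum_ite_eq, if_pos hn]

theorem Finset.sum_sum_ite_outer_eq (F : ι → ι → ι → ι → A) :
    ∑ m ∈ S, ∑ n ∈ S, ∑ p ∈ S, ∑ q ∈ S, (if m = q then F m n p q else 0) =
      ∑ p ∈ S, ∑ n ∈ S, ∑ m ∈ S, F m n p m := by
  have h : ∀ m ∈ S, ∀ n ∈ S, ∀ p ∈ S,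
      ∑ q ∈ S, (if m = q then F m n p q else 0) = F m n p m := fun m hm n _ p _ => by
    rw [Finset.sum_ite_eq, if_pos hm]
  rw [Finset.sum_congr rfl fun m hm => Finset.sum_congr rfl fun n hn =>
    Finset.sum_congr rfl fun p hp => h m hm n hn p hp]
  rw [Finset.sum_comm, Finset.sum_comm (s := S) (t := S) (f := fun p n => ∑ m ∈ S, F m n p m)]
  exact Finset.sum_congr rfl fun n _ => Finset.sum_comm

end SumDelta

/-- The commutation relations of normally ordered products, summed over a finite box. -/
theorem truncatedAct_lie (a b : BandMatrix) (N : ℕ) (v : Fock) :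
    truncatedAct a N (truncatedAct b N v) - truncatedAct b N (truncatedAct a N v) =
      (∑ m ∈ centredBox N, ∑ q ∈ centredBox N,
        (∑ n ∈ centredBox N, a.1 m n * b.1 n q) • normalOrdered m q v) -
      (∑ m ∈ centredBox N, ∑ q ∈ centredBox N,
        (∑ n ∈ centredBox N, b.1 m n * a.1 n q) • normalOrdered m q v) +
      (∑ m ∈ centredBox N, ∑ n ∈ centredBox N,
        BandMatrix.cocycleSign m n * (a.1 m n * b.1 n m)) • v := by
  rw [truncatedAct_truncatedAct, truncatedAct_truncatedAct,
    Finset.sum_comm (f := fun x y : ℤ × ℤ =>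
      (b.1 x.1 x.2 * a.1 y.1 y.2) • normalOrdered x.1 x.2 (normalOrdered y.1 y.2 v))]
  simp only [← Finset.sum_sub_distrib, mul_comm (b.1 _ _) (a.1 _ _), ← smul_sub,
    normalOrdered_lie_apply]
  simp only [smul_add, smul_sub, smul_ite, smul_zero, Finset.sum_add_distrib,
    Finset.sum_sub_distrib, Finset.sum_product, Finset.sum_sum_ite_inner_eq,
    Finset.sum_sum_ite_outer_eq, Finset.sum_smul, smul_smul,
    mul_comm (BandMatrix.cocycleSign _ _)]
  congr 1
  refine Finset.sum_congr rfl fun m hm => ?_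
  rw [Finset.sum_comm]
  refine Finset.sum_congr rfl fun n hn => ?_
  rw [Finset.sum_ite_eq, if_pos hm]

/-- Truncating the inner index of a product of band matrices is harmless once the truncation
is large, because only the entries near the diagonal inside a bounded window act. -/
theorem eventually_truncatedAct_mul (a b : BandMatrix) (v : Fock) :
    ∀ᶠ N : ℕ in atTop, ∑ m ∈ centredBox N, ∑ q ∈ centredBox N,
      (∑ n ∈ centredBox N, a.1 m n * b.1 n q) • normalOrdered m q v =
        truncatedAct (a * b) N v := by
  obtain ⟨k, hk⟩ := a.exists_width
  obtain ⟨l, hl⟩ := b.exists_width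
  obtain ⟨L, hL⟩ := exists_normalOrdered_bound v
  filter_upwards [eventually_ge_atTop (L + 2 * k + l)] with N hN
  rw [truncatedAct_apply]
  refine Finset.sum_congr rfl fun m hm => Finset.sum_congr rfl fun q hq => ?_
  by_cases h : normalOrdered m q v = 0
  · rw [h, smul_zero, smul_zero]
  have h1 := hL m q h
  by_cases hm' : m ≤ L + k + l
  · rw [BandMatrix.mul_apply_sum a b hk m q]
    intro n hn
    rw [Finset.mem_Icc] at hn
    rw [mem_centredBox]
    omega
  -- here every summand vanishes, since `m` is too far from `q ≤ L` for both bands to allow it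
  · have : ∀ n : ℤ, a.1 m n * b.1 n q = 0 := fun n => by
      by_cases hn : (k : ℤ) < |m - n|
      · rw [hk m n hn, zero_mul]
      · rw [hl n q, mul_zero]
        rw [lt_abs] at hn ⊢
        omega
    rw [BandMatrix.mul_apply]
    simp [this]

/-- Only the entries `a_{m,n} b_{n,m}` for which `m` and `n` lie on different sides of the origin
and near each other contribute to the cocycle. -/
theorem eventually_cocycle_eq (a b : BandMatrix) :
    ∀ᶠ N : ℕ in atTop, BandMatrix.cocycle a b =
      ∑ m ∈ centredBox N, ∑ n ∈ centredBox N,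
        BandMatrix.cocycleSign m n * (a.1 m n * b.1 n m) := by
  obtain ⟨k, hk⟩ := a.exists_width
  filter_upwards [eventually_ge_atTop k] with N hN
  exact BandMatrix.cocycle_eq_sum a b hk (Finset.Icc_subset_Icc (by omega) (by omega))

theorem bandAct_lie (a b : BandMatrix) (v : Fock) :
    bandAct a (bandAct b v) - bandAct b (bandAct a v) =
      bandAct ⁅a, b⁆ v + BandMatrix.cocycle a b • v := by
  have hsub : bandAct ⁅a, b⁆ v = bandAct (a * b) v - bandAct (b * a) v := by
    have h : (⁅a, b⁆ : BandMatrix) = a * b + (-1 : ℂ) • (b * a) := by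
      rw [neg_one_smul, ← sub_eq_add_neg]; rfl
    rw [h, bandAct_add, bandAct_smul]
    simp [sub_eq_add_neg]
  obtain ⟨N, h⟩ := ((eventually_bandAct_eq a (bandAct b v)).and
    ((eventually_bandAct_eq b (bandAct a v)).and ((eventually_bandAct_eq a v).and
    ((eventually_bandAct_eq b v).and ((eventually_bandAct_eq (a * b) v).and
    ((eventually_bandAct_eq (b * a) v).and ((eventually_truncatedAct_mul a b v).and
    ((eventually_truncatedAct_mul b a v).and (eventually_cocycle_eq a b))))))))).exists
  obtain ⟨h1, h2, h3, h4, h5, h6, h7, h8, h9⟩ := h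
  rw [hsub, h1, h2, h3, h4, h5, h6, h9, ← h7, ← h8, truncatedAct_lie]

/-- The representation of `a_∞` on Fock space. -/
def aInfAct : AInf →ₗ⁅ℂ⁆ Module.End ℂ Fock where
  toFun x := x.central • 1 + bandAct x.mat
  map_add' x y := by
    refine LinearMap.ext fun v => ?_
    simp only [AInf.central_add, AInf.mat_add, bandAct_add, LinearMap.add_apply,
      LinearMap.smul_apply, add_smul]
    abel
  map_smul' r x := by
    refine LinearMap.ext fun v => ?_
    simp only [AInf.central_smul, AInf.mat_smul, bandAct_smul, LinearMap.add_apply,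
      LinearMap.smul_apply, mul_smul, smul_add, RingHom.id_apply]
  map_lie' {x y} := by
    refine LinearMap.ext fun v => ?_
    have h := bandAct_lie x.mat y.mat v
    simp only [AInf.central_lie, AInf.mat_lie, Ring.lie_def, LinearMap.add_apply,
      LinearMap.sub_apply, LinearMap.smul_apply, Module.End.mul_apply, Module.End.one_apply,
      map_add, map_smul] at h ⊢
    rw [add_comm, ← h]
    simp only [smul_add, smul_comm y.central x.central]
    abel

theorem aInfAct_apply (x : AInf) (v : Fock) :
    aInfAct x v = x.central • v + bandAct x.mat v := rfl

/-! ### Faithfulness, and the completed Clifford algebra -/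

theorem eventually_subset_centredBox (S : Finset ℤ) : ∀ᶠ N : ℕ in atTop, S ⊆ centredBox N := by
  obtain ⟨a, ha⟩ := S.bddAbove
  obtain ⟨b, hb⟩ := S.bddBelow
  filter_upwards [eventually_ge_atTop (a.natAbs + b.natAbs)] with N hN p hp
  have h1 := ha hp
  have h2 := hb hp
  rw [mem_centredBox]
  omega

/-- The action of `a_∞` is compatible with wedging: `[x, ψ_p] = ∑_m x_{m,p} ψ_m`. -/
theorem aInfAct_psi (x : AInf) (p : ℤ) {S : Finset ℤ} (hS : ∀ m ∉ S, x.mat.1 m p = 0) (v : Fock) :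
    aInfAct x (psi p v) = psi p (aInfAct x v) + ∑ m ∈ S, x.mat.1 m p • psi m v := by
  obtain ⟨N, h1, h2, h3⟩ := ((eventually_bandAct_eq x.mat (psi p v)).and
    ((eventually_bandAct_eq x.mat v).and (eventually_subset_centredBox (insert p S)))).exists
  have hp : p ∈ centredBox N := h3 (Finset.mem_insert_self p S)
  have key : ∀ m n : ℤ, normalOrdered m n (psi p v) =
      psi p (normalOrdered m n v) + if n = p then psi m v else 0 := fun m n => by
    have := congrArg (fun T : Module.End ℂ Fock => T v) (normalOrdered_mul_psi m n p)
    simp only [LinearMap.add_apply, Module.End.mul_apply] at this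
    rw [this]
    split_ifs <;> rfl
  rw [aInfAct_apply, aInfAct_apply, h1, h2, truncatedAct_apply, truncatedAct_apply, map_add,
    map_smul, add_assoc, Finset.sum_subset ((Finset.subset_insert p S).trans h3)
      fun m _ hm => by rw [hS m hm, zero_smul]]
  simp only [map_sum, map_smul, key, smul_add, Finset.sum_add_distrib, smul_ite, smul_zero,
    Finset.sum_ite_eq', hp, if_true]

/-- The Maya diagram with black beads exactly at the positions at most `c`. -/
def Maya.vacuum (c : ℤ) : Maya where
  black := Set.Iic c
  finite_black_pos := (Set.finite_Icc 0 c).subset fun _ h => ⟨h.1.le, h.2⟩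
  finite_white_neg := (Set.finite_Icc c 0).subset fun p h => by
    have : ¬ p ≤ c := h.2
    exact ⟨by omega, h.1⟩

@[simp] theorem Maya.mem_vacuum {c p : ℤ} : p ∈ (Maya.vacuum c).black ↔ p ≤ c := Iff.rfl

theorem Maya.insert_injective {M : Maya} {p q : ℤ} (hp : p ∉ M.black)
    (h : M.insert p = M.insert q) : p = q := by
  have : p ∈ (M.insert q).black := by rw [← h]; simp
  rw [Maya.mem_insert] at this
  tauto

/-- The matrix of an element of `a_∞` is read off from its commutators with the `ψ_p`, and its
central part from what remains. -/
theorem aInfAct_injective : Function.Injective aInfAct := by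
  rw [injective_iff_map_eq_zero]
  intro x hx
  obtain ⟨k, hk⟩ := x.mat.exists_width
  have hmat : ∀ m p, x.mat.1 m p = 0 := fun m p => by
    by_cases hm : m ∈ Finset.Icc (p - k) (p + k)
    swap
    · rw [Finset.mem_Icc] at hm
      exact hk m p (by rw [lt_abs]; omega)
    -- wedging onto a vacuum far below all the indices involved separates the entries
    set M := Maya.vacuum (p - k - 1) with hM
    have hmem : ∀ m ∈ Finset.Icc (p - (k : ℤ)) (p + k), m ∉ M.black := fun m hm => by
      rw [Finset.mem_Icc] at hm
      rw [hM, Maya.mem_vacuum]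
      omega
    have h := aInfAct_psi x p (S := Finset.Icc (p - k) (p + k)) (fun m hm => hk m p (by
      rw [Finset.mem_Icc] at hm
      rw [lt_abs]; omega)) (Finsupp.single M 1)
    rw [hx, LinearMap.zero_apply, LinearMap.zero_apply, map_zero, zero_add] at h
    have h' := congrArg (fun v : Fock => v (M.insert m)) h
    simp only [Finsupp.coe_zero, Pi.zero_apply, Finsupp.finsetSum_apply, Finsupp.smul_apply] at h'
    rw [Finset.sum_eq_single m] at h'
    · rw [psi_single_of_notMem (hmem m hm), Finsupp.single_eq_same, one_mul] at h'
      exact (mul_eq_zero.mp h'.symm).resolve_right (M.sign_ne_zero m)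
    · intro q hq hqm
      rw [psi_single_of_notMem (hmem q hq), Finsupp.single_eq_of_ne, smul_zero]
      exact fun h => hqm (Maya.insert_injective (hmem m hm) h).symm
    · exact fun h => absurd hm h
  have hmat' : x.mat = 0 := Subtype.ext (funext fun m => funext fun p => hmat m p)
  have hc : x.central = 0 := by
    have h := congrArg (fun T : Module.End ℂ Fock =>
      T (Finsupp.single (Maya.vacuum 0) 1) (Maya.vacuum 0)) hx
    simpa [aInfAct_apply, hmat', bandAct_zero] using h
  exact AInf.ext hmat' hc

/-- The terms `-a_{m,n} ψ_n^* ψ_m` with `n` nonpositive are collected by `m`, and the terms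
`a_{m,n} ψ_m ψ_n^*` with `n` positive by `n`; by the band condition each collection is finite, and
in the former `m` is bounded above. -/
theorem aInfAct_mem_cliffordCompletion (x : AInf) : aInfAct x ∈ cliffordCompletion := by
  obtain ⟨k, hk⟩ := x.mat.exists_width
  have hpsi : ∀ m, psi m ∈ cliffordAlg := fun m =>
    Algebra.subset_adjoin (Or.inl ⟨m, rfl⟩)
  have hpsiStar : ∀ m, psiStar m ∈ cliffordAlg := fun m =>
    Algebra.subset_adjoin (Or.inr ⟨m, rfl⟩)
  refine ⟨x.central, k + 1, 0,
    fun m => ∑ n ∈ Finset.Icc (m - k) 0, (-x.mat.1 m n) • psiStar n,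
    fun n => ∑ m ∈ Finset.Icc (n - k) (n + k), x.mat.1 m n • psi m,
    fun m => sum_mem fun n _ => cliffordAlg.smul_mem (hpsiStar n) _,
    fun n => sum_mem fun m _ => cliffordAlg.smul_mem (hpsi m) _, fun v => ?_⟩
  -- on `v`, both infinite sums reduce to the same large finite truncation
  obtain ⟨L, hL1, hL2⟩ := exists_annihilation_bound v
  obtain ⟨N, h, hN⟩ := ((eventually_bandAct_eq x.mat v).and
    (eventually_ge_atTop (L + k + 1))).exists
  have key : ∀ m n : ℤ, x.mat.1 m n • normalOrdered m n v =
      (if n ≤ 0 then (-x.mat.1 m n) • psiStar n (psi m v) else 0) +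
        if 0 < n then x.mat.1 m n • psi m (psiStar n v) else 0 := fun m n => by
    rcases le_or_gt n 0 with hn | hn
    · rw [if_pos hn, if_neg hn.not_gt, normalOrdered_of_nonpos m hn, add_zero, neg_smul,
        LinearMap.neg_apply, smul_neg]
      rfl
    · rw [if_neg hn.not_ge, if_pos hn, normalOrdered_of_pos m hn, zero_add]
      rfl
  rw [aInfAct_apply, h, truncatedAct_apply, add_assoc]
  simp only [key, Finset.sum_add_distrib]
  congr 2
  · rw [finsum_mem_eq_sum_of_inter_support_eq (t := centredBox N)]
    · refine Finset.sum_congr rfl fun m _ => ?_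
      rw [← Finset.sum_filter]
      simp only [LinearMap.sum_apply, LinearMap.smul_apply]
      by_cases hm : m < -L
      · simp [hL1 m hm]
      · symm
        refine Finset.sum_subset (fun n hn => ?_) fun n hn hn' => ?_
        · rw [Finset.mem_Icc] at hn
          rw [Finset.mem_filter, mem_centredBox]
          omega
        · rw [Finset.mem_filter, mem_centredBox] at hn
          rw [Finset.mem_Icc] at hn'
          rw [hk m n (by rw [lt_abs]; omega), neg_zero, zero_smul]
    · ext m
      simp only [Set.mem_inter_iff, Function.mem_support, Set.mem_Iio, Finset.mem_coe,
        mem_centredBox]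
      refine and_congr_left fun hm => ?_
      have h1 : ¬ m < -L := fun h' => hm (by rw [hL1 m h', map_zero])
      have h2 : ¬ (k : ℤ) < m := fun h' => hm (by
        rw [Finset.Icc_eq_empty (by omega), Finset.sum_empty, LinearMap.zero_apply])
      omega
  · rw [finsum_mem_eq_sum_of_inter_support_eq (t := (centredBox N).filter (0 < ·)),
      Finset.sum_comm, Finset.sum_filter]
    · refine Finset.sum_congr rfl fun n _ => ?_
      split_ifs with hn
      swap
      · exact Finset.sum_const_zero
      simp only [LinearMap.sum_apply, LinearMap.smul_apply]
      by_cases hn' : (L : ℤ) < n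
      · simp [hL2 n hn']
      · symm
        refine Finset.sum_subset (fun m hm => ?_) fun m hm hm' => ?_
        · rw [Finset.mem_Icc] at hm
          rw [mem_centredBox]
          omega
        · rw [Finset.mem_Icc] at hm'
          rw [hk m n (by rw [lt_abs]; omega), zero_smul]
    · ext n
      simp only [Set.mem_inter_iff, Function.mem_support, Set.mem_Ioi, Finset.mem_coe,
        Finset.mem_filter, mem_centredBox]
      refine and_congr_left fun hn => ?_
      have h1 : ¬ (L : ℤ) < n := fun h' => hn (by rw [hL2 n h', map_zero])
      omega

/-! ### The Heisenberg operators -/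

theorem finsum_eq_finsum_comp {α β A : Type*} [AddCommMonoid A] {f : β → A} {e : α → β}
    (he : Function.Injective e) (hf : Function.support f ⊆ Set.range e) :
    ∑ᶠ b, f b = ∑ᶠ a, f (e a) := by
  rw [← finsum_mem_univ f, ← finsum_mem_range he, ← finsum_mem_inter_support,
    ← finsum_mem_inter_support (s := Set.range e), Set.univ_inter, Set.inter_eq_right.mpr hf]

/-- The signed number of integers crossing the origin under translation by `j` is `j`. This is the
source of both the central term of the affine Lie algebra and the charge of a vacuum. -/
theorem finsum_crossing (j : ℤ) :
    ∑ᶠ p : ℤ, ((if 0 < p + j then 1 else 0) - (if 0 < p then 1 else 0) : ℤ) = j := by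
  rcases le_total 0 j with hj | hj
  · rw [finsum_eq_finsetSum_of_support_subset (s := Finset.Ioc (-j) 0)]
    · rw [Finset.sum_congr rfl (g := fun _ => (1 : ℤ))]
      · simp [hj]
      · intro p hp
        rw [Finset.mem_Ioc] at hp
        rw [if_pos (by omega), if_neg (by omega), sub_zero]
    · intro p hp
      rw [Finset.mem_coe, Finset.mem_Ioc]
      by_contra h
      refine hp ?_
      dsimp only
      split_ifs <;> omega
  · rw [finsum_eq_finsetSum_of_support_subset (s := Finset.Ioc 0 (-j))]
    · rw [Finset.sum_congr rfl (g := fun _ => (-1 : ℤ))]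
      · simp [hj]
      · intro p hp
        rw [Finset.mem_Ioc] at hp
        rw [if_neg (by omega), if_pos (by omega), zero_sub]
    · intro p hp
      rw [Finset.mem_coe, Finset.mem_Ioc]
      by_contra h
      refine hp ?_
      dsimp only
      split_ifs <;> omega

theorem finsum_cocycleSign_add (j : ℤ) :
    ∑ᶠ p : ℤ, BandMatrix.cocycleSign p (p + j) = j := by
  have h := congrArg (Int.castAddHom ℂ) (finsum_crossing j)
  rw [AddMonoidHom.map_finsum_of_injective _ Int.cast_injective] at h
  simpa [BandMatrix.cocycleSign_eq] using h

/-- The band matrix with ones on its `k`-th diagonal, corresponding to `∑_p Ē_{p,p+k}`. -/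
def shiftBand (k : ℤ) : BandMatrix :=
  ⟨fun p q => if q = p + k then 1 else 0, k.natAbs, fun p q h => if_neg (by
    rintro rfl
    rw [lt_abs] at h
    omega)⟩

theorem shiftBand_apply (k p q : ℤ) :
    (shiftBand k).1 p q = if q = p + k then 1 else 0 := rfl

theorem shiftBand_mul (j k : ℤ) : shiftBand j * shiftBand k = shiftBand (j + k) := by
  ext p q
  rw [BandMatrix.mul_apply, finsum_eq_single _ (p + j)]
  · simp only [shiftBand_apply, if_true, one_mul, add_assoc]
  · intro r hr
    rw [shiftBand_apply, if_neg hr, zero_mul]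

/-- The cocycle is a sum over the pairs `(p, p + j)`, whose signs count the crossings of the
origin. -/
theorem cocycle_shiftBand (j k : ℤ) :
    BandMatrix.cocycle (shiftBand j) (shiftBand k) = if j = -k then (j : ℂ) else 0 := by
  rw [BandMatrix.cocycle, finsum_eq_finsum_comp (e := fun p : ℤ => (p, p + j))
    (fun p q h => congrArg Prod.fst h)]
  · split_ifs with h
    · refine Eq.trans (finsum_congr fun p => ?_) (finsum_cocycleSign_add j)
      rw [shiftBand_apply, shiftBand_apply, if_pos rfl, if_pos (by dsimp only; omega), one_mul,
        mul_one]
    · refine Eq.trans (finsum_congr fun p => ?_) finsum_zero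
      rw [shiftBand_apply _ (p + j), if_neg (by dsimp only; omega), mul_zero, mul_zero]
  · rintro ⟨p, q⟩ h
    refine ⟨p, ?_⟩
    by_contra hq
    refine h ?_
    dsimp only
    rw [shiftBand_apply, if_neg (fun h' => hq (by rw [h'])), zero_mul, mul_zero]

/-- The Heisenberg generator `α_k`, as the action of `∑_p Ē_{p,p+k}`. -/
def alphaOp (k : ℤ) : Module.End ℂ Fock := bandAct (shiftBand k)

theorem aInfAct_mk_zero (a : BandMatrix) : aInfAct ⟨a, 0⟩ = bandAct a := by
  refine LinearMap.ext fun v => ?_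
  rw [aInfAct_apply, zero_smul, zero_add]

theorem alphaOp_lie (j k : ℤ) : ⁅alphaOp j, alphaOp k⁆ =
    if j = -k then (j : ℂ) • (1 : Module.End ℂ Fock) else 0 := by
  refine LinearMap.ext fun v => ?_
  refine (bandAct_lie (shiftBand j) (shiftBand k) v).trans ?_
  have h : (⁅shiftBand j, shiftBand k⁆ : BandMatrix) = 0 := by
    rw [Ring.lie_def, shiftBand_mul, shiftBand_mul, add_comm, sub_self]
  rw [h, bandAct_zero, LinearMap.zero_apply, zero_add, cocycle_shiftBand]
  split_ifs
  · rfl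
  · simp

/-- For `k ≠ 0` no normal ordering is needed, and `α_k` is the locally finite sum
`∑_m ψ_m ψ_{m+k}^*`. -/
theorem finsum_alpha_term (k : ℤ) (hk : k ≠ 0) (v : Fock) :
    {m : ℤ | psi m (psiStar (m + k) v) ≠ 0}.Finite ∧ alphaOp k v = alphaApply k v := by
  have hinj : Function.Injective fun m : ℤ => (m, m + k) := fun p q h => congrArg Prod.fst h
  have hterm : ∀ m : ℤ, (shiftBand k).1 m (m + k) • normalOrdered m (m + k) v =
      psi m (psiStar (m + k) v) := fun m => by
    rw [shiftBand_apply, if_pos rfl, one_smul, normalOrdered_of_ne (by omega)]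
    rfl
  constructor
  · refine ((finite_support_act (shiftBand k) v).preimage hinj.injOn).subset fun m hm => ?_
    rw [Set.mem_preimage, Set.mem_ofPred_eq, hterm]
    exact hm
  · refine (finsum_eq_finsum_comp hinj ?_).trans (finsum_congr hterm)
    rintro ⟨p, q⟩ h
    refine ⟨p, ?_⟩
    by_contra hq
    refine h ?_
    dsimp only
    rw [shiftBand_apply, if_neg (fun h' => hq (by rw [h'])), zero_smul]

theorem alphaOp_psi (k p : ℤ) (v : Fock) :
    alphaOp k (psi p v) = psi p (alphaOp k v) + psi (p - k) v := by
  have h := aInfAct_psi ⟨shiftBand k, 0⟩ p (S := {p - k}) (fun m hm => by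
    rw [shiftBand_apply, if_neg]
    rw [Finset.mem_singleton] at hm
    omega) v
  rw [aInfAct_mk_zero, Finset.sum_singleton, shiftBand_apply, if_pos (by omega), one_smul] at h
  exact h

theorem alphaOp_vacuum {k : ℤ} (hk : 0 < k) (c : ℤ) :
    alphaOp k (Finsupp.single (Maya.vacuum c) 1) = 0 := by
  rw [(finsum_alpha_term k hk.ne' _).2, alphaApply]
  refine (finsum_congr fun m => ?_).trans finsum_zero
  by_cases hm : m + k ≤ c
  · rw [psiStar_single_of_mem (Maya.mem_vacuum.mpr hm), psi_single_of_mem]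
    rw [Maya.mem_erase, Maya.mem_vacuum]
    omega
  · rw [psiStar_single_of_notMem (fun h => hm (Maya.mem_vacuum.mp h)), map_zero]

/-! ### Transposition -/

/-- The symmetric bilinear form on Fock space for which the Maya diagrams are orthonormal. -/
def Fock.form : LinearMap.BilinForm ℂ Fock :=
  Finsupp.lsum ℂ fun M => (LinearMap.id (R := ℂ) (M := ℂ)).smulRight (Finsupp.lapply (R := ℂ) M)

theorem Fock.form_single_left (M : Maya) (v : Fock) : Fock.form (Finsupp.single M 1) v = v M := by
  simp [Fock.form]

theorem Fock.form_single_right (M : Maya) (v : Fock) : Fock.form v (Finsupp.single M 1) = v M := by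
  induction v using Finsupp.induction_linear with
  | zero => simp
  | add u v hu hv => simp [hu, hv]
  | single M' a =>
    classical
    simp [Fock.form, Finsupp.single_apply, eq_comm]

/-- Wedging and contraction are transposes of each other. -/
theorem Fock.form_psi (p : ℤ) (u v : Fock) :
    Fock.form (psi p u) v = Fock.form u (psiStar p v) := by
  classical
  have : Fock.form ∘ₗ psi p = Fock.form.compl₂ (psiStar p) := by
    refine Finsupp.lhom_ext' fun M => LinearMap.ext_ring (Finsupp.lhom_ext' fun M' =>
      LinearMap.ext_ring ?_)
    change Fock.form (psi p (Finsupp.single M 1)) (Finsupp.single M' 1) =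
      Fock.form (Finsupp.single M 1) (psiStar p (Finsupp.single M' 1))
    rw [Fock.form_single_left, Fock.form_single_right]
    by_cases hM : p ∈ M.black
    · rw [psi_single_of_mem hM, Finsupp.zero_apply]
      by_cases hM' : p ∈ M'.black
      · rw [psiStar_single_of_mem hM', Finsupp.single_eq_of_ne]
        rintro rfl
        simp at hM
      · rw [psiStar_single_of_notMem hM', Finsupp.zero_apply]
    · rw [psi_single_of_notMem hM]
      by_cases hM' : p ∈ M'.black
      · rw [psiStar_single_of_mem hM', Finsupp.single_apply, Finsupp.single_apply]
        by_cases h : M.insert p = M'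
        · subst h
          rw [if_pos rfl, if_pos (Maya.erase_insert hM), Maya.sign_insert hM, if_neg (by omega),
            one_mul, one_mul]
        · rw [if_neg h, if_neg]
          rintro rfl
          exact h (Maya.insert_erase hM')
      · rw [psiStar_single_of_notMem hM', Finsupp.zero_apply, Finsupp.single_eq_of_ne]
        rintro rfl
        simp at hM'
  exact LinearMap.congr_fun (LinearMap.congr_fun this u) v

theorem Fock.form_comm (u v : Fock) : Fock.form u v = Fock.form v u := by
  induction u using Finsupp.induction_linear with
  | zero => simp
  | add u w hu hw => simp [hu, hw]
  | single M a =>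
    rw [← mul_one a, ← smul_eq_mul, ← Finsupp.smul_single, map_smul, map_smul,
      LinearMap.smul_apply, Fock.form_single_left, Fock.form_single_right]

/-- The Heisenberg operators `α_k` and `α_{-k}` are transposes of each other. -/
theorem Fock.form_alphaOp {k : ℤ} (hk : k ≠ 0) (u v : Fock) :
    Fock.form (alphaOp k u) v = Fock.form u (alphaOp (-k) v) := by
  obtain ⟨hu, hu'⟩ := finsum_alpha_term k hk u
  obtain ⟨hv, hv'⟩ := finsum_alpha_term (-k) (neg_ne_zero.mpr hk) v
  have e : ∀ m, Fock.form (psi m (psiStar (m + k) u)) v =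
      Fock.form u (psi (m + k) (psiStar (m + k + -k) v)) := fun m => by
    rw [Fock.form_psi, Fock.form_comm, ← Fock.form_psi, Fock.form_comm, add_neg_cancel_right]
  rw [hu', hv', alphaApply, alphaApply, ← LinearMap.flip_apply,
    map_finsum _ hu, map_finsum _ hv]
  simp only [LinearMap.flip_apply, e]
  exact finsum_comp_equiv (Equiv.addRight k)
    (f := fun m => Fock.form u (psi m (psiStar (m + -k) v)))

/-! ### Embedding the affine Lie algebra into `a_∞` -/

section Coeffs

variable {ℓ : ℕ}

/-- The coefficients of a loop, as a linear equivalence with finitely supported sequences of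
matrices. -/
def Loop.coeffs (ℓ : ℕ) : Loop ℓ ≃ₗ[ℂ] (ℤ →₀ GLie ℓ) :=
  LieAlgebra.LoopAlgebra.toFinsupp ℂ ℤ (GLie ℓ)

theorem Loop.coeffs_mono (X : GLie ℓ) (n : ℤ) :
    Loop.coeffs ℓ (Loop.mono X n) = Finsupp.single n X :=
  LieAlgebra.LoopAlgebra.toFinsupp_single_tmul ℂ ℤ (GLie ℓ) n X

theorem Loop.mono_add (X Y : GLie ℓ) (n : ℤ) :
    Loop.mono (X + Y) n = Loop.mono X n + Loop.mono Y n :=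
  TensorProduct.tmul_add _ _ _

theorem Loop.mono_zero (n : ℤ) : Loop.mono (0 : GLie ℓ) n = 0 :=
  TensorProduct.tmul_zero _ _

theorem Loop.coeffs_degree (f : Loop ℓ) (n : ℤ) :
    Loop.coeffs ℓ (Loop.degree f) n = (n : ℂ) • Loop.coeffs ℓ f n := by
  induction f using Loop.induction with
  | h0 => simp
  | ha x y hx hy => simp only [map_add, Finsupp.add_apply, hx, hy, smul_add]
  | hm X m =>
    rw [Loop.degree_mono, map_smul, Loop.coeffs_mono, Finsupp.smul_apply]
    by_cases h : n = m
    · subst h; rfl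
    · rw [Finsupp.single_eq_of_ne h, smul_zero, smul_zero]

/-- Loops are spanned by the `X ⊗ t ^ n` with `X` a multiple of a matrix unit. -/
theorem Loop.induction_single {P : Loop ℓ → Prop} (x : Loop ℓ) (h0 : P 0)
    (hs : ∀ i j r n, P (Loop.mono (Matrix.single i j r) n))
    (ha : ∀ x y, P x → P y → P (x + y)) : P x := by
  induction x using Loop.induction with
  | h0 => exact h0
  | ha x y hx hy => exact ha x y hx hy
  | hm X n =>
    induction X using Matrix.induction_on' with
    | h_zero => rw [Loop.mono_zero]; exact h0
    | h_add X Y hX hY => rw [Loop.mono_add]; exact ha _ _ hX hY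
    | h_std_basis i j r => exact hs i j r n

end Coeffs

section Embedding

variable {ℓ : ℕ} [NeZero ℓ]

/-- The bijection `(k, i) ↦ i + 1 + k ℓ` between `ℤ × {0, …, ℓ - 1}` and `ℤ`, which cuts the
positions into blocks of length `ℓ`. -/
def site (ℓ : ℕ) [NeZero ℓ] : ℤ × Fin ℓ ≃ ℤ :=
  (Int.divModEquiv ℓ).symm.trans (Equiv.addRight 1)

theorem site_apply (k : ℤ) (i : Fin ℓ) : site ℓ (k, i) = (i : ℤ) + 1 + k * ℓ := by
  change k * ℓ + (i : ℤ) + 1 = _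
  ring

theorem site_pos_iff (k : ℤ) (i : Fin ℓ) : 0 < site ℓ (k, i) ↔ 0 ≤ k := by
  rw [site_apply]
  have := i.2
  constructor
  · intro h
    by_contra hk
    nlinarith
  · intro h
    positivity

theorem exists_eq_site (p : ℤ) : ∃ k i, p = site ℓ (k, i) :=
  ⟨((site ℓ).symm p).1, ((site ℓ).symm p).2, by simp⟩

/-- Distant positions lie in distant blocks. -/
theorem lt_abs_sub_of_lt_abs_site_sub {K : ℕ} {k k' : ℤ} {i i' : Fin ℓ}
    (h : (((K + 1) * ℓ : ℕ) : ℤ) < |site ℓ (k, i) - site ℓ (k', i')|) : (K : ℤ) < |k' - k| := by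
  rw [site_apply, site_apply] at h
  have h1 : ((i : ℕ) : ℤ) < ℓ := by exact_mod_cast i.2
  have h2 : ((i' : ℕ) : ℤ) < ℓ := by exact_mod_cast i'.2
  have h0 : (0 : ℤ) ≤ ℓ := Int.natCast_nonneg ℓ
  push_cast at h
  rw [lt_abs] at h ⊢
  by_contra! hk
  have h3 := mul_le_mul_of_nonneg_right hk.1 h0
  have h4 := mul_le_mul_of_nonneg_right hk.2 h0
  rcases h with h | h <;> nlinarith

/-- The band matrix of a loop, which is the matrix of multiplication by the loop on
`ℂ^ℓ ⊗ ℂ[t, t⁻¹]` in the basis indexed by `site`: on the blocks `(k, k')` it is the coefficient of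
`t ^ (k' - k)`. -/
def loopBand (f : Loop ℓ) : BandMatrix :=
  ⟨fun p q => Loop.coeffs ℓ f (((site ℓ).symm q).1 - ((site ℓ).symm p).1)
      ((site ℓ).symm p).2 ((site ℓ).symm q).2, by
    obtain ⟨a, ha⟩ := (Loop.coeffs ℓ f).support.bddAbove
    obtain ⟨b, hb⟩ := (Loop.coeffs ℓ f).support.bddBelow
    refine ⟨(a.natAbs + b.natAbs + 1) * ℓ, fun p q h => ?_⟩
    obtain ⟨k, i, rfl⟩ := exists_eq_site (ℓ := ℓ) p
    obtain ⟨k', i', rfl⟩ := exists_eq_site (ℓ := ℓ) q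
    have hk := lt_abs_sub_of_lt_abs_site_sub h
    simp only [Equiv.symm_apply_apply]
    by_cases hs : k' - k ∈ (Loop.coeffs ℓ f).support
    · have h1 := ha hs
      have h2 := hb hs
      rw [lt_abs] at hk
      omega
    · rw [Finsupp.notMem_support_iff.mp hs]
      rfl⟩

theorem loopBand_site (f : Loop ℓ) (k k' : ℤ) (i i' : Fin ℓ) :
    (loopBand f).1 (site ℓ (k, i)) (site ℓ (k', i')) = Loop.coeffs ℓ f (k' - k) i i' := by
  simp only [loopBand, Equiv.symm_apply_apply]

theorem BandMatrix.ext_site {a b : BandMatrix} (h : ∀ (k k' : ℤ) (i i' : Fin ℓ),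
    a.1 (site ℓ (k, i)) (site ℓ (k', i')) = b.1 (site ℓ (k, i)) (site ℓ (k', i'))) : a = b := by
  ext p q
  obtain ⟨k, i, rfl⟩ := exists_eq_site (ℓ := ℓ) p
  obtain ⟨k', i', rfl⟩ := exists_eq_site (ℓ := ℓ) q
  exact h k k' i i'

theorem loopBand_mono_site (X : GLie ℓ) (n k k' : ℤ) (i i' : Fin ℓ) :
    (loopBand (Loop.mono X n)).1 (site ℓ (k, i)) (site ℓ (k', i')) =
      if k' = k + n then X i i' else 0 := by
  rw [loopBand_site, Loop.coeffs_mono]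
  split_ifs with h
  · rw [h, add_sub_cancel_left, Finsupp.single_eq_same]
  · rw [Finsupp.single_eq_of_ne (by omega)]
    rfl

theorem loopBand_add (f g : Loop ℓ) : loopBand (f + g) = loopBand f + loopBand g :=
  BandMatrix.ext_site (ℓ := ℓ) fun k k' i i' => by
    rw [loopBand_site, map_add]
    exact congrArg₂ (· + ·) (loopBand_site f k k' i i').symm (loopBand_site g k k' i i').symm

theorem loopBand_smul (r : ℂ) (f : Loop ℓ) : loopBand (r • f) = r • loopBand f :=
  BandMatrix.ext_site (ℓ := ℓ) fun k k' i i' => by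
    rw [loopBand_site, map_smul]
    exact congrArg (r * ·) (loopBand_site f k k' i i').symm

/-- `loopBand` as a linear map. -/
def loopBandHom (ℓ : ℕ) [NeZero ℓ] : Loop ℓ →ₗ[ℂ] BandMatrix where
  toFun := loopBand
  map_add' := loopBand_add
  map_smul' := loopBand_smul

/-- Multiplication of loops becomes multiplication of band matrices. -/
theorem loopBandHom_mono_mul_mono (X Y : GLie ℓ) (n m : ℤ) :
    loopBandHom ℓ (Loop.mono X n) * loopBandHom ℓ (Loop.mono Y m) =
      loopBandHom ℓ (Loop.mono (X * Y) (n + m)) := by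
  refine BandMatrix.ext_site (ℓ := ℓ) fun k k' i i' => ?_
  have hinj : Function.Injective fun s : Fin ℓ => site ℓ (k + n, s) := fun s s' h =>
    congrArg Prod.snd ((site ℓ).injective h)
  rw [BandMatrix.mul_apply, finsum_eq_finsum_comp hinj, finsum_eq_sum_of_fintype]
  · simp only [loopBandHom, LinearMap.coe_mk, AddHom.coe_mk, loopBand_mono_site, if_true]
    rw [Matrix.mul_apply, add_assoc]
    split_ifs
    · rfl
    · simp
  · intro p hp
    obtain ⟨r, s, rfl⟩ := exists_eq_site (ℓ := ℓ) p
    refine ⟨s, ?_⟩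
    by_cases hr : r = k + n
    · rw [hr]
    · refine absurd ?_ hp
      change (loopBand _).1 _ _ * _ = 0
      rw [loopBand_mono_site, if_neg hr, zero_mul]

theorem loopBandHom_lie (f g : Loop ℓ) :
    loopBandHom ℓ ⁅f, g⁆ = ⁅loopBandHom ℓ f, loopBandHom ℓ g⁆ := by
  induction f using Loop.induction with
  | h0 => simp
  | ha x y hx hy => simp only [add_lie, map_add, hx, hy]
  | hm X n =>
    induction g using Loop.induction with
    | h0 => simp
    | ha x y hx hy => simp only [lie_add, map_add, hx, hy]
    | hm Y m =>
      rw [Ring.lie_def, loopBandHom_mono_mul_mono, loopBandHom_mono_mul_mono, Loop.lie_mono,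
        add_comm m n, eq_sub_iff_add_eq, ← map_add, ← Loop.mono_add, sub_add_cancel]

theorem BandMatrix.cocycle_add_right (a b c : BandMatrix) :
    BandMatrix.cocycle a (b + c) = BandMatrix.cocycle a b + BandMatrix.cocycle a c := by
  rw [BandMatrix.cocycle_skew, BandMatrix.cocycle_add_left, BandMatrix.cocycle_skew b,
    BandMatrix.cocycle_skew c]
  ring

theorem BandMatrix.cocycle_zero_right (a : BandMatrix) : BandMatrix.cocycle a 0 = 0 := by
  simp [BandMatrix.cocycle]

theorem BandMatrix.cocycle_zero_left (a : BandMatrix) : BandMatrix.cocycle 0 a = 0 := by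
  simp [BandMatrix.cocycle]

/-- The cocycle of `a_∞` restricts to the cocycle of the affine Lie algebra. The pairing of
`X_{i,j} ⊗ t ^ n` with `Y ⊗ t ^ (-n)` receives the entry `Y_{j,i}` once for every block that crosses
the origin under translation by `n` blocks, counted with sign. -/
theorem cocycle_loopBandHom (f g : Loop ℓ) :
    BandMatrix.cocycle (loopBandHom ℓ f) (loopBandHom ℓ g) = Loop.cocycle f g := by
  induction f using Loop.induction_single with
  | h0 => rw [map_zero, BandMatrix.cocycle_zero_left]; simp
  | ha x y hx hy =>
    rw [map_add, BandMatrix.cocycle_add_left, hx, hy, map_add, LinearMap.add_apply]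
  | hs i j r n =>
    induction g using Loop.induction with
    | h0 => rw [map_zero, BandMatrix.cocycle_zero_right, map_zero]
    | ha x y hx hy => rw [map_add, BandMatrix.cocycle_add_right, hx, hy, map_add]
    | hm Y m =>
      have hinj : Function.Injective fun k : ℤ => (site ℓ (k, i), site ℓ (k + n, j)) :=
        fun k k' h => congrArg Prod.fst ((site ℓ).injective (congrArg Prod.fst h))
      -- a block crosses the origin exactly when its number, shifted by one, does
      have hsign : ∀ k : ℤ, BandMatrix.cocycleSign (site ℓ (k, i)) (site ℓ (k + n, j)) =
          BandMatrix.cocycleSign (k + 1) (k + 1 + n) := fun k => by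
        simp only [BandMatrix.cocycleSign_eq, site_pos_iff]
        congr 2 <;> simp only [eq_iff_iff] <;> omega
      have hcount : ∑ᶠ k : ℤ, BandMatrix.cocycleSign (k + 1) (k + 1 + n) = n := by
        rw [← finsum_cocycleSign_add n]
        exact finsum_comp_equiv (Equiv.addRight 1)
          (f := fun k => BandMatrix.cocycleSign k (k + n))
      rw [BandMatrix.cocycle, finsum_eq_finsum_comp hinj, Loop.cocycle_mono]
      · simp only [loopBandHom, LinearMap.coe_mk, AddHom.coe_mk, loopBand_mono_site, if_true,
          Matrix.single_apply_same, hsign]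
        have htr : (Matrix.single i j r * Y).trace = r * Y j i := by
          simp [Matrix.trace_single_mul]
        split_ifs with h
        · rw [htr, ← hcount, ← smul_eq_mul (a := finsum _), finsum_smul]
          refine finsum_congr fun k => ?_
          rw [if_pos (by omega), smul_eq_mul]
        · refine (finsum_congr fun k => ?_).trans finsum_zero
          rw [if_neg (by omega), mul_zero, mul_zero]
      · rintro ⟨p, q⟩ h
        obtain ⟨k, a, rfl⟩ := exists_eq_site (ℓ := ℓ) p
        obtain ⟨k', b, rfl⟩ := exists_eq_site (ℓ := ℓ) q
        have h' : (loopBand (Loop.mono (Matrix.single i j r) n)).1 (site ℓ (k, a))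
            (site ℓ (k', b)) ≠ 0 := left_ne_zero_of_mul (right_ne_zero_of_mul h)
        rw [loopBand_mono_site, ite_ne_right_iff, Matrix.single_apply, ite_ne_right_iff] at h'
        obtain ⟨rfl, ⟨rfl, rfl⟩, -⟩ := h'
        exact ⟨k, rfl⟩

theorem loopBandHom_injective : Function.Injective (loopBandHom ℓ) := by
  rw [injective_iff_map_eq_zero]
  intro f hf
  refine (Loop.coeffs ℓ).map_eq_zero_iff.mp (Finsupp.ext fun n => Matrix.ext fun i j => ?_)
  have h := loopBand_site f 0 n i j
  rw [sub_zero] at h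
  rw [← h, show loopBand f = 0 from hf]
  rfl

/-- The embedding of the affine Lie algebra without derivation into `a_∞`. -/
def affineEmbedding (ℓ : ℕ) [NeZero ℓ] : AffineGL.glPrime ℓ →ₗ⁅ℂ⁆ AInf where
  toFun x := ⟨loopBandHom ℓ x.1.loop, x.1.central⟩
  map_add' x y := AInf.ext (map_add (loopBandHom ℓ) x.1.loop y.1.loop) rfl
  map_smul' r x := AInf.ext (map_smul (loopBandHom ℓ) r x.1.loop) rfl
  map_lie' {x y} := by
    refine AInf.ext ?_ ?_
    · have hx : x.1.deriv = 0 := x.2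
      have hy : y.1.deriv = 0 := y.2
      change loopBandHom ℓ (_ + x.1.deriv • _ - y.1.deriv • _) = _
      rw [hx, hy, zero_smul, zero_smul, add_zero, sub_zero, loopBandHom_lie]
      rfl
    · exact (cocycle_loopBandHom x.1.loop y.1.loop).symm

theorem affineEmbedding_injective : Function.Injective (affineEmbedding ℓ) := fun x y h =>
  Subtype.ext (AffineGL.ext (loopBandHom_injective (congrArg AInf.mat h))
    (congrArg AInf.central h)
    ((show x.1.deriv = 0 from x.2).trans (show y.1.deriv = 0 from y.2).symm))

theorem affineEmbedding_c :
    affineEmbedding ℓ ⟨AffineGL.c, AffineGL.c_mem_glPrime⟩ = AInf.c :=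
  AInf.ext (map_zero (loopBandHom ℓ)) rfl

theorem blockSum_site (i j : Fin ℓ) (m k k' : ℤ) (a b : Fin ℓ) :
    (AInf.blockSum i j m).mat.1 (site ℓ (k, a)) (site ℓ (k', b)) =
      if k' = k + m then Matrix.single i j 1 a b else 0 := by
  have h : (∃ r : ℤ, site ℓ (k, a) = (i : ℤ) + 1 + r * ℓ ∧
      site ℓ (k', b) = (j : ℤ) + 1 + r * ℓ + m * ℓ) ↔ (k' = k + m ∧ i = a ∧ j = b) := by
    have e : ∀ r : ℤ, site ℓ (r, j) + m * ℓ = site ℓ (r + m, j) := fun r => by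
      rw [site_apply, site_apply]
      ring
    simp only [← site_apply, e, (site ℓ).injective.eq_iff, Prod.mk.injEq]
    constructor
    · rintro ⟨r, ⟨rfl, rfl⟩, rfl, rfl⟩
      exact ⟨rfl, rfl, rfl⟩
    · rintro ⟨rfl, rfl, rfl⟩
      exact ⟨k, ⟨rfl, rfl⟩, rfl, rfl⟩
  simp only [AInf.blockSum, h, Matrix.single_apply, ite_and]

theorem affineEmbedding_mono_unit (i j : Fin ℓ) (m : ℤ) :
    affineEmbedding ℓ ⟨AffineGL.mono (AffineGL.unit i j) m, AffineGL.mono_mem_glPrime _ m⟩ =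
      AInf.blockSum i j m :=
  AInf.ext (BandMatrix.ext_site (ℓ := ℓ) fun k k' a b =>
    (loopBand_mono_site _ m k k' a b).trans (blockSum_site i j m k k' a b).symm) rfl

end Embedding

/-! ### Trace-free loops and the principal Heisenberg elements -/

section Span

variable {ℓ : ℕ}

/-- `X ↦ X ⊗ t ^ n` as a linear map. -/
def Loop.monoHom (ℓ : ℕ) (n : ℤ) : GLie ℓ →ₗ[ℂ] Loop ℓ where
  toFun X := Loop.mono X n
  map_add' X Y := Loop.mono_add X Y n
  map_smul' r X := TensorProduct.tmul_smul r (AddMonoidAlgebra.single n (1 : ℂ)) X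

theorem Loop.eq_sum_mono (f : Loop ℓ) :
    f = ∑ n ∈ (Loop.coeffs ℓ f).support, Loop.mono (Loop.coeffs ℓ f n) n := by
  refine (Loop.coeffs ℓ).injective ?_
  rw [map_sum]
  simp only [Loop.coeffs_mono]
  exact (Finsupp.sum_single _).symm

/-- The trace of a loop, an element of `ℂ[t, t⁻¹] ⊗ ℂ`, is computed coefficientwise. -/
theorem Loop.trace_coeffs (f : Loop ℓ) (n : ℤ) : (Loop.coeffs ℓ f n).trace =
    TensorProduct.equivFinsuppOfBasisLeft (AddMonoidAlgebra.basis ℤ ℂ)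
      (AffineGL.loopTrace ℓ f) n := by
  induction f using Loop.induction with
  | h0 => simp
  | ha x y hx hy => simp only [map_add, Finsupp.add_apply, Matrix.trace_add, hx, hy]
  | hm X m =>
    rw [AffineGL.loopTrace_mono, TensorProduct.equivFinsuppOfBasisLeft_apply_tmul_apply,
      ← AddMonoidAlgebra.basis_apply, Module.Basis.repr_self, Loop.coeffs_mono]
    by_cases hn : n = m
    · subst hn; simp
    · rw [Finsupp.single_eq_of_ne hn, Finsupp.single_eq_of_ne hn, Matrix.trace_zero, zero_smul]

theorem AffineGL.trace_coeffs_of_mem_slPrime {x : AffineGL ℓ} (hx : x ∈ AffineGL.slPrime ℓ)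
    (n : ℤ) :
    (Loop.coeffs ℓ x.loop n).trace = 0 := by
  rw [Loop.trace_coeffs, show AffineGL.loopTrace ℓ x.loop = 0 from hx.2, map_zero]
  rfl

/-- The loop part of an element of the affine Lie algebra, as a linear map. -/
def AffineGL.loopHom (ℓ : ℕ) : AffineGL ℓ →ₗ[ℂ] Loop ℓ where
  toFun := AffineGL.loop
  map_add' _ _ := rfl
  map_smul' _ _ := rfl

/-- The remaining two coordinates of an element of the affine Lie algebra, as a linear map. -/
def AffineGL.centralDerivHom (ℓ : ℕ) : AffineGL ℓ →ₗ[ℂ] ℂ × ℂ where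
  toFun x := (x.central, x.deriv)
  map_add' _ _ := rfl
  map_smul' _ _ := rfl

theorem AffineGL.centralDerivHom_mono (X : GLie ℓ) (n : ℤ) :
    AffineGL.centralDerivHom ℓ (AffineGL.mono X n) = 0 := rfl

theorem centralDerivHom_heisenberg (k : ℤ) :
    AffineGL.centralDerivHom ℓ (AffineGL.heisenberg ℓ k) = 0 := by
  rw [AffineGL.heisenberg, map_sum]
  refine Finset.sum_eq_zero fun a _ => ?_
  rw [map_sum]
  refine Finset.sum_eq_zero fun b _ => ?_
  split_ifs
  · exact AffineGL.centralDerivHom_mono _ _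
  · exact AffineGL.centralDerivHom_mono _ _
  · exact map_zero _

/-- The affine Lie algebra of `sl_ℓ` is spanned by `c` and the `X ⊗ t ^ n` with `X` of trace
zero. -/
theorem AffineGL.slPrime_eq_sum (y : AffineGL.slPrime ℓ) :
    y = (∑ n ∈ (Loop.coeffs ℓ y.1.loop).support,
      (⟨AffineGL.mono (Loop.coeffs ℓ y.1.loop n) n, AffineGL.mono_mem_slPrime
        (AffineGL.trace_coeffs_of_mem_slPrime y.2 n) n⟩ : AffineGL.slPrime ℓ)) +
      y.1.central • ⟨AffineGL.c, AffineGL.c_mem_slPrime⟩ := by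
  refine Subtype.ext ?_
  let ι : AffineGL.slPrime ℓ →ₗ[ℂ] AffineGL ℓ :=
    { toFun := Subtype.val, map_add' := fun _ _ => rfl, map_smul' := fun _ _ => rfl }
  have hι : ∀ z, z.1 = ι z := fun _ => rfl
  rw [hι (_ + _), map_add, map_sum, map_smul]
  simp only [← hι]
  set s := ∑ n ∈ (Loop.coeffs ℓ y.1.loop).support,
    AffineGL.mono (Loop.coeffs ℓ y.1.loop n) n with hs
  have h1 : s.loop = y.1.loop := by
    change AffineGL.loopHom ℓ s = _
    rw [hs, map_sum]
    exact (Loop.eq_sum_mono y.1.loop).symm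
  have h2 : AffineGL.centralDerivHom ℓ s = 0 := by
    rw [hs, map_sum]
    exact Finset.sum_eq_zero fun n _ => AffineGL.centralDerivHom_mono _ n
  have hd : y.1.deriv = 0 := y.2.1
  refine AffineGL.ext ?_ ?_ ?_
  · change y.1.loop = s.loop + y.1.central • 0
    rw [h1, smul_zero, add_zero]
  · change y.1.central = s.central + y.1.central * 1
    rw [show s.central = 0 from congrArg Prod.fst h2, zero_add, mul_one]
  · change y.1.deriv = s.deriv + y.1.central * 0
    rw [show s.deriv = 0 from congrArg Prod.snd h2, hd, mul_zero, add_zero]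

end Span

section Restriction

variable {ℓ : ℕ} [NeZero ℓ]

/-- `loopBandHom` as a linear map to `a_∞`. -/
def loopToAInf (ℓ : ℕ) [NeZero ℓ] : Loop ℓ →ₗ[ℂ] AInf where
  toFun f := ⟨loopBandHom ℓ f, 0⟩
  map_add' f g := AInf.ext (map_add _ f g) (add_zero 0).symm
  map_smul' r f := AInf.ext (map_smul _ r f) (mul_zero r).symm

theorem sum_smul_blockSum (X : GLie ℓ) (m : ℤ) :
    ∑ i : Fin ℓ, ∑ j : Fin ℓ, X i j • AInf.blockSum i j m = loopToAInf ℓ (Loop.mono X m) := by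
  have h : ∀ i j : Fin ℓ, AInf.blockSum i j m =
      (loopToAInf ℓ ∘ₗ Loop.monoHom ℓ m) (AffineGL.unit i j) := fun i j =>
    (affineEmbedding_mono_unit i j m).symm
  simp only [h, ← map_smul, ← map_sum]
  change loopToAInf ℓ (Loop.mono _ m) = _
  congr 2
  conv_rhs => rw [Matrix.matrix_eq_sum_single X]
  simp

/-- A linear map given by the block sums on trace-free matrices is the restriction of the embedding
of the affine Lie algebra of `gl_ℓ`, because these matrices and `c` span. -/
theorem eq_of_agrees_on_sl (θ : AffineGL.slPrime ℓ →ₗ[ℂ] AInf)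
    (hc : θ ⟨AffineGL.c, AffineGL.c_mem_slPrime⟩ = AInf.c)
    (hθ : ∀ (X : GLie ℓ) (hX : X.trace = 0) (m : ℤ),
      θ ⟨AffineGL.mono X m, AffineGL.mono_mem_slPrime hX m⟩ =
        ∑ i : Fin ℓ, ∑ j : Fin ℓ, X i j • AInf.blockSum i j m) (y : AffineGL.slPrime ℓ) :
    θ y = ⟨loopBandHom ℓ y.1.loop, y.1.central⟩ := by
  conv_lhs => rw [AffineGL.slPrime_eq_sum y]
  rw [map_add, map_sum, map_smul, hc]
  rw [Finset.sum_congr rfl fun n _ =>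
    (hθ _ (AffineGL.trace_coeffs_of_mem_slPrime y.2 n) n).trans (sum_smul_blockSum _ n),
    ← map_sum, ← Loop.eq_sum_mono]
  refine AInf.ext ?_ ?_
  · change loopBandHom ℓ y.1.loop + y.1.central • 0 = _
    rw [smul_zero, add_zero]
  · change 0 + y.1.central * 1 = _
    rw [zero_add, mul_one]

/-- In terms of blocks, translation by `k = q ℓ + j` shifts the position within a block by `j`,
with a carry into the next block. -/
theorem site_eq_site_add_iff (k r r' : ℤ) (a b : Fin ℓ) :
    site ℓ (r', b) = site ℓ (r, a) + k ↔
      ((b : ℤ) = a + k % ℓ ∧ r' = r + k / ℓ) ∨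
        ((b : ℤ) = a + k % ℓ - ℓ ∧ r' = r + (k / ℓ + 1)) := by
  rw [site_apply, site_apply]
  have hℓ : (0 : ℤ) < ℓ := by exact_mod_cast NeZero.pos ℓ
  have h0 := Int.emod_nonneg k hℓ.ne'
  have h1 := Int.emod_lt_of_pos k hℓ
  have h2 := Int.mul_ediv_add_emod k ℓ
  have ha : ((a : ℕ) : ℤ) < ℓ := by exact_mod_cast a.2
  have hb : ((b : ℕ) : ℤ) < ℓ := by exact_mod_cast b.2
  have ha' : (0 : ℤ) ≤ ((a : ℕ) : ℤ) := Int.natCast_nonneg _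
  have hb' : (0 : ℤ) ≤ ((b : ℕ) : ℤ) := Int.natCast_nonneg _
  generalize ((a : ℕ) : ℤ) = x at *
  generalize ((b : ℕ) : ℤ) = y at *
  generalize k % (ℓ : ℤ) = j at *
  generalize k / (ℓ : ℤ) = q at *
  subst h2
  obtain ⟨D, rfl⟩ : ∃ D, r' = r + q + D := ⟨r' - r - q, by ring⟩
  have e : y + 1 + (r + q + D) * ℓ = x + 1 + r * ℓ + (ℓ * q + j) ↔ y + D * ℓ = x + j := by
    constructor <;> intro h <;> linarith
  rw [e]
  constructor
  · intro h
    -- `D` is the carry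
    have hD : D = 0 ∨ D = 1 := by
      have : -1 < D := by by_contra h'; nlinarith
      have : D < 2 := by by_contra h'; nlinarith
      omega
    rcases hD with rfl | rfl
    · left; constructor <;> linarith
    · right; constructor <;> linarith
  · rintro (⟨h, h'⟩ | ⟨h, h'⟩)
    · obtain rfl : D = 0 := by linarith
      linarith
    · obtain rfl : D = 1 := by linarith
      linarith

/-- The principal Heisenberg element of degree `k` acts as translation of all positions by `k`. -/
theorem loopBandHom_heisenberg (k : ℤ) :
    loopBandHom ℓ (AffineGL.heisenberg ℓ k).loop = shiftBand k := by
  refine BandMatrix.ext_site (ℓ := ℓ) fun r r' a b => ?_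
  let φ : AffineGL ℓ →+ ℂ :=
    { toFun := fun x => (loopBandHom ℓ x.loop).1 (site ℓ (r, a)) (site ℓ (r', b))
      map_zero' := by rw [AffineGL.loop_zero, map_zero]; rfl
      map_add' := fun x y => by rw [AffineGL.loop_add, map_add]; rfl }
  have hmono : ∀ (i j : Fin ℓ) (n : ℤ), φ (AffineGL.mono (AffineGL.unit i j) n) =
      if r' = r + n then Matrix.single i j 1 a b else 0 := fun i j n =>
    loopBand_mono_site _ n r r' a b
  change φ (AffineGL.heisenberg ℓ k) = _
  rw [shiftBand_apply, AffineGL.heisenberg, map_sum, Finset.sum_eq_single a, map_sum,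
    Finset.sum_eq_single b]
  · simp only [site_eq_site_add_iff]
    have hℓ : (0 : ℤ) < ℓ := by exact_mod_cast NeZero.pos ℓ
    split_ifs <;> simp only [hmono, map_zero, Matrix.single_apply_same] <;>
      first | omega | (split_ifs <;> first | rfl | omega)
  · intro j _ hj
    split_ifs <;> simp [hmono, hj]
  · simp
  · intro i _ hi
    rw [map_sum]
    refine Finset.sum_eq_zero fun j _ => ?_
    split_ifs <;> simp [hmono, hi]
  · simp

end Restriction

/-! ### Weights of Maya diagrams -/

open Classical in
/-- The sum of `f` over the black beads of `M`, normalised by subtracting the sum over the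
nonpositive positions: only finitely many terms are nonzero. -/
def Maya.weight (f : ℤ → ℤ) (M : Maya) : ℤ :=
  ∑ᶠ p : ℤ, f p * ((if p ∈ M.black then 1 else 0) - (if p ≤ 0 then 1 else 0))

theorem Maya.weight_insert (f : ℤ → ℤ) {M : Maya} {p : ℤ} (hp : p ∉ M.black) :
    (M.insert p).weight f = M.weight f + f p := by
  classical
  have h1 : ∑ᶠ q : ℤ, (if q = p then f p else 0) = f p := by
    rw [finsum_eq_single _ p fun q hq => if_neg hq, if_pos rfl]
  rw [← h1, weight, weight, ← finsum_add_distrib]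
  · refine finsum_congr fun q => ?_
    by_cases hq : q = p
    · subst hq
      simp only [Maya.mem_insert, hp, or_true, if_true, if_false]
      ring
    · simp [hq]
  · obtain ⟨L, hL1, hL2⟩ := M.exists_window
    refine (Set.finite_Icc (-(L : ℤ)) L).subset fun q hq => ?_
    by_contra h
    refine hq ?_
    rw [Set.mem_Icc] at h
    dsimp only
    by_cases hb : q ∈ M.black
    · have := hL1 q hb
      rw [if_pos hb, if_pos (by omega), sub_self, mul_zero]
    · have := hL2 q hb
      rw [if_neg hb, if_neg (by omega), sub_self, mul_zero]
  · refine (Set.finite_singleton p).subset fun q hq => ?_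
    by_contra h
    exact hq (if_neg h)

theorem Maya.weight_erase (f : ℤ → ℤ) {M : Maya} {p : ℤ} (hp : p ∈ M.black) :
    (M.erase p).weight f = M.weight f - f p := by
  have h := Maya.weight_insert f (M := M.erase p) (p := p) (by simp)
  rw [Maya.insert_erase hp] at h
  omega

/-- The weight of a diagram with the finitely many black beads `s` above a filled half-line. -/
theorem Maya.weight_eq_of_black_eq (f : ℤ → ℤ) (c : ℤ) (s : Finset ℤ) (hs : ∀ p ∈ s, c < p)
    (M : Maya) (hM : ∀ p, p ∈ M.black ↔ p ≤ c ∨ p ∈ s) :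
    M.weight f = (Maya.vacuum c).weight f + ∑ p ∈ s, f p := by
  induction s using Finset.induction_on generalizing M with
  | empty =>
    have : M = Maya.vacuum c := Maya.ext (Set.ext fun p => by simp [hM])
    rw [this, Finset.sum_empty, add_zero]
  | insert a s ha ih =>
    have hac := hs a (Finset.mem_insert_self a s)
    have h := ih (fun p hp => hs p (Finset.mem_insert_of_mem hp)) (M.erase a) fun p => by
      rw [Maya.mem_erase, hM, Finset.mem_insert]
      constructor
      · tauto
      · rintro (h | h)
        · exact ⟨Or.inl h, by omega⟩
        · exact ⟨Or.inr (Or.inr h), fun h' => ha (h' ▸ h)⟩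
    rw [Maya.weight_erase f ((hM a).mpr (Or.inr (Finset.mem_insert_self a s)))] at h
    rw [Finset.sum_insert ha]
    omega

/-- The charge of a Maya diagram: the number of black beads at positive positions minus the number
of white beads at nonpositive positions. -/
def Maya.charge (M : Maya) : ℤ := M.weight fun _ => 1

/-- By the reflection `p ↦ 1 - p` the charge of a vacuum becomes a count of crossings. -/
theorem Maya.charge_vacuum (h : ℤ) : (Maya.vacuum h).charge = h := by
  rw [charge, weight]
  refine Eq.trans ?_ (finsum_crossing h)
  rw [← finsum_comp_equiv (Equiv.subLeft (1 : ℤ))]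
  refine finsum_congr fun p => ?_
  have e1 : 1 - p ≤ h ↔ 0 < p + h := by constructor <;> intro <;> omega
  have e2 : 1 - p ≤ 0 ↔ 0 < p := by constructor <;> intro <;> omega
  simp only [Equiv.subLeft_apply, Maya.mem_vacuum, e1, e2, one_mul]

/-! ### Charged partitions -/

theorem YoungDiagram.rowLen_eq_zero_of_colLen_le {lam : YoungDiagram} {r : ℕ}
    (hr : lam.colLen 0 ≤ r) : lam.rowLen r = 0 := by
  by_contra hne
  have hmem : (r, 0) ∈ lam := YoungDiagram.mem_iff_lt_rowLen.mpr (Nat.pos_of_ne_zero hne)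
  have := YoungDiagram.mem_iff_lt_colLen.mp hmem
  omega

/-- The bead of each row of a charged partition is obtained by raising a bead of the vacuum by the
length of the row. -/
theorem weight_ofPartition (f : ℤ → ℤ) (lam : YoungDiagram) (h : ℤ) :
    (Maya.ofPartition lam h).weight f = (Maya.vacuum h).weight f +
      ∑ r ∈ Finset.range (lam.colLen 0), (f ((lam.rowLen r : ℤ) - r + h) - f (h - r)) := by
  set R := lam.colLen 0 with hR
  have h1 := Maya.weight_eq_of_black_eq f (h - R)
    ((Finset.range R).image fun r : ℕ => (lam.rowLen r : ℤ) - r + h) (fun p hp => by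
      obtain ⟨r, hr, rfl⟩ := Finset.mem_image.mp hp
      rw [Finset.mem_range] at hr
      omega) (Maya.ofPartition lam h) fun p => by
        rw [Finset.mem_image]
        constructor
        · rintro ⟨r, rfl⟩
          by_cases hr : r < R
          · exact Or.inr ⟨r, Finset.mem_range.mpr hr, rfl⟩
          · rw [YoungDiagram.rowLen_eq_zero_of_colLen_le (by omega)]
            left; push_cast; omega
        · rintro (hp | ⟨r, -, rfl⟩)
          · refine ⟨(h - p).toNat, ?_⟩
            rw [YoungDiagram.rowLen_eq_zero_of_colLen_le (by omega)]
            push_cast; omega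
          · exact ⟨r, rfl⟩
  have h2 := Maya.weight_eq_of_black_eq f (h - R)
    ((Finset.range R).image fun r : ℕ => h - r) (fun p hp => by
      obtain ⟨r, hr, rfl⟩ := Finset.mem_image.mp hp
      rw [Finset.mem_range] at hr
      omega) (Maya.vacuum h) fun p => by
        rw [Finset.mem_image, Maya.mem_vacuum]
        constructor
        · intro hp
          by_cases hr : (h - p).toNat < R
          · exact Or.inr ⟨(h - p).toNat, Finset.mem_range.mpr hr, by omega⟩
          · left; omega
        · rintro (hp | ⟨r, -, rfl⟩) <;> omega
  rw [Finset.sum_image] at h1 h2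
  · rw [h1, h2, Finset.sum_sub_distrib]
    ring
  · intro r _ s _ hrs
    simp only at hrs
    omega
  · intro r _ s _ hrs
    simp only at hrs
    rcases lt_trichotomy r s with hlt | heq | hlt
    · have := lam.rowLen_anti r s hlt.le
      omega
    · exact heq
    · have := lam.rowLen_anti s r hlt.le
      omega

theorem charge_ofPartition (lam : YoungDiagram) (h : ℤ) :
    (Maya.ofPartition lam h).charge = h := by
  rw [Maya.charge, weight_ofPartition]
  simp only [sub_self, Finset.sum_const_zero, add_zero]
  exact Maya.charge_vacuum h

/-- The number of the block of length `ℓ` in which a position lies. -/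
def blockNumber (ℓ : ℕ) (p : ℤ) : ℤ := (p - 1) / ℓ

theorem blockNumber_add_one {ℓ : ℕ} (hℓ : 0 < ℓ) (p : ℤ) :
    blockNumber ℓ (p + 1) = blockNumber ℓ p + if (ℓ : ℤ) ∣ p then 1 else 0 := by
  have hℓ' : (0 : ℤ) < ℓ := by exact_mod_cast hℓ
  rw [blockNumber, blockNumber, add_sub_cancel_right]
  split_ifs with h
  · obtain ⟨q, rfl⟩ := h
    rw [Int.mul_ediv_cancel_left _ hℓ'.ne']
    have : ((ℓ : ℤ) * q - 1) / ℓ = q - 1 := by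
      rw [Int.ediv_eq_iff_of_pos hℓ']
      constructor <;> nlinarith
    omega
  · have h0 := Int.emod_nonneg p hℓ'.ne'
    have h1 := Int.emod_lt_of_pos p hℓ'
    have h2 := Int.mul_ediv_add_emod p ℓ
    have h3 : p % ℓ ≠ 0 := fun h' => h (Int.dvd_of_emod_eq_zero h')
    rw [add_zero, eq_comm, Int.ediv_eq_iff_of_pos hℓ']
    constructor
    · nlinarith [show (1 : ℤ) ≤ p % ℓ by omega]
    · nlinarith

/-- Moving a bead up from `c` to `c + n` increases its block number once for each multiple of `ℓ`
that it passes; these correspond to the boxes of colour `0` in a row. -/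
theorem card_filter_dvd {ℓ : ℕ} (hℓ : 0 < ℓ) (c : ℤ) (n : ℕ) :
    (((Finset.range n).filter fun s : ℕ => (ℓ : ℤ) ∣ c + s).card : ℤ) =
      blockNumber ℓ (c + n) - blockNumber ℓ c := by
  induction n with
  | zero => simp
  | succ n ih =>
    rw [Finset.range_add_one, Finset.filter_insert]
    push_cast
    rw [← add_assoc, blockNumber_add_one hℓ]
    split_ifs with h
    · rw [Finset.card_insert_of_notMem (by simp)]
      push_cast
      rw [ih]; ring
    · rw [ih]; ring

theorem numZeroBoxes_eq_sum {ℓ : ℕ} (hℓ : 0 < ℓ) (lam : YoungDiagram) (h : ℤ) :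
    (numZeroBoxes ℓ lam h : ℤ) = ∑ r ∈ Finset.range (lam.colLen 0),
      (blockNumber ℓ ((lam.rowLen r : ℤ) - r + h) - blockNumber ℓ (h - r)) := by
  rw [numZeroBoxes, Finset.card_filter,
    Finset.sum_finset_product lam.cells (Finset.range (lam.colLen 0))
      (fun r => Finset.range (lam.rowLen r))]
  · push_cast
    refine Finset.sum_congr rfl fun r _ => ?_
    rw [show (lam.rowLen r : ℤ) - r + h = h - r + lam.rowLen r by ring, ← card_filter_dvd hℓ,
      Finset.card_filter]
    push_cast
    refine Finset.sum_congr rfl fun s _ => ?_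
    rw [show h + (s : ℤ) - r = h - r + s by ring]
  · rintro ⟨r, s⟩
    rw [YoungDiagram.mem_cells, Finset.mem_range, Finset.mem_range,
      ← YoungDiagram.mem_iff_lt_rowLen, ← YoungDiagram.mem_iff_lt_colLen]
    exact ⟨fun hm => ⟨lam.up_left_mem le_rfl (Nat.zero_le s) hm, hm⟩, fun hm => hm.2⟩

/-- The weight of a Maya diagram for the block numbers, relative to the vacuum of the same charge.
For a charged partition this is its number of boxes of colour `0`. -/
def Maya.level (ℓ : ℕ) (M : Maya) : ℤ :=
  M.weight (blockNumber ℓ) - (Maya.vacuum M.charge).weight (blockNumber ℓ)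

theorem level_ofPartition {ℓ : ℕ} (hℓ : 0 < ℓ) (lam : YoungDiagram) (h : ℤ) :
    (Maya.ofPartition lam h).level ℓ = numZeroBoxes ℓ lam h := by
  rw [Maya.level, charge_ofPartition, weight_ofPartition, numZeroBoxes_eq_sum hℓ]
  ring

/-- The Young diagram with row lengths `f`, cut off after `R` rows. -/
def YoungDiagram.ofRowFunction (f : ℕ → ℕ) (hf : Antitone f) (R : ℕ) : YoungDiagram where
  cells := (Finset.range R ×ˢ Finset.range (f 0)).filter fun x => x.2 < f x.1
  isLowerSet := by
    rintro ⟨r, s⟩ ⟨r', s'⟩ ⟨h1, h2⟩ h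
    simp only [Finset.coe_filter, Finset.mem_product, Finset.mem_range, Set.mem_ofPred_eq] at h ⊢
    dsimp only at h1 h2
    have := hf h1
    omega

theorem YoungDiagram.rowLen_ofRowFunction (f : ℕ → ℕ) (hf : Antitone f) (R : ℕ)
    (hR : ∀ r, R ≤ r → f r = 0) (r : ℕ) : (YoungDiagram.ofRowFunction f hf R).rowLen r = f r := by
  refine eq_of_forall_lt_iff fun s => ?_
  rw [← YoungDiagram.mem_iff_lt_rowLen, ← YoungDiagram.mem_cells]
  simp only [ofRowFunction, Finset.mem_filter, Finset.mem_product, Finset.mem_range]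
  refine ⟨fun h => h.2, fun h => ⟨⟨?_, ?_⟩, h⟩⟩
  · by_contra hr
    rw [hR r (by omega)] at h
    omega
  · exact h.trans_le (hf (Nat.zero_le r))

/-- Every Maya diagram comes from a charged partition: its black beads `p_0 > p_1 > ⋯` make
`p_r + r` weakly decreasing and eventually constant. -/
theorem exists_eq_ofPartition (M : Maya) : ∃ lam, M = Maya.ofPartition lam M.charge := by
  suffices h : ∃ lam h, M = Maya.ofPartition lam h by
    obtain ⟨lam, h, rfl⟩ := h
    exact ⟨lam, by rw [charge_ofPartition]⟩
  obtain ⟨L, hL1, hL2⟩ := M.exists_window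
  -- count positions downwards from `L`, so that `Nat.nth P` lists the black beads in order
  let P : ℕ → Prop := fun n => (L : ℤ) - n ∈ M.black
  have hP : ∀ n : ℕ, 2 * L < n → P n := fun n hn => by
    by_contra h
    have := hL2 _ h
    omega
  have hinf : (Set.ofPred P).Infinite := by
    refine Set.infinite_of_not_bddAbove fun ⟨b, hb⟩ => ?_
    have := hb (hP (b + 2 * L + 1) (by omega))
    omega
  have hmono := Nat.nth_strictMono hinf
  have hstep : ∀ r, Nat.nth P r + 1 ≤ Nat.nth P (r + 1) := fun r => hmono (Nat.lt_succ_self r)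
  set q : ℕ → ℤ := fun r => (L : ℤ) - Nat.nth P r + r with hq
  have hanti : Antitone q := antitone_nat_of_succ_le fun r => by
    have := hstep r
    simp only [hq]
    push_cast
    omega
  set R := 2 * L + 1 with hRdef
  -- after `R` beads, the list has reached the range where all positions are black
  have hconst : ∀ r, R ≤ r → q r = q R := fun r hr => by
    induction r, hr using Nat.le_induction with
    | base => rfl
    | succ r hr ih =>
      rw [← ih]
      have h1 := hmono.le_apply (x := r)
      have h2 : Nat.nth P (r + 1) = Nat.nth P r + 1 := by
        refine le_antisymm ?_ (hstep r)
        by_contra! h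
        obtain ⟨s, hs⟩ : ∃ s, Nat.nth P s = Nat.nth P r + 1 := by
          have : Nat.nth P r + 1 ∈ Set.range (Nat.nth P) := by
            rw [Nat.range_nth_of_infinite hinf]
            exact hP _ (by omega)
          exact this
        have h3 : r < s := hmono.lt_iff_lt.mp (by omega)
        have h4 : s < r + 1 := hmono.lt_iff_lt.mp (by omega)
        omega
      simp only [hq, h2]
      push_cast
      ring
  have hge : ∀ r, q R ≤ q r := fun r => by
    rcases le_total r R with h | h
    · exact hanti h
    · exact (hconst r h).ge
  have hrow : Antitone fun r => (q r - q R).toNat :=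
    fun r s h => Int.toNat_le_toNat (sub_le_sub_right (hanti h) _)
  refine ⟨YoungDiagram.ofRowFunction (fun r => (q r - q R).toNat) hrow R, q R, ?_⟩
  refine Maya.ext (Set.ext fun p => ?_)
  have hmem : p ∈ M.black ↔ ∃ r, p = (L : ℤ) - Nat.nth P r := by
    constructor
    · intro hp
      have hpL := hL1 p hp
      have : (L - p).toNat ∈ Set.range (Nat.nth P) := by
        rw [Nat.range_nth_of_infinite hinf]
        change (L : ℤ) - ((L - p).toNat : ℕ) ∈ M.black
        rwa [Int.toNat_of_nonneg (by omega), sub_sub_cancel]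
      obtain ⟨r, hr⟩ := this
      exact ⟨r, by omega⟩
    · rintro ⟨r, rfl⟩
      exact Nat.nth_mem_of_infinite hinf r
  rw [hmem]
  refine exists_congr fun r => ?_
  rw [YoungDiagram.rowLen_ofRowFunction _ hrow R fun s hs => by rw [hconst s hs]; simp]
  rw [Int.toNat_of_nonneg (sub_nonneg.mpr (hge r))]
  have : q r = (L : ℤ) - Nat.nth P r + r := rfl
  constructor <;> intro h <;> omega

/-! ### The charge sectors and the degree operator -/

/-- A charge sector is spanned by the Maya diagrams of that charge, since each of them comes from a
partition. -/
theorem mem_chargeSector_iff {h : ℤ} {v : Fock} :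
    v ∈ chargeSector h ↔ ∀ M, v M ≠ 0 → M.charge = h := by
  have hrange : (Set.range fun lam : YoungDiagram => ket lam h) =
      (fun M => Finsupp.single M (1 : ℂ)) '' {M : Maya | M.charge = h} := by
    ext v
    constructor
    · rintro ⟨lam, rfl⟩
      exact ⟨_, charge_ofPartition lam h, rfl⟩
    · rintro ⟨M, rfl, rfl⟩
      obtain ⟨lam, hlam⟩ := exists_eq_ofPartition M
      exact ⟨lam, congrArg (Finsupp.single · (1 : ℂ)) hlam.symm⟩
  rw [chargeSector, hrange, ← Finsupp.supported_eq_span_single, Finsupp.mem_supported']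
  exact forall_congr' fun M => not_imp_comm

theorem single_mem_chargeSector (M : Maya) : Finsupp.single M 1 ∈ chargeSector M.charge := by
  rw [mem_chargeSector_iff]
  intro M' h
  by_contra hne
  exact h (Finsupp.single_eq_of_ne fun h' => hne (by rw [h']))

/-- `Ē_{m,n}` moves a bead from `n` to `m`, which changes every weight accordingly. -/
theorem normalOrdered_single (m n : ℤ) (M : Maya) :
    normalOrdered m n (Finsupp.single M 1) = 0 ∨ ∃ M' a,
      normalOrdered m n (Finsupp.single M 1) = Finsupp.single M' a ∧
        ∀ f, M'.weight f = M.weight f + f m - f n := by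
  rcases le_or_gt n 0 with hn | hn
  · rw [normalOrdered_of_nonpos m hn, LinearMap.neg_apply, Module.End.mul_apply]
    by_cases hm : m ∈ M.black
    · left
      rw [psi_single_of_mem hm, map_zero, neg_zero]
    rw [psi_single_of_notMem hm]
    by_cases hn' : n ∈ (M.insert m).black
    · rw [psiStar_single_of_mem hn', ← Finsupp.single_neg]
      refine Or.inr ⟨_, _, rfl, fun f => ?_⟩
      rw [Maya.weight_erase f hn', Maya.weight_insert f hm]
    · left
      rw [psiStar_single_of_notMem hn', neg_zero]
  · rw [normalOrdered_of_pos m hn, Module.End.mul_apply]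
    by_cases hn' : n ∈ M.black
    · rw [psiStar_single_of_mem hn']
      by_cases hm : m ∈ (M.erase n).black
      · left
        rw [psi_single_of_mem hm]
      · rw [psi_single_of_notMem hm]
        refine Or.inr ⟨_, _, rfl, fun f => ?_⟩
        rw [Maya.weight_insert f hm, Maya.weight_erase f hn']
        ring
    · left
      rw [psiStar_single_of_notMem hn', map_zero]

theorem normalOrdered_mem_chargeSector {h : ℤ} {v : Fock} (hv : v ∈ chargeSector h) (m n : ℤ) :
    normalOrdered m n v ∈ chargeSector h := by
  have hle : chargeSector h ≤ (chargeSector h).comap (normalOrdered m n) := by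
    refine Submodule.span_le.mpr ?_
    rintro _ ⟨lam, rfl⟩
    change normalOrdered m n (Finsupp.single _ 1) ∈ chargeSector h
    rcases normalOrdered_single m n (Maya.ofPartition lam h) with h0 | ⟨M', a, h1, h2⟩
    · rw [h0]
      exact zero_mem _
    · have hc : M'.charge = h := by
        have h3 := h2 fun _ => 1
        have h4 := charge_ofPartition lam h
        rw [Maya.charge] at h4 ⊢
        omega
      rw [h1, ← mul_one a, ← smul_eq_mul, ← Finsupp.smul_single, ← hc]
      exact Submodule.smul_mem _ _ (single_mem_chargeSector M')
  exact hle hv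

theorem bandAct_mem_chargeSector (a : BandMatrix) {h : ℤ} {v : Fock} (hv : v ∈ chargeSector h) :
    bandAct a v ∈ chargeSector h := by
  obtain ⟨N, hN⟩ := (eventually_bandAct_eq a v).exists
  rw [hN, truncatedAct_apply]
  exact sum_mem fun m _ => sum_mem fun n _ =>
    Submodule.smul_mem _ _ (normalOrdered_mem_chargeSector hv m n)

/-- The operator by which `d` acts, which multiplies each Maya diagram by minus its level. -/
def levelOp (ℓ : ℕ) : Module.End ℂ Fock :=
  Finsupp.linearCombination ℂ fun M : Maya => Finsupp.single M (-(M.level ℓ : ℂ))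

theorem levelOp_single (ℓ : ℕ) (M : Maya) (a : ℂ) :
    levelOp ℓ (Finsupp.single M a) = (-(M.level ℓ : ℂ)) • Finsupp.single M a := by
  simp [levelOp, Finsupp.linearCombination_single, mul_comm]

theorem levelOp_mem_chargeSector (ℓ : ℕ) {h : ℤ} {v : Fock} (hv : v ∈ chargeSector h) :
    levelOp ℓ v ∈ chargeSector h := by
  have hle : chargeSector h ≤ (chargeSector h).comap (levelOp ℓ) := by
    refine Submodule.span_le.mpr ?_
    rintro _ ⟨lam, rfl⟩
    change levelOp ℓ (Finsupp.single _ 1) ∈ chargeSector h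
    rw [levelOp_single]
    exact Submodule.smul_mem _ _ (Submodule.subset_span ⟨lam, rfl⟩)
  exact hle hv

theorem levelOp_normalOrdered (ℓ : ℕ) (m n : ℤ) (v : Fock) :
    levelOp ℓ (normalOrdered m n v) = normalOrdered m n (levelOp ℓ v) +
      ((blockNumber ℓ n - blockNumber ℓ m : ℤ) : ℂ) • normalOrdered m n v := by
  suffices h : levelOp ℓ * normalOrdered m n = normalOrdered m n * levelOp ℓ +
      ((blockNumber ℓ n - blockNumber ℓ m : ℤ) : ℂ) • normalOrdered m n from
    LinearMap.congr_fun h v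
  refine Fock.end_ext fun M => ?_
  simp only [LinearMap.add_apply, Module.End.mul_apply, LinearMap.smul_apply, levelOp_single,
    map_smul]
  rcases normalOrdered_single m n M with h0 | ⟨M', a, h1, h2⟩
  · rw [h0, map_zero, smul_zero, smul_zero, add_zero]
  · have hc : M'.charge = M.charge := by
      rw [Maya.charge, h2]
      exact add_sub_cancel_right _ _
    rw [h1, levelOp_single, ← add_smul]
    congr 1
    rw [Maya.level, Maya.level, hc, h2]
    push_cast
    ring

theorem blockNumber_site (ℓ : ℕ) [NeZero ℓ] (k : ℤ) (i : Fin ℓ) :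
    blockNumber ℓ (site ℓ (k, i)) = k := by
  have hℓ : (0 : ℤ) < ℓ := by exact_mod_cast NeZero.pos ℓ
  have hi : ((i : ℕ) : ℤ) < ℓ := by exact_mod_cast i.2
  rw [blockNumber, site_apply, Int.ediv_eq_iff_of_pos hℓ]
  constructor
  · linarith [Int.natCast_nonneg (i : ℕ)]
  · linarith

/-- The commutator of the level operator with `∑ a_{m,n} Ē_{m,n}` multiplies each entry by the
difference of the block numbers. -/
theorem levelOp_lie_bandAct (ℓ : ℕ) {a b : BandMatrix}
    (h : ∀ m n, b.1 m n = a.1 m n * ((blockNumber ℓ n - blockNumber ℓ m : ℤ) : ℂ)) (v : Fock) :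
    levelOp ℓ (bandAct a v) - bandAct a (levelOp ℓ v) = bandAct b v := by
  obtain ⟨N, h1, h2, h3⟩ := ((eventually_bandAct_eq a v).and
    ((eventually_bandAct_eq a (levelOp ℓ v)).and (eventually_bandAct_eq b v))).exists
  rw [h1, h2, h3]
  simp only [truncatedAct_apply, map_sum, map_smul, ← Finset.sum_sub_distrib, ← smul_sub]
  refine Finset.sum_congr rfl fun m _ => Finset.sum_congr rfl fun n _ => ?_
  rw [levelOp_normalOrdered, add_sub_cancel_left, smul_smul, h]

/-- The level operator realises the derivation `t d/dt`. -/
theorem levelOp_lie_loop {ℓ : ℕ} [NeZero ℓ] (f : Loop ℓ) (v : Fock) :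
    levelOp ℓ (bandAct (loopBandHom ℓ f) v) - bandAct (loopBandHom ℓ f) (levelOp ℓ v) =
      bandAct (loopBandHom ℓ (Loop.degree f)) v := by
  refine levelOp_lie_bandAct ℓ (fun m n => ?_) v
  obtain ⟨k, i, rfl⟩ := exists_eq_site (ℓ := ℓ) m
  obtain ⟨k', i', rfl⟩ := exists_eq_site (ℓ := ℓ) n
  rw [blockNumber_site, blockNumber_site, mul_comm]
  refine (loopBand_site _ k k' i i').trans ?_
  rw [Loop.coeffs_degree]
  exact congrArg (_ * ·) (loopBand_site f k k' i i').symm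

/-- The representation of the affine Lie algebra on Fock space. -/
def affineAct (ℓ : ℕ) [NeZero ℓ] : AffineGL ℓ →ₗ⁅ℂ⁆ Module.End ℂ Fock where
  toFun x := aInfAct ⟨loopBandHom ℓ x.loop, x.central⟩ + x.deriv • levelOp ℓ
  map_add' x y := by
    have h : (⟨loopBandHom ℓ (x + y).loop, (x + y).central⟩ : AInf) =
        ⟨loopBandHom ℓ x.loop, x.central⟩ + ⟨loopBandHom ℓ y.loop, y.central⟩ :=
      AInf.ext (map_add (loopBandHom ℓ) _ _) rfl
    rw [h, map_add, AffineGL.deriv_add, add_smul]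
    abel
  map_smul' r x := by
    have h : (⟨loopBandHom ℓ (r • x).loop, (r • x).central⟩ : AInf) =
        r • ⟨loopBandHom ℓ x.loop, x.central⟩ :=
      AInf.ext (map_smul (loopBandHom ℓ) _ _) rfl
    rw [h, map_smul, AffineGL.deriv_smul, mul_smul, smul_add, RingHom.id_apply]
  map_lie' {x y} := by
    refine LinearMap.ext fun v => ?_
    have hxy := bandAct_lie (loopBandHom ℓ x.loop) (loopBandHom ℓ y.loop) v
    have hx := levelOp_lie_loop x.loop v
    have hy := levelOp_lie_loop y.loop v
    rw [cocycle_loopBandHom, ← loopBandHom_lie] at hxy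
    simp only [Ring.lie_def, AffineGL.loop_lie, AffineGL.central_lie, AffineGL.deriv_lie,
      zero_smul, add_zero, LinearMap.sub_apply, LinearMap.add_apply, LinearMap.smul_apply,
      Module.End.mul_apply, aInfAct_apply, map_add, map_sub, map_smul, smul_add, bandAct_add,
      sub_eq_add_neg (loopBandHom ℓ _ + _), ← neg_one_smul ℂ (_ • loopBandHom ℓ _),
      bandAct_smul]
    rw [← hx, ← hy, eq_sub_of_add_eq hxy.symm]
    module

theorem affineAct_glPrime (ℓ : ℕ) [NeZero ℓ] (x : AffineGL.glPrime ℓ) :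
    affineAct ℓ (x : AffineGL ℓ) = aInfAct (affineEmbedding ℓ x) := by
  have hx : x.1.deriv = 0 := x.2
  change aInfAct _ + x.1.deriv • levelOp ℓ = _
  rw [hx, zero_smul, add_zero]
  rfl

theorem affineAct_heisenberg (ℓ : ℕ) [NeZero ℓ] (k : ℤ) :
    affineAct ℓ (AffineGL.heisenberg ℓ k) = alphaOp k := by
  have h := centralDerivHom_heisenberg (ℓ := ℓ) k
  have h1 : (AffineGL.heisenberg ℓ k).central = 0 := congrArg Prod.fst h
  have h2 : (AffineGL.heisenberg ℓ k).deriv = 0 := congrArg Prod.snd h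
  change aInfAct ⟨loopBandHom ℓ (AffineGL.heisenberg ℓ k).loop, _⟩ + _ • levelOp ℓ = _
  rw [h1, h2, zero_smul, add_zero, loopBandHom_heisenberg, aInfAct_mk_zero]
  rfl

theorem affineAct_c (ℓ : ℕ) [NeZero ℓ] : affineAct ℓ AffineGL.c = 1 := by
  refine LinearMap.ext fun v => ?_
  change (1 : ℂ) • v + bandAct (loopBandHom ℓ 0) v + (0 : ℂ) • levelOp ℓ v = v
  rw [map_zero, bandAct_zero, one_smul, zero_smul, LinearMap.zero_apply, add_zero, add_zero]

theorem affineAct_d (ℓ : ℕ) [NeZero ℓ] (lam : YoungDiagram) (h : ℤ) :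
    affineAct ℓ AffineGL.d (ket lam h) = (-(numZeroBoxes ℓ lam h : ℂ)) • ket lam h := by
  change (0 : ℂ) • ket lam h + bandAct (loopBandHom ℓ 0) (ket lam h) +
    (1 : ℂ) • levelOp ℓ (ket lam h) = _
  rw [map_zero, bandAct_zero, one_smul, zero_smul, LinearMap.zero_apply, zero_add, zero_add, ket,
    levelOp_single, level_ofPartition (NeZero.pos ℓ), Int.cast_natCast]

theorem affineAct_isPreserved (ℓ : ℕ) [NeZero ℓ] (h : ℤ) :
    IsPreserved (affineAct ℓ) (chargeSector h) := fun _ _ hv =>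
  add_mem (add_mem (Submodule.smul_mem _ _ hv) (bandAct_mem_chargeSector _ hv))
    (Submodule.smul_mem _ _ (levelOp_mem_chargeSector ℓ hv))

/-! ### Singular vectors of the Heisenberg algebra -/

/-- The operators `e_k` determined from the `α_i`, `i > 0`, by Newton's identities
`k e_k = ∑_{i=1}^k (-1)^{i-1} e_{k-i} α_i`. -/
def elementaryOp : ℕ → Module.End ℂ Fock
  | 0 => 1
  | n + 1 => ((n + 1 : ℕ) : ℂ)⁻¹ •
      ∑ i : Fin (n + 1), (-1 : ℂ) ^ (i : ℕ) • (elementaryOp (n - i) * alphaOp ((i : ℕ) + 1 : ℤ))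
decreasing_by omega

theorem elementaryOp_zero : elementaryOp 0 = 1 := by rw [elementaryOp]

theorem smul_elementaryOp (n : ℕ) (v : Fock) :
    (n : ℂ) • elementaryOp n v = ∑ i ∈ Finset.range n,
      (-1 : ℂ) ^ i • elementaryOp (n - 1 - i) (alphaOp (i + 1) v) := by
  cases n with
  | zero => simp
  | succ n =>
    rw [elementaryOp, LinearMap.smul_apply, smul_smul,
      mul_inv_cancel₀ (Nat.cast_ne_zero.mpr n.succ_ne_zero), one_smul, LinearMap.sum_apply,
      Finset.sum_range fun i => (-1 : ℂ) ^ i • elementaryOp (n + 1 - 1 - i) (alphaOp (i + 1) v)]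
    rfl

theorem sum_alternating_telescope {A : Type*} [AddCommGroup A] [Module ℂ A] (g : ℕ → A) (n : ℕ) :
    ∑ i ∈ Finset.range n, (-1 : ℂ) ^ i • (g i + g (i + 1)) + (-1 : ℂ) ^ n • g n = g 0 := by
  induction n with
  | zero => simp
  | succ n ih =>
    rw [Finset.sum_range_succ, ← ih, pow_succ]
    module

/-- The operators `e_k` commute with wedging like the coefficients of `Λ(1 + t S)`, where `S` is
the shift `e_p ↦ e_{p-1}`. -/
theorem elementaryOp_succ_psi (n : ℕ) (p : ℤ) (v : Fock) :
    elementaryOp (n + 1) (psi p v) =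
      psi p (elementaryOp (n + 1) v) + psi (p - 1) (elementaryOp n v) := by
  induction n using Nat.strong_induction_on generalizing p v with
  | _ n ih =>
    have hn : ((n + 1 : ℕ) : ℂ) ≠ 0 := Nat.cast_ne_zero.mpr n.succ_ne_zero
    refine smul_right_injective Fock hn ?_
    dsimp only
    -- commuting `ψ_p` past `e_{n-i} α_{i+1}` produces, besides the terms of the claim, a sum of two
    -- neighbours; with the alternating signs these telescope
    have hterm : ∀ i ∈ Finset.range n,
        (-1 : ℂ) ^ i • elementaryOp (n - i) (alphaOp (i + 1) (psi p v)) =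
          psi p ((-1 : ℂ) ^ i • elementaryOp (n - i) (alphaOp (i + 1) v)) +
          psi (p - 1) ((-1 : ℂ) ^ i • elementaryOp (n - 1 - i) (alphaOp (i + 1) v)) +
          (-1 : ℂ) ^ i • (psi (p - 1 - i) (elementaryOp (n - i) v) +
            psi (p - 1 - (i + 1 : ℕ)) (elementaryOp (n - (i + 1)) v)) := fun i hi => by
      rw [Finset.mem_range] at hi
      obtain ⟨j, rfl⟩ : ∃ j, n = i + j + 1 := ⟨n - i - 1, by omega⟩
      rw [show i + j + 1 - i = j + 1 by omega, show i + j + 1 - 1 - i = j by omega,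
        show i + j + 1 - (i + 1) = j by omega, alphaOp_psi, map_add, ih j (by omega),
        ih j (by omega), show p - ((i : ℤ) + 1) = p - 1 - i by ring,
        show p - 1 - (i : ℤ) - 1 = p - 1 - (i + 1 : ℕ) by push_cast; ring]
      simp only [map_smul]
      module
    have hlast : (-1 : ℂ) ^ n • elementaryOp (n - n) (alphaOp (n + 1) (psi p v)) =
        psi p ((-1 : ℂ) ^ n • elementaryOp (n - n) (alphaOp (n + 1) v)) +
          (-1 : ℂ) ^ n • psi (p - 1 - n) (elementaryOp (n - n) v) := by
      rw [Nat.sub_self, elementaryOp_zero, alphaOp_psi, map_smul,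
        show p - ((n : ℤ) + 1) = p - 1 - n by ring]
      simp only [Module.End.one_apply, smul_add]
    have htel := sum_alternating_telescope
      (fun i : ℕ => psi (p - 1 - i) (elementaryOp (n - i) v)) n
    rw [smul_add, ← map_smul (psi p), smul_elementaryOp, smul_elementaryOp, Nat.add_sub_cancel,
      Finset.sum_range_succ, Finset.sum_congr rfl hterm, hlast, Finset.sum_add_distrib,
      Finset.sum_add_distrib, ← map_sum, ← map_sum, ← smul_elementaryOp, Finset.sum_range_succ,
      map_add, Nat.cast_add, Nat.cast_one, add_smul, one_smul, map_smul]
    simp only [Nat.cast_zero, sub_zero, Nat.sub_zero] at htel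
    rw [← htel]
    abel

theorem elementaryOp_eq_zero {v : Fock} (hv : ∀ k : ℤ, 0 < k → alphaOp k v = 0) {n : ℕ}
    (hn : 0 < n) : elementaryOp n v = 0 := by
  refine (smul_eq_zero.mp ((smul_elementaryOp n v).trans ?_)).resolve_left
    (Nat.cast_ne_zero.mpr hn.ne')
  exact Finset.sum_eq_zero fun i _ => by rw [hv _ (by omega), map_zero, smul_zero]

/-- The Maya diagram with all beads moved down by one position. -/
def Maya.shiftDown (M : Maya) : Maya where
  black := {p | p + 1 ∈ M.black}
  finite_black_pos := by
    obtain ⟨L, hL, -⟩ := M.exists_window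
    exact (Set.finite_Icc 0 (L : ℤ)).subset fun p hp => ⟨hp.1.le, by have := hL _ hp.2; omega⟩
  finite_white_neg := by
    obtain ⟨L, -, hL⟩ := M.exists_window
    exact (Set.finite_Icc (-(L : ℤ) - 1) 0).subset fun p hp =>
      ⟨by have := hL _ hp.2; omega, hp.1⟩

@[simp] theorem Maya.mem_shiftDown {M : Maya} {p : ℤ} :
    p ∈ M.shiftDown.black ↔ p + 1 ∈ M.black := Iff.rfl

theorem Maya.shiftDown_injective : Function.Injective Maya.shiftDown := fun M M' h => by
  refine Maya.ext (Set.ext fun p => ?_)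
  have := Set.ext_iff.mp (congrArg Maya.black h) (p - 1)
  simpa using this

theorem Maya.shiftDown_vacuum (c : ℤ) : (Maya.vacuum c).shiftDown = Maya.vacuum (c - 1) :=
  Maya.ext (Set.ext fun p => by simp only [mem_shiftDown, mem_vacuum]; omega)

theorem Maya.shiftDown_insert (M : Maya) (p : ℤ) :
    (M.insert p).shiftDown = M.shiftDown.insert (p - 1) :=
  Maya.ext (Set.ext fun _ => or_congr_right eq_sub_iff_add_eq.symm)

theorem Maya.sign_shiftDown (M : Maya) (p : ℤ) : M.shiftDown.sign (p - 1) = M.sign p := by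
  have h : {q : ℤ | p < q ∧ q ∈ M.black} =
      (· + 1) '' {q : ℤ | p - 1 < q ∧ q ∈ M.shiftDown.black} := by
    ext q
    constructor
    · intro hq
      exact ⟨q - 1, ⟨by have := hq.1; omega, by simpa using hq.2⟩, by ring⟩
    · rintro ⟨q, hq, rfl⟩
      exact ⟨by have := hq.1; dsimp only; omega, hq.2⟩
  rw [sign, sign, h, Set.ncard_image_of_injective _ (add_left_injective 1)]

/-- The translation operator on Fock space, which moves all beads down by one position. -/
def translation : Module.End ℂ Fock := Finsupp.lmapDomain ℂ ℂ Maya.shiftDown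

theorem translation_single (M : Maya) (a : ℂ) :
    translation (Finsupp.single M a) = Finsupp.single M.shiftDown a :=
  Finsupp.mapDomain_single

theorem translation_injective : Function.Injective translation :=
  Finsupp.mapDomain_injective Maya.shiftDown_injective

theorem translation_psi (p : ℤ) (v : Fock) :
    translation (psi p v) = psi (p - 1) (translation v) := by
  suffices h : translation * psi p = psi (p - 1) * translation from LinearMap.congr_fun h v
  refine Fock.end_ext fun M => ?_
  rw [Module.End.mul_apply, Module.End.mul_apply, translation_single]
  by_cases hp : p ∈ M.black
  · rw [psi_single_of_mem hp, psi_single_of_mem (by simpa using hp), map_zero]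
  · rw [psi_single_of_notMem hp, psi_single_of_notMem (by simpa using hp), translation_single,
      Maya.shiftDown_insert, Maya.sign_shiftDown]

theorem Maya.eq_vacuum {M : Maya} {c : ℤ} (h1 : ∀ p ≤ c, p ∈ M.black)
    (h2 : {p : ℤ | c < p ∧ p ∈ M.black}.ncard = 0) : M = Maya.vacuum c := by
  rw [Set.ncard_eq_zero (M.finite_above c)] at h2
  refine Maya.ext (Set.ext fun p => ⟨fun hp => ?_, h1 p⟩)
  by_contra hc
  have : p ∈ {p : ℤ | c < p ∧ p ∈ M.black} := ⟨not_le.mp hc, hp⟩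
  rw [h2] at this
  exact this

theorem Maya.sign_vacuum {c p : ℤ} (h : c ≤ p) : (Maya.vacuum c).sign p = 1 := by
  have : {q : ℤ | p < q ∧ q ∈ (Maya.vacuum c).black} = ∅ := by
    ext q
    simp only [mem_vacuum, Set.mem_ofPred_eq, Set.mem_empty_iff_false, iff_false]
    omega
  rw [sign, this, Set.ncard_empty, pow_zero]

theorem single_eq_smul_psi {M : Maya} {p : ℤ} (hp : p ∈ M.black) :
    (Finsupp.single M 1 : Fock) = M.sign p • psi p (Finsupp.single (M.erase p) 1) := by
  rw [psi_single_of_notMem (by simp), Maya.insert_erase hp, Maya.sign_erase hp,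
    if_neg (lt_irrefl p), one_mul, one_mul, Finsupp.smul_single, smul_eq_mul,
    Maya.sign_mul_self]

/-- On a Maya diagram with `k` beads above a filled half-line, `e_k` moves all `k` beads down by
one position and higher `e_j` vanish. Moving the `k` beads down amounts to adding a bead at the
bottom and translating everything. -/
theorem elementaryOp_single (w : ℤ) (k : ℕ) (M : Maya) (h1 : ∀ p ≤ w - 1, p ∈ M.black)
    (h2 : {p : ℤ | w - 1 < p ∧ p ∈ M.black}.ncard = k) :
    M.charge = w - 1 + k ∧ (∀ j, k < j → elementaryOp j (Finsupp.single M 1) = 0) ∧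
      elementaryOp k (Finsupp.single M 1) =
        (-1 : ℂ) ^ k • translation (psi w (Finsupp.single M 1)) := by
  induction k generalizing M with
  | zero =>
    obtain rfl := Maya.eq_vacuum h1 h2
    refine ⟨by rw [Maya.charge_vacuum]; simp, fun j hj =>
      elementaryOp_eq_zero (fun i hi => alphaOp_vacuum hi _) hj, ?_⟩
    have h : (Maya.vacuum (w - 1)).insert w = Maya.vacuum w :=
      Maya.ext (Set.ext fun q => by simp only [Maya.mem_insert, Maya.mem_vacuum]; omega)
    rw [elementaryOp_zero, pow_zero, one_smul, psi_single_of_notMem (by simp), h,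
      translation_single, Maya.shiftDown_vacuum, Maya.sign_vacuum (by omega), one_mul]
    rfl
  | succ k ih =>
    obtain ⟨p, hp⟩ := Set.nonempty_of_ncard_ne_zero (h2.trans_ne k.succ_ne_zero)
    have hcard : {q : ℤ | w - 1 < q ∧ q ∈ (M.erase p).black}.ncard = k := by
      have : {q : ℤ | w - 1 < q ∧ q ∈ (M.erase p).black} =
          {q : ℤ | w - 1 < q ∧ q ∈ M.black} \ {p} := by
        ext q
        simp only [Maya.mem_erase, Set.mem_ofPred_eq, Set.mem_sdiff, Set.mem_singleton_iff]
        tauto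
      rw [this, Set.ncard_sdiff_singleton_of_mem hp, h2, Nat.add_sub_cancel]
    obtain ⟨h3, h4, h5⟩ := ih (M.erase p)
      (fun q hq => Maya.mem_erase.mpr ⟨h1 q hq, by have := hp.1; omega⟩) hcard
    refine ⟨?_, fun j hj => ?_, ?_⟩
    · rw [Maya.charge, Maya.weight_erase _ hp.2] at h3
      rw [Maya.charge]
      push_cast
      omega
    · obtain ⟨j, rfl⟩ : ∃ i, j = i + 1 := ⟨j - 1, by omega⟩
      rw [single_eq_smul_psi hp.2, map_smul, elementaryOp_succ_psi, h4 _ (by omega),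
        h4 _ (by omega), map_zero, map_zero, add_zero, smul_zero]
    · have hanti := congrArg (fun T : Module.End ℂ Fock => T (Finsupp.single (M.erase p) 1))
        (psi_mul_psi w p)
      simp only [Module.End.mul_apply, LinearMap.neg_apply] at hanti
      rw [single_eq_smul_psi hp.2, map_smul, elementaryOp_succ_psi, h4 _ (by omega), h5,
        map_zero, zero_add, map_smul, ← translation_psi, map_smul, map_smul, hanti, map_neg,
        pow_succ]
      module

/-- Operators that agree on the diagrams in the support of `v` agree on `v`. -/
theorem Fock.map_eq_of_support {S T : Module.End ℂ Fock} {v : Fock}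
    (h : ∀ M, v M ≠ 0 → S (Finsupp.single M 1) = T (Finsupp.single M 1)) : S v = T v := by
  rw [← Finsupp.sum_single v, Finsupp.sum, map_sum, map_sum]
  refine Finset.sum_congr rfl fun M hM => ?_
  rw [← mul_one (v M), ← smul_eq_mul, ← Finsupp.smul_single, map_smul, map_smul,
    h M (Finsupp.mem_support_iff.mp hM)]

/-- If `ψ_p v = 0` then `p` is black in every diagram of the support of `v`, because `ψ_p` maps the
diagrams that are white at `p` injectively to diagrams, up to sign. -/
theorem mem_black_of_psi_eq_zero {p : ℤ} {v : Fock} (h : psi p v = 0) {M : Maya} (hM : v M ≠ 0) :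
    p ∈ M.black := by
  by_contra hp
  have h' := Fock.form_psi p v (Finsupp.single (M.insert p) 1)
  rw [h, map_zero, LinearMap.zero_apply, psiStar_single_of_mem (by simp), Maya.erase_insert hp,
    one_mul, ← mul_one (Maya.sign _ _), ← smul_eq_mul, ← Finsupp.smul_single, map_smul,
    Fock.form_single_right, smul_eq_mul] at h'
  exact (mul_ne_zero (Maya.sign_ne_zero _ _) hM) h'.symm

/-- The singular vectors of charge `h` are the multiples of the vacuum: a singular vector is
annihilated by `e_k` for `k > 0`, which forces the diagrams in its support to be black at one
position after another up to `h`. -/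
theorem eq_vacuum_of_singular {h : ℤ} {v : Fock} (hv : v ∈ chargeSector h)
    (hsing : ∀ k : ℤ, 0 < k → alphaOp k v = 0) {M : Maya} (hM : v M ≠ 0) : M = Maya.vacuum h := by
  rw [mem_chargeSector_iff] at hv
  obtain ⟨L, hL, -⟩ := exists_annihilation_bound v
  have hfill : ∀ w, min (-(L : ℤ)) (h + 1) ≤ w → w ≤ h + 1 → ∀ M, v M ≠ 0 → ∀ p ≤ w - 1,
      p ∈ M.black := by
    intro w hw
    induction w, hw using Int.leInduction with
    | base =>
      exact fun _ M hM p hp => mem_black_of_psi_eq_zero (hL p (by omega)) hM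
    | succ w hw ih =>
      intro hwh M hM p hp
      have ih' := ih (by omega)
      -- a diagram of charge `h` filled below `w` has exactly `h + 1 - w` beads from `w` on
      have hk : 0 < (h + 1 - w).toNat := by omega
      have he : elementaryOp (h + 1 - w).toNat v =
          ((-1 : ℂ) ^ (h + 1 - w).toNat • (translation * psi w)) v := by
        refine Fock.map_eq_of_support fun M hM => ?_
        obtain ⟨h3, -, h5⟩ := elementaryOp_single w _ M (ih' M hM) rfl
        rw [hv M hM] at h3
        have : (h + 1 - w).toNat = {p : ℤ | w - 1 < p ∧ p ∈ M.black}.ncard := by omega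
        rw [this, h5]
        rfl
      rw [elementaryOp_eq_zero hsing hk, LinearMap.smul_apply, eq_comm] at he
      have h0 := (smul_eq_zero.mp he).resolve_left (pow_ne_zero _ (by norm_num))
      have hpsi : psi w v = 0 := translation_injective (h0.trans (map_zero _).symm)
      rcases (show p ≤ w - 1 ∨ p = w by omega) with hp' | rfl
      · exact ih' M hM p hp'
      · exact mem_black_of_psi_eq_zero hpsi hM
  have hfull := hfill (h + 1) (min_le_right _ _) le_rfl M hM
  obtain ⟨h3, -, -⟩ := elementaryOp_single (h + 1) _ M hfull rfl
  rw [hv M hM] at h3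
  rw [add_sub_cancel_right] at hfull h3
  exact Maya.eq_vacuum hfull (by omega)

/-! ### Irreducibility of the charge sectors -/

theorem levelOp_apply (ℓ : ℕ) (v : Fock) (M : Maya) :
    levelOp ℓ v M = -(M.level ℓ : ℂ) * v M := by
  induction v using Finsupp.induction_linear with
  | zero => simp
  | add u v hu hv => simp only [map_add, Finsupp.add_apply, hu, hv, mul_add]
  | single M' a =>
    rw [levelOp_single, Finsupp.smul_apply, smul_eq_mul]
    by_cases h : M = M'
    · rw [h]
    · rw [Finsupp.single_eq_of_ne h, mul_zero, mul_zero]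

/-- The level for `ℓ = 1`, which for a charged partition is the number of all boxes, is lowered by
`k` under `α_k`. -/
theorem level_one_of_alphaOp_single {k : ℤ} {M M' : Maya}
    (h : alphaOp k (Finsupp.single M 1) M' ≠ 0) :
    M'.level 1 = M.level 1 - k ∧ M'.charge = M.charge := by
  constructor
  · have hcomm := levelOp_lie_bandAct 1 (a := shiftBand k) (b := (k : ℂ) • shiftBand k)
      (fun m n => by
        change (k : ℂ) * (shiftBand k).1 m n = _
        rw [shiftBand_apply, blockNumber, blockNumber]
        split_ifs with h
        · subst h
          simp
        · simp) (Finsupp.single M 1)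
    rw [bandAct_smul, levelOp_single, map_smul] at hcomm
    have h' := congrArg (fun v : Fock => v M') hcomm
    simp only [Finsupp.sub_apply, Finsupp.smul_apply, LinearMap.smul_apply, levelOp_apply,
      smul_eq_mul] at h'
    have h2 : ((M'.level 1 : ℤ) : ℂ) = ((M.level 1 - k : ℤ) : ℂ) := by
      refine mul_right_cancel₀ h ?_
      push_cast
      rw [alphaOp]
      linear_combination -h'
    exact_mod_cast h2
  · exact mem_chargeSector_iff.mp
      (bandAct_mem_chargeSector (shiftBand k) (single_mem_chargeSector M)) M' h

theorem exists_of_alphaOp_apply_ne_zero {k : ℤ} {v : Fock} {M' : Maya}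
    (h : alphaOp k v M' ≠ 0) : ∃ M, v M ≠ 0 ∧ M'.level 1 = M.level 1 - k := by
  by_contra! hne
  refine h ?_
  rw [← Finsupp.sum_single v, Finsupp.sum, map_sum, Finsupp.finsetSum_apply]
  refine Finset.sum_eq_zero fun M hM => ?_
  rw [← mul_one (v M), ← smul_eq_mul, ← Finsupp.smul_single, map_smul, Finsupp.smul_apply]
  by_contra h0
  exact hne M (Finsupp.mem_support_iff.mp hM)
    (level_one_of_alphaOp_single (right_ne_zero_of_smul h0)).1

theorem level_one_nonneg (M : Maya) : 0 ≤ M.level 1 := by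
  obtain ⟨lam, hlam⟩ := exists_eq_ofPartition M
  rw [hlam, level_ofPartition one_pos]
  exact Int.natCast_nonneg _

theorem YoungDiagram.finite_card_eq (n : ℕ) : {lam : YoungDiagram | lam.card = n}.Finite := by
  refine Set.Finite.of_injOn (f := YoungDiagram.cells)
    (t := (Finset.range n ×ˢ Finset.range n).powerset) ?_
    (fun lam _ mu _ h => YoungDiagram.ext h) (Finset.finite_toSet _)
  rintro lam rfl
  rw [Finset.mem_coe, Finset.mem_powerset]
  rintro ⟨r, s⟩ hrs
  rw [YoungDiagram.mem_cells] at hrs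
  rw [Finset.mem_product, Finset.mem_range, Finset.mem_range]
  constructor
  · refine (YoungDiagram.mem_iff_lt_colLen.mp hrs).trans_le ?_
    rw [YoungDiagram.colLen_eq_card]
    exact Finset.card_le_card (Finset.filter_subset _ _)
  · refine (YoungDiagram.mem_iff_lt_rowLen.mp hrs).trans_le ?_
    rw [YoungDiagram.rowLen_eq_card]
    exact Finset.card_le_card (Finset.filter_subset _ _)

/-- There are finitely many partitions of a given size, hence finitely many Maya diagrams of given
charge and level. -/
theorem finite_charge_level (h : ℤ) (n : ℕ) :
    {M : Maya | M.charge = h ∧ M.level 1 = n}.Finite := by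
  refine ((YoungDiagram.finite_card_eq n).image fun lam => Maya.ofPartition lam h).subset ?_
  rintro M ⟨rfl, hn⟩
  obtain ⟨lam, hlam⟩ := exists_eq_ofPartition M
  refine ⟨lam, ?_, hlam.symm⟩
  rw [hlam, level_ofPartition one_pos] at hn
  rw [Set.mem_ofPred_eq, YoungDiagram.card]
  rw [numZeroBoxes, Finset.filter_true_of_mem fun b _ => by simp] at hn
  exact_mod_cast hn

variable {h : ℤ} {U : Submodule ℂ Fock}

theorem eq_smul_vacuum_of_singular {v : Fock} (hv : v ∈ chargeSector h)
    (hsing : ∀ k : ℤ, 0 < k → alphaOp k v = 0) :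
    v = v (Maya.vacuum h) • Finsupp.single (Maya.vacuum h) 1 := by
  refine Finsupp.ext fun M => ?_
  rw [Finsupp.smul_apply, smul_eq_mul]
  by_cases hM : M = Maya.vacuum h
  · rw [hM, Finsupp.single_eq_same, mul_one]
  · rw [Finsupp.single_eq_of_ne hM, mul_zero]
    by_contra h0
    exact hM (eq_vacuum_of_singular hv hsing h0)

/-- Applying the `α_k` with `k > 0` as long as the result is nonzero leads to the vacuum. -/
theorem vacuum_mem_of_isInvariant (hU : U ≤ chargeSector h)
    (hinv : ∀ k ≠ 0, ∀ v ∈ U, alphaOp k v ∈ U) (hne : U ≠ ⊥) :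
    Finsupp.single (Maya.vacuum h) 1 ∈ U := by
  have key : ∀ N : ℕ, ∀ v ∈ U, v ≠ 0 → (∀ M, v M ≠ 0 → M.level 1 < N) →
      Finsupp.single (Maya.vacuum h) 1 ∈ U := by
    intro N
    induction N with
    | zero =>
      intro v _ hv0 hlevel
      obtain ⟨M, hM⟩ := Finsupp.ne_iff.mp hv0
      have h1 := hlevel M hM
      have h2 := level_one_nonneg M
      omega
    | succ N ih =>
      intro v hv hv0 hlevel
      by_cases hsing : ∀ k : ℤ, 0 < k → alphaOp k v = 0
      · have hvac := eq_smul_vacuum_of_singular (hU hv) hsing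
        have hc : v (Maya.vacuum h) ≠ 0 := fun h0 => hv0 (by rw [hvac, h0, zero_smul])
        rw [hvac] at hv
        exact (Submodule.smul_mem_iff U hc).mp hv
      · push Not at hsing
        obtain ⟨k, hk, hk0⟩ := hsing
        refine ih _ (hinv k hk.ne' v hv) hk0 fun M hM => ?_
        obtain ⟨M', hM', heq⟩ := exists_of_alphaOp_apply_ne_zero hM
        have := hlevel M' hM'
        push_cast at this
        omega
  obtain ⟨v, hv, hv0⟩ := (Submodule.ne_bot_iff U).mp hne
  obtain ⟨b, hb⟩ := (v.support.image fun M => M.level 1).bddAbove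
  refine key (b + 1).toNat v hv hv0 fun M hM => ?_
  have := hb (Finset.mem_coe.mpr (Finset.mem_image_of_mem (fun M => M.level 1)
    (Finsupp.mem_support_iff.mpr hM)))
  have h0 := level_one_nonneg M
  omega

/-- A subspace containing the vacuum and invariant under the Heisenberg operators contains every
diagram. Otherwise, in the least level where this fails, the values of a functional vanishing
on the subspace would be the coefficients of a singular vector, because `α_k` and `α_{-k}` are
transposes of each other. -/
theorem single_mem_of_isInvariant (hinv : ∀ k ≠ 0, ∀ v ∈ U, alphaOp k v ∈ U)
    (hvac : Finsupp.single (Maya.vacuum h) 1 ∈ U) (n : ℕ) :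
    ∀ M : Maya, M.charge = h → M.level 1 = n → Finsupp.single M 1 ∈ U := by
  induction n using Nat.strong_induction_on with
  | _ n ih =>
    intro M₀ hc hn
    by_contra hM₀
    obtain ⟨φ, hφ, hφU⟩ := Submodule.exists_le_ker_of_notMem hM₀
    -- `v` represents the restriction of `φ` to level `n` with respect to the bilinear form
    set F := (finite_charge_level h n).toFinset with hF
    set v : Fock := ∑ M ∈ F, φ (Finsupp.single M 1) • Finsupp.single M 1 with hv
    have hvF : ∀ M ∈ F, v M = φ (Finsupp.single M 1) := fun M hM => by
      rw [hv, Finsupp.finsetSum_apply, Finset.sum_eq_single M]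
      · simp
      · intro M' _ hne
        rw [Finsupp.smul_apply, Finsupp.single_eq_of_ne hne.symm, smul_zero]
      · exact fun h' => absurd hM h'
    have hmemF : ∀ M, M ∈ F ↔ M.charge = h ∧ M.level 1 = n := fun M => by
      rw [hF, Set.Finite.mem_toFinset]; rfl
    have hvh : v ∈ chargeSector h := sum_mem fun M hM => Submodule.smul_mem _ _ (by
      rw [← ((hmemF M).mp hM).1]
      exact single_mem_chargeSector M)
    have hsing : ∀ k : ℤ, 0 < k → alphaOp k v = 0 := fun k hk => by
      refine Finsupp.ext fun M' => ?_
      rw [← Fock.form_single_right, Fock.form_alphaOp hk.ne', hv, map_sum, LinearMap.sum_apply]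
      simp only [map_smul, LinearMap.smul_apply, Fock.form_single_left, smul_eq_mul]
      by_contra hne
      obtain ⟨M, hM, hMne⟩ := Finset.exists_ne_zero_of_sum_ne_zero hne
      obtain ⟨hl, hch⟩ := level_one_of_alphaOp_single (right_ne_zero_of_mul hMne)
      obtain ⟨hM1, hM2⟩ := (hmemF M).mp hM
      have h0 := level_one_nonneg M'
      have hM'U : alphaOp (-k) (Finsupp.single M' 1) ∈ U :=
        hinv (-k) (by omega) _ (ih (M'.level 1).toNat (by omega) M' (by omega) (by omega))
      -- the coefficient of `M'` in `α_k v` is `φ (α_{-k} M')`, which vanishes by minimality of `n`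
      refine hne ((Eq.trans ?_ (LinearMap.mem_ker.mp (hφU hM'U))))
      conv_rhs => rw [← Finsupp.sum_single (alphaOp (-k) (Finsupp.single M' 1))]
      rw [Finsupp.sum, map_sum]
      symm
      refine (Finset.sum_congr rfl fun M₁ _ => ?_).trans
        (Finset.sum_subset (fun M₁ hM₁ => ?_) fun M₁ _ hM₁ => ?_)
      · rw [← mul_one (alphaOp (-k) _ _), ← smul_eq_mul, ← Finsupp.smul_single, map_smul,
          smul_eq_mul, mul_comm, smul_eq_mul, mul_one]
      · obtain ⟨hl₁, hch₁⟩ := level_one_of_alphaOp_single (Finsupp.mem_support_iff.mp hM₁)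
        exact (hmemF M₁).mpr ⟨by omega, by omega⟩
      · rw [Finsupp.notMem_support_iff.mp hM₁, mul_zero]
    have hM₀F : v M₀ ≠ 0 := by
      rw [hvF M₀ ((hmemF M₀).mpr ⟨hc, hn⟩)]
      exact hφ
    exact hM₀ (eq_vacuum_of_singular hvh hsing hM₀F ▸ hvac)

theorem eq_bot_or_eq_of_isInvariant (hU : U ≤ chargeSector h)
    (hinv : ∀ k ≠ 0, ∀ v ∈ U, alphaOp k v ∈ U) : U = ⊥ ∨ U = chargeSector h := by
  refine or_iff_not_imp_left.mpr fun hne => le_antisymm hU (Submodule.span_le.mpr ?_)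
  rintro _ ⟨lam, rfl⟩
  have hl := level_ofPartition one_pos lam h
  exact single_mem_of_isInvariant hinv (vacuum_mem_of_isInvariant hU hinv hne) _ _
    (charge_ofPartition lam h) hl

/-- The charge sectors are irreducible already under the Heisenberg operators. -/
theorem affineAct_isIrreducibleOn (ℓ : ℕ) [NeZero ℓ] (h : ℤ) :
    IsIrreducibleOn (affineAct ℓ) (chargeSector h) := by
  constructor
  · refine (Submodule.ne_bot_iff _).mpr ⟨ket ⊥ h, Submodule.subset_span ⟨⊥, rfl⟩, ?_⟩
    exact Finsupp.single_ne_zero.mpr one_ne_zero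
  · refine fun U hU hpres => eq_bot_or_eq_of_isInvariant hU fun k _ v hv => ?_
    rw [← affineAct_heisenberg ℓ k]
    exact hpres _ v hv

end

theorem mainTheorem1 (ℓ : ℕ) (hℓ : 0 < ℓ) :
    ∃ (Φ : AffineGL.glPrime ℓ →ₗ⁅ℂ⁆ AInf) (π : AInf →ₗ⁅ℂ⁆ Module.End ℂ Fock)
      (ρ : AffineGL ℓ →ₗ⁅ℂ⁆ Module.End ℂ Fock),
      -- the embedding into `a_∞`
      Function.Injective Φ ∧
      Φ ⟨AffineGL.c, AffineGL.c_mem_glPrime⟩ = AInf.c ∧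
      (∀ (i j : Fin ℓ) (m : ℤ),
        Φ ⟨AffineGL.mono (AffineGL.unit i j) m, AffineGL.mono_mem_glPrime _ m⟩ =
          AInf.blockSum i j m) ∧
      -- the standard action of `a_∞` on Fock space, which embeds it into the completed Clifford
      -- algebra
      (∀ (x : AInf) (v : Fock),
        {mn : ℤ × ℤ | x.mat.1 mn.1 mn.2 • normalOrdered mn.1 mn.2 v ≠ 0}.Finite ∧
        π x v = x.central • v +
          ∑ᶠ mn : ℤ × ℤ, x.mat.1 mn.1 mn.2 • normalOrdered mn.1 mn.2 v) ∧
      Function.Injective π ∧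
      (∀ x : AInf, π x ∈ cliffordCompletion) ∧
      -- the resulting action, in which `c` acts as `1`
      (∀ x : AffineGL.glPrime ℓ, ρ (x : AffineGL ℓ) = π (Φ x)) ∧
      ρ AffineGL.c = 1 ∧
      -- it agrees with the action of the affine algebra of `sl_ℓ` given by the same formula
      (∀ θ : AffineGL.slPrime ℓ →ₗ[ℂ] AInf,
        θ ⟨AffineGL.c, AffineGL.c_mem_slPrime⟩ = AInf.c →
        (∀ (X : GLie ℓ) (hX : X.trace = 0) (m : ℤ),
          θ ⟨AffineGL.mono X m, AffineGL.mono_mem_slPrime hX m⟩ =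
            ∑ i : Fin ℓ, ∑ j : Fin ℓ, X i j • AInf.blockSum i j m) →
        ∀ y : AffineGL.slPrime ℓ, ρ (y : AffineGL ℓ) = π (θ y)) ∧
      -- the action of `d`
      (∀ (lam : YoungDiagram) (h : ℤ),
        ρ AffineGL.d (ket lam h) = (-(numZeroBoxes ℓ lam h : ℂ)) • ket lam h) ∧
      -- the charge sectors
      (∀ h : ℤ, IsPreserved ρ (chargeSector h) ∧ IsIrreducibleOn ρ (chargeSector h)) ∧
      -- the Heisenberg generators
      (∀ k : ℤ, k ≠ 0 → ∀ v : Fock,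
        {m : ℤ | psi m (psiStar (m + k) v) ≠ 0}.Finite ∧
        ρ (AffineGL.heisenberg ℓ k) v = alphaApply k v) ∧
      (∀ j k : ℤ, j ≠ 0 → k ≠ 0 →
        ⁅ρ (AffineGL.heisenberg ℓ j), ρ (AffineGL.heisenberg ℓ k)⁆ =
          if j = -k then (j : ℂ) • (1 : Module.End ℂ Fock) else 0) := by
  have : NeZero ℓ := ⟨hℓ.ne'⟩
  refine ⟨affineEmbedding ℓ, aInfAct, affineAct ℓ, affineEmbedding_injective,
    affineEmbedding_c, affineEmbedding_mono_unit,
    fun x v => ⟨finite_support_act x.mat v, rfl⟩, aInfAct_injective,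
    aInfAct_mem_cliffordCompletion, affineAct_glPrime ℓ, affineAct_c ℓ,
    fun θ hc hθ y => ?_, affineAct_d ℓ,
    fun h => ⟨affineAct_isPreserved ℓ h, affineAct_isIrreducibleOn ℓ h⟩,
    fun k hk v => ?_, fun j k _ _ => ?_⟩
  · rw [eq_of_agrees_on_sl θ hc hθ y]
    exact affineAct_glPrime ℓ ⟨y.1, AffineGL.slPrime_le_glPrime y.2⟩
  · rw [affineAct_heisenberg]
    exact finsum_alpha_term k hk v
  · rw [affineAct_heisenberg, affineAct_heisenberg]
    exact alphaOp_lie j k
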